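/- Let $\Gamma$ be a finite simply laced Coxeter graph (a finite simple graph with vertex set $V$; adjacent vertices have label $3$ and distinct non-adjacent vertices have label $2$). Let $A_\Gamma$ be its zig-zag algebra over $\mathbb{C}$: the algebra generated by orthogonal idempotents $e_i$ ($i\in V$) with $\sum_i e_i=1$, by the arrows $(i|j)=e_i(i|j)e_j$ for all ordered pairs of adjacent vertices, and by loops $x_i=e_ix_ie_i$, with relations $(i|j)(j|k)=0$ for $i\neq k$, $(i|j)(j|i)=x_i$ for every neighbour $j$ of $i$ (so all paths of length two from $i$ back to $i$ are equal), and $x_i(i|j)=0$, $(i|j)x_j=0$, $x_i^2=0$ (so there are no nonzero paths of length $\geq 3$). It is graded by path length: $\deg e_i=0$, $\deg (i|j)=1$, $\deg x_i=2$. (At a vertex with at least one neighbour the generator $x_i$ is redundant; an isolated vertex contributes a factor $\mathbb{C}[x]/x^2$.) Bimodules and modules are $\mathbb{Z}$-graded, morphisms preserve degrees, and $M\langle k\rangle_n=M_{n-k}$. Put $P_i=A_\Gamma e_i$, $Q_i=e_iA_\Gamma$ and consider the complexes of graded $A_\Gamma$-bimodules $$\Sigma_i=\big(P_i\otimes_{\mathbb{C}}Q_i\xrightarrow{\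 f\ }A_\Gamma\big),\qquad \Sigma_i^{-1}=\big(A_\Gamma\xrightarrow{\ g\ }P_i\otimes_{\mathbb{C}}Q_i\langle-2\rangle\big),$$ with $A_\Gamma$ in cohomological degree $0$ and $P_i\otimes_{\mathbb{C}} Q_i$ (resp. $P_i\otimes_{\mathbb{C}} Q_i\langle -2\rangle$) in degree $-1$ (resp. $1$), where $f$ and $g$ are the bimodule maps with $f(e_i\otimes e_i)=e_i$ and $g(1)=x_i\otimes e_i+\sum_{j \text{ adjacent to } i}(j|i)\otimes(i|j)+e_i\otimes x_i$. Then there are homotopy equivalences of complexes of graded $A_\Gamma$-bimodules 1. $\Sigma_i\otimes_{A_\Gamma}\Sigma_i^{-1}\simeq A_\Gamma\simeq\Sigma_i^{-1}\otimes_{A_\Gamma}\Sigma_i$ for every $i$; 2. $\Sigma_i\otimes_{A_\Gamma}\Sigma_j\otimes_{A_\Gamma}\Sigma_i\simeq\Sigma_j\otimes_{A_\Gamma}\Sigma_i\otimes_{A_\Gamma}\Sigma_j$ if $i$ and $j$ are adjacent; 3. $\Sigma_i\otimes_{A_\Gamma}\Sigma_j\simeq\Sigma_j\otimes_{A_\Gamma}\Sigma_i$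 if $i\neq j$ are not adjacent. Consequently the Artin–Tits group $\mathbf{B}(\Gamma)$ (generators $\sigma_i$, $i\in V$; relations $\sigma_i\sigma_j\sigma_i=\sigma_j\sigma_i\sigma_j$ for adjacent $i,j$, and $\sigma_i\sigma_j=\sigma_j\sigma_i$ for distinct non-adjacent $i,j$) acts weakly on the bounded homotopy category $\mathcal{C}_\Gamma=K^b(A_\Gamma\text{-}\mathrm{pmod})$ of finitely generated projective graded left $A_\Gamma$-modules: the functors $\Sigma_i\otimes_{A_\Gamma}-$ and $\Sigma_i^{-1}\otimes_{A_\Gamma}-$ restrict to mutually quasi-inverse autoequivalences of $\mathcal{C}_\Gamma$, and there is a group homomorphism from $\mathbf{B}(\Gamma)$ to the group of autoequivalences of $\mathcal{C}_\Gamma$ up to natural isomorphism sending $\sigma_i$ to the class of $\Sigma_i\otimes_{A_\Gamma}-$ (hence $\sigma_i^{-1}$ to the class of $\Sigma_i^{-1}\otimes_{A_\Gamma}-$). -/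

import Mathlib

open CategoryTheory Limits TensorProduct

universe w v₁ v₂ v₃ u

noncomputable section

namespace ZigZag

/-! ### Gradings -/

section Grading

variable {M : Type*} [AddCommGroup M] [Module ℂ M]

/-- A criterion for a family of subspaces to be a grading. -/
lemma isInternal_of {gr : ℤ → Submodule ℂ M} (hsup : ∀ x, x ∈ iSup gr) {X : ℤ → Type*}
    [∀ i, AddCommGroup (X i)] [∀ i, Module ℂ (X i)] (D : ∀ i, M →ₗ[ℂ] X i)
    (h0 : ∀ i j, i ≠ j → ∀ x ∈ gr j, D i x = 0)
    (hinj : ∀ i, ∀ x ∈ gr i, D i x = 0 → x = 0) : DirectSum.IsInternal gr := by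
  rw [DirectSum.isInternal_submodule_iff_iSupIndep_and_iSup_eq_top]
  refine ⟨?_, eq_top_iff.2 fun x _ => hsup x⟩
  intro i
  rw [Submodule.disjoint_def]
  intro x hx hx'
  apply hinj i x hx
  have : (⨆ j, ⨆ (_ : j ≠ i), gr j) ≤ LinearMap.ker (D i) :=
    iSup₂_le fun j hj x hx => h0 i j hj.symm x hx
  exact this hx'

variable {gr : ℤ → Submodule ℂ M} (h : DirectSum.IsInternal gr)

/-- A graded vector space is isomorphic to the direct sum of its homogeneous parts. -/
def gradedEquiv : (DirectSum ℤ fun n => gr n) ≃ₗ[ℂ] M :=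
  have hb : Function.Bijective (DirectSum.coeLinearMap gr) := h
  LinearEquiv.ofBijective (DirectSum.coeLinearMap gr) hb

/-- The decomposition of an element of a graded vector space into its homogeneous components. -/
def comps : M →ₗ[ℂ] (ℤ →₀ M) :=
  (DirectSum.toModule ℂ ℤ (ℤ →₀ M) fun n => Finsupp.lsingle n ∘ₗ (gr n).subtype) ∘ₗ
    (gradedEquiv h).symm.toLinearMap

lemma comps_of_mem {n : ℤ} {x : M} (hx : x ∈ gr n) : comps h x = Finsupp.single n x := by
  have : (gradedEquiv h).symm x = DirectSum.lof ℂ ℤ (fun n => gr n) n ⟨x, hx⟩ := by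
    rw [LinearEquiv.symm_apply_eq]
    change x = DirectSum.coeLinearMap gr _
    rw [DirectSum.coeLinearMap_lof]
  simp [comps, this]

@[elab_as_elim]
lemma gr_induction {gr : ℤ → Submodule ℂ M} (h : DirectSum.IsInternal gr) {p : M → Prop} (x : M) (hom : ∀ n, ∀ x ∈ gr n, p x)
    (zero : p 0) (add : ∀ x y, p x → p y → p (x + y)) : p x := by
  have hx : x ∈ iSup gr := by rw [h.submodule_iSup_eq_top]; trivial
  exact Submodule.iSup_induction gr (motive := p) hx hom zero add

end Grading

/-! ### Graded bimodules -/

section Bimod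

variable {A : Type v₁} [Ring A] [Algebra ℂ A] {B : Type v₂} [Ring B] [Algebra ℂ B]
  {C : Type v₃} [Ring C] [Algebra ℂ C]

/-- A `ℤ`-graded `(A, B)`-bimodule over `ℂ`-algebras `A` and `B` with gradings `𝒜` and `ℬ`: a
complex vector space which is the direct sum of the subspaces `gr n`, with commuting left action
of `A` and right action of `B` compatible with the gradings. -/
structure GrBimod (𝒜 : ℤ → Submodule ℂ A) (ℬ : ℤ → Submodule ℂ B) where
  carrier : Type w
  [addCommGroup : AddCommGroup carrier]
  [module : Module ℂ carrier]
  gr : ℤ → Submodule ℂ carrier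
  isInternal : DirectSum.IsInternal gr
  lact : A →ₐ[ℂ] Module.End ℂ carrier
  ract : Bᵐᵒᵖ →ₐ[ℂ] Module.End ℂ carrier
  act_comm : ∀ a b m, lact a (ract b m) = ract b (lact a m)
  lact_mem : ∀ {p n : ℤ} {a : A} {m : carrier}, a ∈ 𝒜 p → m ∈ gr n → lact a m ∈ gr (p + n)
  ract_mem : ∀ {q n : ℤ} {b : B} {m : carrier},
    b ∈ ℬ q → m ∈ gr n → ract (MulOpposite.op b) m ∈ gr (n + q)

attribute [instance] GrBimod.addCommGroup GrBimod.module

variable {𝒜 : ℤ → Submodule ℂ A} {ℬ : ℤ → Submodule ℂ B} {𝒞 : ℤ → Submodule ℂ C}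

namespace GrBimod

/-- The space of homomorphisms of graded bimodules (of degree `0`). -/
def homs (M N : GrBimod.{w} 𝒜 ℬ) : Submodule ℂ (M.carrier →ₗ[ℂ] N.carrier) where
  carrier := {f | (∀ a m, f (M.lact a m) = N.lact a (f m)) ∧
    (∀ b m, f (M.ract b m) = N.ract b (f m)) ∧ ∀ n, ∀ m ∈ M.gr n, f m ∈ N.gr n}
  zero_mem' := ⟨by simp, by simp, by simp⟩
  add_mem' := by
    rintro f g ⟨h1, h2, h3⟩ ⟨k1, k2, k3⟩
    exact ⟨by simp [h1, k1], by simp [h2, k2],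
      fun n m hm => add_mem (h3 n m hm) (k3 n m hm)⟩
  smul_mem' := by
    rintro c f ⟨h1, h2, h3⟩
    exact ⟨by simp [h1], by simp [h2], fun n m hm => Submodule.smul_mem _ _ (h3 n m hm)⟩

instance : Category (GrBimod.{w} 𝒜 ℬ) where
  Hom M N := homs M N
  id M := ⟨LinearMap.id, by simp, by simp, by simp⟩
  comp f g := ⟨g.1 ∘ₗ f.1, by simp [f.2.1, g.2.1], by simp [f.2.2.1, g.2.2.1],
    fun n m hm => g.2.2.2 n _ (f.2.2.2 n m hm)⟩

instance (M N : GrBimod.{w} 𝒜 ℬ) : AddCommGroup (M ⟶ N) :=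
  inferInstanceAs (AddCommGroup (homs M N))

/-- The linear map underlying a homomorphism. -/
def toLin {M N : GrBimod.{w} 𝒜 ℬ} (f : M ⟶ N) : M.carrier →ₗ[ℂ] N.carrier := f.1

/-- Constructor for homomorphisms. -/
def mkHom {M N : GrBimod.{w} 𝒜 ℬ} (f : M.carrier →ₗ[ℂ] N.carrier)
    (h1 : ∀ a m, f (M.lact a m) = N.lact a (f m)) (h2 : ∀ b m, f (M.ract b m) = N.ract b (f m))
    (h3 : ∀ n, ∀ m ∈ M.gr n, f m ∈ N.gr n) : M ⟶ N := ⟨f, h1, h2, h3⟩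

section

variable {M N K : GrBimod.{w} 𝒜 ℬ}

@[ext] lemma hom_ext {f g : M ⟶ N} (h : ∀ x, toLin f x = toLin g x) : f = g :=
  Subtype.ext (LinearMap.ext h)

@[simp] lemma toLin_id : toLin (𝟙 M) = LinearMap.id := rfl
@[simp] lemma toLin_comp (f : M ⟶ N) (g : N ⟶ K) : toLin (f ≫ g) = toLin g ∘ₗ toLin f := rfl
@[simp] lemma toLin_zero : toLin (0 : M ⟶ N) = 0 := rfl
@[simp] lemma toLin_add (f g : M ⟶ N) : toLin (f + g) = toLin f + toLin g := rfl
@[simp] lemma toLin_mkHom (f : M.carrier →ₗ[ℂ] N.carrier) (h1 h2 h3) :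
    toLin (mkHom f h1 h2 h3 : M ⟶ N) = f := rfl

lemma toLin_lact (f : M ⟶ N) (a m) : toLin f (M.lact a m) = N.lact a (toLin f m) := f.2.1 a m
lemma toLin_ract (f : M ⟶ N) (b m) : toLin f (M.ract b m) = N.ract b (toLin f m) := f.2.2.1 b m
lemma toLin_mem (f : M ⟶ N) {n m} (h : m ∈ M.gr n) : toLin f m ∈ N.gr n := f.2.2.2 n m h

end

instance : Preadditive (GrBimod.{w} 𝒜 ℬ) where
  add_comp _ _ _ f g h := by ext; simp
  comp_add _ _ _ f g h := by ext; simp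

/-! ### Zero object and coproducts -/

/-- The zero bimodule. -/
@[reducible] def zeroObj : GrBimod.{w} 𝒜 ℬ where
  carrier := PUnit
  gr _ := ⊥
  isInternal := isInternal_of (X := fun _ => ℂ) (fun x => by simp [Subsingleton.elim x 0])
    (fun _ => 0) (by simp) (fun _ _ _ _ => Subsingleton.elim _ _)
  lact :=
    { toFun := fun _ => 1
      map_one' := rfl
      map_mul' := fun _ _ => Subsingleton.elim _ _
      map_zero' := Subsingleton.elim _ _
      map_add' := fun _ _ => Subsingleton.elim _ _
      commutes' := fun _ => Subsingleton.elim _ _ }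
  ract :=
    { toFun := fun _ => 1
      map_one' := rfl
      map_mul' := fun _ _ => Subsingleton.elim _ _
      map_zero' := Subsingleton.elim _ _
      map_add' := fun _ _ => Subsingleton.elim _ _
      commutes' := fun _ => Subsingleton.elim _ _ }
  act_comm _ _ _ := rfl
  lact_mem _ _ := by simp
  ract_mem _ _ := by simp

instance : HasZeroObject (GrBimod.{w} 𝒜 ℬ) where
  zero := ⟨zeroObj, by
    rw [IsZero.iff_id_eq_zero]
    ext x⟩

/-- The direct sum of a family of graded bimodules, with the degreewise grading. -/
@[reducible] def directSum {J : Type} (M : J → GrBimod.{w} 𝒜 ℬ) : GrBimod.{w} 𝒜 ℬ where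
  carrier := Π₀ j, (M j).carrier
  gr n := ⨅ j, ((M j).gr n).comap (DFinsupp.lapply j)
  isInternal := by
    classical
    refine isInternal_of (X := fun _ => ∀ j, (M j).carrier) (fun x => ?_)
      (fun i => LinearMap.pi fun j => (Finsupp.lapply i ∘ₗ comps (M j).isInternal) ∘ₗ
        DFinsupp.lapply j) ?_ ?_
    · induction x using DFinsupp.induction with
      | h0 => exact zero_mem _
      | ha j b f _ _ ih =>
        refine add_mem ?_ ih
        refine gr_induction (M j).isInternal 
          (p := fun b => (DFinsupp.single j b : Π₀ j, (M j).carrier) ∈ _) b ?_ ?_ ?_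
        · intro n x hx
          refine Submodule.mem_iSup_of_mem n ?_
          simp only [Submodule.mem_iInf, Submodule.mem_comap, DFinsupp.lapply_apply]
          intro k
          by_cases hk : j = k
          · subst hk; simpa using hx
          · rw [DFinsupp.single_eq_of_ne (Ne.symm hk)]; exact zero_mem _
        · simp
        · intro x y hx hy
          rw [DFinsupp.single_add]
          exact add_mem hx hy
    · intro i j hij x hx
      simp only [Submodule.mem_iInf, Submodule.mem_comap, DFinsupp.lapply_apply] at hx
      ext k
      simp [comps_of_mem _ (hx k), Ne.symm hij]
    · intro i x hx h
      simp only [Submodule.mem_iInf, Submodule.mem_comap, DFinsupp.lapply_apply] at hx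
      ext k
      simpa [comps_of_mem _ (hx k)] using congr_fun h k
  lact :=
    { toFun := fun a => DFinsupp.mapRange.linearMap fun j => (M j).lact a
      map_one' := by ext; simp
      map_mul' := fun _ _ => by ext; simp
      map_zero' := by ext; simp
      map_add' := fun _ _ => by ext; simp
      commutes' := fun c => by
        ext x j
        simp }
  ract :=
    { toFun := fun a => DFinsupp.mapRange.linearMap fun j => (M j).ract a
      map_one' := by ext; simp
      map_mul' := fun _ _ => by ext; simp
      map_zero' := by ext; simp
      map_add' := fun _ _ => by ext; simp
      commutes' := fun c => by
        ext x j
        simpa using LinearMap.congr_fun ((M j).ract.commutes c) (x j) }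
  act_comm a b m := by ext j; simp [(M j).act_comm]
  lact_mem ha hm := by
    simp only [Submodule.mem_iInf, Submodule.mem_comap, DFinsupp.lapply_apply] at hm ⊢
    exact fun j => by simpa using (M j).lact_mem ha (hm j)
  ract_mem ha hm := by
    simp only [Submodule.mem_iInf, Submodule.mem_comap, DFinsupp.lapply_apply] at hm ⊢
    exact fun j => by simpa using (M j).ract_mem ha (hm j)

/-- The inclusion of a summand into the direct sum. -/
def directSumι {J : Type} (M : J → GrBimod.{w} 𝒜 ℬ) (j : J) : M j ⟶ directSum M :=
  letI := Classical.decEq J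
  mkHom (DFinsupp.lsingle (M := fun j => (M j).carrier) (R := ℂ) j)
    (fun a m => by simp)
    (fun a m => by simp)
    (fun n m hm => by
      simp only [Submodule.mem_iInf, Submodule.mem_comap, DFinsupp.lapply_apply]
      intro k
      by_cases hk : j = k
      · subst hk; simpa using hm
      · rw [DFinsupp.lsingle_apply, DFinsupp.single_eq_of_ne (Ne.symm hk)]; exact zero_mem _)

@[elab_as_elim]
lemma directSum_induction {J : Type} (M : J → GrBimod.{w} 𝒜 ℬ) {p : (directSum M).carrier → Prop}
    (x : (directSum M).carrier) (zero : p 0) (add : ∀ x y, p x → p y → p (x + y))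
    (single : ∀ j m, p (toLin (directSumι M j) m)) : p x := by
  classical
  induction x using DFinsupp.induction with
  | h0 => exact zero
  | ha j b f _ _ ih => exact add _ _ (single j b) ih

/-- The homomorphism out of a direct sum with given components. -/
def directSumDesc {J : Type} (M : J → GrBimod.{w} 𝒜 ℬ) {N : GrBimod.{w} 𝒜 ℬ}
    (f : ∀ j, M j ⟶ N) : directSum M ⟶ N :=
  letI := Classical.decEq J
  have key : ∀ j m, DFinsupp.lsum ℂ (fun j => toLin (f j)) (toLin (directSumι M j) m) =
      toLin (f j) m := fun j m => by
    change DFinsupp.lsum ℂ (fun j => toLin (f j)) (DFinsupp.single j m) = _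
    simp
  mkHom (DFinsupp.lsum ℂ fun j => toLin (f j))
    (fun a x => by
      refine directSum_induction M x ?_ (fun x y hx hy => ?_) fun j m => ?_
      · simp only [map_zero]
      · rw [map_add, map_add, hx, hy, map_add, map_add]
      · rw [← toLin_lact, key, key, toLin_lact])
    (fun a x => by
      refine directSum_induction M x ?_ (fun x y hx hy => ?_) fun j m => ?_
      · simp only [map_zero]
      · rw [map_add, map_add, hx, hy, map_add, map_add]
      · rw [← toLin_ract, key, key, toLin_ract])
    (fun n x hx => by
      simp only [Submodule.mem_iInf, Submodule.mem_comap, DFinsupp.lapply_apply] at hx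
      classical
      rw [DFinsupp.lsum_apply_apply, DFinsupp.sumAddHom_apply]
      exact Submodule.dfinsuppSum_mem _ _ _ fun j _ => toLin_mem (f j) (hx j))

lemma directSumι_desc {J : Type} (M : J → GrBimod.{w} 𝒜 ℬ) {N : GrBimod.{w} 𝒜 ℬ}
    (f : ∀ j, M j ⟶ N) (j : J) : directSumι M j ≫ directSumDesc M f = f j := by
  classical
  ext m
  change DFinsupp.lsum ℂ (fun j => toLin (f j)) (DFinsupp.single j m) = _
  simp

instance : HasCoproducts.{0} (GrBimod.{w} 𝒜 ℬ) :=
  hasCoproducts_of_colimit_cofans (fun M => Cofan.mk (directSum M) (directSumι M)) fun M =>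
    Cofan.IsColimit.mk _ (fun s => directSumDesc M s.inj)
      (fun s j => directSumι_desc M s.inj j)
      (fun s m hm => by
        ext x
        refine directSum_induction M x ?_ (fun x y hx hy => ?_) fun j y => ?_
        · rw [map_zero, map_zero]
        · rw [map_add, map_add, hx, hy]
        · have h1 : directSumι M j ≫ m = s.inj j := hm j
          have h2 := directSumι_desc M s.inj j
          exact LinearMap.congr_fun (congrArg toLin (h1.trans h2.symm)) y)

/-! ### The tensor product of graded bimodules -/

/-- The subspace of `M ⊗[ℂ] N` spanned by the elements `m b ⊗ n - m ⊗ b n`. -/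
def tensorRel (M : GrBimod.{w} 𝒜 ℬ) (N : GrBimod.{w} ℬ 𝒞) :
    Submodule ℂ (M.carrier ⊗[ℂ] N.carrier) :=
  Submodule.span ℂ {t | ∃ m b n, t = M.ract (MulOpposite.op b) m ⊗ₜ n - m ⊗ₜ N.lact b n}

/-- The underlying vector space of `M ⊗_B N`. -/
abbrev TensorCarrier (M : GrBimod.{w} 𝒜 ℬ) (N : GrBimod.{w} ℬ 𝒞) : Type w :=
  (M.carrier ⊗[ℂ] N.carrier) ⧸ tensorRel M N

/-- The class of a pure tensor in `M ⊗_B N`. -/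
def tmul {M : GrBimod.{w} 𝒜 ℬ} {N : GrBimod.{w} ℬ 𝒞} (m : M.carrier) (n : N.carrier) :
    TensorCarrier M N := (tensorRel M N).mkQ (m ⊗ₜ n)

section

variable {M : GrBimod.{w} 𝒜 ℬ} {N : GrBimod.{w} ℬ 𝒞}

lemma tmul_add (m : M.carrier) (n n' : N.carrier) : tmul m (n + n') = tmul m n + tmul m n' := by
  simp [tmul, TensorProduct.tmul_add]

lemma add_tmul (m m' : M.carrier) (n : N.carrier) : tmul (m + m') n = tmul m n + tmul m' n := by
  simp [tmul, TensorProduct.add_tmul]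

@[simp] lemma tmul_zero (m : M.carrier) : tmul m (0 : N.carrier) = 0 := by
  simp [tmul]

@[simp] lemma zero_tmul (n : N.carrier) : tmul (0 : M.carrier) n = 0 := by
  simp [tmul]

lemma ract_tmul (m : M.carrier) (b : B) (n : N.carrier) :
    tmul (M.ract (MulOpposite.op b) m) n = tmul m (N.lact b n) := by
  rw [tmul, tmul, ← sub_eq_zero, ← map_sub, Submodule.mkQ_apply, Submodule.Quotient.mk_eq_zero]
  exact Submodule.subset_span ⟨m, b, n, rfl⟩

@[elab_as_elim]
lemma tensor_induction {p : TensorCarrier M N → Prop} (x : TensorCarrier M N) (zero : p 0)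
    (tmul : ∀ m n, p (tmul m n)) (add : ∀ x y, p x → p y → p (x + y)) : p x := by
  obtain ⟨x, rfl⟩ := (tensorRel M N).mkQ_surjective x
  induction x with
  | zero => simpa using zero
  | tmul m n => exact tmul m n
  | add x y hx hy => rw [map_add]; exact add _ _ hx hy

/-- Linear maps out of `M ⊗_B N`. -/
def tensorLift {X : Type*} [AddCommGroup X] [Module ℂ X]
    (f : M.carrier →ₗ[ℂ] N.carrier →ₗ[ℂ] X)
    (hf : ∀ m b n, f (M.ract (MulOpposite.op b) m) n = f m (N.lact b n)) :
    TensorCarrier M N →ₗ[ℂ] X :=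
  (tensorRel M N).liftQ (TensorProduct.lift f) (by
    rw [tensorRel, Submodule.span_le]
    rintro _ ⟨m, b, n, rfl⟩
    simp [hf])

@[simp] lemma tensorLift_tmul {X : Type*} [AddCommGroup X] [Module ℂ X]
    (f : M.carrier →ₗ[ℂ] N.carrier →ₗ[ℂ] X) (hf) (m : M.carrier) (n : N.carrier) :
    tensorLift f hf (tmul m n) = f m n := by
  simp [tensorLift, tmul]

/-- The bilinear map `(m, n) ↦ m ⊗ n`. -/
def tmulBilin (M : GrBimod.{w} 𝒜 ℬ) (N : GrBimod.{w} ℬ 𝒞) :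
    M.carrier →ₗ[ℂ] N.carrier →ₗ[ℂ] TensorCarrier M N :=
  (TensorProduct.mk ℂ M.carrier N.carrier).compr₂ (tensorRel M N).mkQ

@[simp] lemma tmulBilin_apply (m : M.carrier) (n : N.carrier) :
    tmulBilin M N m n = tmul m n := rfl

/-- The grading of `M ⊗_B N`: degree `n` is spanned by the tensors `x ⊗ y` of homogeneous
elements with `deg x + deg y = n`. -/
def tensorGr (M : GrBimod.{w} 𝒜 ℬ) (N : GrBimod.{w} ℬ 𝒞) (n : ℤ) :
    Submodule ℂ (TensorCarrier M N) :=
  Submodule.span ℂ {t | ∃ p q, p + q = n ∧ ∃ x ∈ M.gr p, ∃ y ∈ N.gr q, t = tmul x y}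

lemma tmul_mem_tensorGr {p q n : ℤ} (h : p + q = n) {x : M.carrier} (hx : x ∈ M.gr p)
    {y : N.carrier} (hy : y ∈ N.gr q) : tmul x y ∈ tensorGr M N n :=
  Submodule.subset_span ⟨p, q, h, x, hx, y, hy, rfl⟩

/-- The bilinear map sending `(x, y)` to the homogeneous components of `x ⊗ y`. -/
def tensorCompsBilin (M : GrBimod.{w} 𝒜 ℬ) (N : GrBimod.{w} ℬ 𝒞) :
    M.carrier →ₗ[ℂ] N.carrier →ₗ[ℂ] (ℤ →₀ TensorCarrier M N) :=
  LinearMap.compl₁₂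
    (Finsupp.lsum ℂ fun p => LinearMap.flip (Finsupp.lsum ℂ fun q => LinearMap.flip
      ((tmulBilin M N).compr₂ (Finsupp.lsingle (p + q)))))
    (comps M.isInternal) (comps N.isInternal)

lemma tensorCompsBilin_of_mem {p q : ℤ} {x : M.carrier} (hx : x ∈ M.gr p)
    {y : N.carrier} (hy : y ∈ N.gr q) :
    tensorCompsBilin M N x y = Finsupp.single (p + q) (tmul x y) := by
  simp [tensorCompsBilin, comps_of_mem _ hx, comps_of_mem _ hy]

lemma tensorCompsBilin_balanced [GradedAlgebra ℬ] (m : M.carrier) (b : B) (n : N.carrier) :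
    tensorCompsBilin M N (M.ract (MulOpposite.op b) m) n =
      tensorCompsBilin M N m (N.lact b n) := by
  refine gr_induction M.isInternal m (fun i m hm => ?_) ?_ (fun x y hx hy => ?_)
  · refine gr_induction N.isInternal n (fun j n hn => ?_) (by simp) (fun x y hx hy => ?_)
    · refine gr_induction (DirectSum.Decomposition.isInternal ℬ) b (fun k b hb => ?_) (by simp)
        (fun x y hx hy => ?_)
      · rw [tensorCompsBilin_of_mem (M.ract_mem hb hm) hn,
          tensorCompsBilin_of_mem hm (N.lact_mem hb hn), ract_tmul, add_assoc]
      · simp only [MulOpposite.op_add, map_add, LinearMap.add_apply, hx, hy]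
    · simp only [map_add, hx, hy]
  · simp only [map_zero, LinearMap.zero_apply]
  · simp only [map_add, LinearMap.add_apply, hx, hy]

lemma tensor_isInternal [GradedAlgebra ℬ] (M : GrBimod.{w} 𝒜 ℬ) (N : GrBimod.{w} ℬ 𝒞) :
    DirectSum.IsInternal (tensorGr M N) := by
  have key : ∀ n, ∀ x ∈ tensorGr M N n,
      tensorLift (tensorCompsBilin M N) tensorCompsBilin_balanced x = Finsupp.single n x := by
    intro n x hx
    induction hx using Submodule.span_induction with
    | mem x hx =>
      obtain ⟨p, q, rfl, x, hx, y, hy, rfl⟩ := hx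
      rw [tensorLift_tmul, tensorCompsBilin_of_mem hx hy]
    | zero => simp
    | add x y _ _ hx hy => rw [map_add, hx, hy, Finsupp.single_add]
    | smul c x _ hx => rw [map_smul, hx, Finsupp.smul_single]
  refine isInternal_of (X := fun _ => TensorCarrier M N) (fun x => ?_)
    (fun i => Finsupp.lapply i ∘ₗ tensorLift (tensorCompsBilin M N) tensorCompsBilin_balanced)
    (fun i j hij x hx => ?_) (fun i x hx h => ?_)
  · refine tensor_induction x (zero_mem _) (fun m n => ?_) (fun x y => add_mem)
    refine gr_induction M.isInternal m (fun i m hm => ?_) ?_ (fun x y hx hy => ?_)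
    · refine gr_induction N.isInternal n (fun j n hn => ?_) (by simp) (fun x y hx hy => ?_)
      · exact Submodule.mem_iSup_of_mem (i + j) (tmul_mem_tensorGr rfl hm hn)
      · rw [tmul_add]; exact add_mem hx hy
    · rw [zero_tmul]; exact zero_mem _
    · rw [add_tmul]; exact add_mem hx hy
  · simp [key j x hx, hij.symm]
  · simpa [key i x hx] using h

/-- An algebra action descends to the quotient by a stable subspace. -/
def quotAct {R X : Type*} [Ring R] [Algebra ℂ R] [AddCommGroup X] [Module ℂ X]
    (φ : R →ₐ[ℂ] Module.End ℂ X) (S : Submodule ℂ X) (h : ∀ r, S ≤ S.comap (φ r)) :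
    R →ₐ[ℂ] Module.End ℂ (X ⧸ S) where
  toFun r := S.mapQ S (φ r) (h r)
  map_one' := by ext; simp
  map_mul' _ _ := by ext; simp
  map_zero' := by ext; simp
  map_add' _ _ := by ext; simp
  commutes' _ := by ext; simp [Module.algebraMap_end_apply]

end

/-- The tensor product `M ⊗_B N` of graded bimodules. -/
@[reducible] def tensor [GradedAlgebra ℬ] (M : GrBimod.{w} 𝒜 ℬ) (N : GrBimod.{w} ℬ 𝒞) :
    GrBimod.{w} 𝒜 𝒞 where
  carrier := TensorCarrier M N
  gr := tensorGr M N
  isInternal := tensor_isInternal M N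
  lact := quotAct ((Module.End.rTensorAlgHom ℂ M.carrier N.carrier).comp M.lact) (tensorRel M N)
    (fun a => by
      rw [tensorRel, Submodule.span_le]
      rintro _ ⟨m, b, n, rfl⟩
      refine Submodule.subset_span ⟨M.lact a m, b, n, ?_⟩
      rw [map_sub, ← M.act_comm]
      rfl)
  ract := quotAct ((Module.End.lTensorAlgHom ℂ N.carrier M.carrier).comp N.ract) (tensorRel M N)
    (fun c => by
      rw [tensorRel, Submodule.span_le]
      rintro _ ⟨m, b, n, rfl⟩
      refine Submodule.subset_span ⟨m, b, N.ract c n, ?_⟩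
      rw [map_sub, N.act_comm]
      rfl)
  act_comm a c x := by
    refine tensor_induction x ?_ (fun m n => ?_) (fun x y hx hy => ?_)
    · simp only [map_zero]
    · rfl
    · simp only [map_add, hx, hy]
  lact_mem {p n a x} ha hx := by
    induction hx using Submodule.span_induction with
    | mem x hx =>
      obtain ⟨i, j, rfl, x, hx, y, hy, rfl⟩ := hx
      exact tmul_mem_tensorGr (add_assoc _ _ _) (M.lact_mem ha hx) hy
    | zero => rw [map_zero]; exact zero_mem _
    | add x y _ _ hx hy => rw [map_add]; exact add_mem hx hy
    | smul c x _ hx => rw [map_smul]; exact Submodule.smul_mem _ _ hx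
  ract_mem {p n a x} ha hx := by
    induction hx using Submodule.span_induction with
    | mem x hx =>
      obtain ⟨i, j, rfl, x, hx, y, hy, rfl⟩ := hx
      exact tmul_mem_tensorGr (add_assoc _ _ _).symm hx (N.ract_mem ha hy)
    | zero => rw [map_zero]; exact zero_mem _
    | add x y _ _ hx hy => rw [map_add]; exact add_mem hx hy
    | smul c x _ hx => rw [map_smul]; exact Submodule.smul_mem _ _ hx

section

variable [GradedAlgebra ℬ]

lemma tensor_lact_tmul {M : GrBimod.{w} 𝒜 ℬ} {N : GrBimod.{w} ℬ 𝒞} (a : A)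
    (m : M.carrier) (n : N.carrier) :
    (tensor M N).lact a (tmul m n) = tmul (M.lact a m) n := rfl

lemma tensor_ract_tmul {M : GrBimod.{w} 𝒜 ℬ} {N : GrBimod.{w} ℬ 𝒞} (c : Cᵐᵒᵖ)
    (m : M.carrier) (n : N.carrier) :
    (tensor M N).ract c (tmul m n) = tmul m (N.ract c n) := rfl

/-- The homomorphism `f ⊗ g`. -/
def tensorMap {M M' : GrBimod.{w} 𝒜 ℬ} {N N' : GrBimod.{w} ℬ 𝒞} (f : M ⟶ M') (g : N ⟶ N') :
    tensor M N ⟶ tensor M' N' :=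
  have key : ∀ m b n, (tmulBilin M' N').compl₁₂ (toLin f) (toLin g)
      (M.ract (MulOpposite.op b) m) n =
      (tmulBilin M' N').compl₁₂ (toLin f) (toLin g) m (N.lact b n) := fun m b n => by
    simp [toLin_ract, toLin_lact, ract_tmul]
  mkHom (tensorLift ((tmulBilin M' N').compl₁₂ (toLin f) (toLin g)) key)
    (fun a x => by
      refine tensor_induction x ?_ (fun m n => ?_) (fun x y hx hy => ?_)
      · simp only [map_zero]
      · change tmul (toLin f (M.lact a m)) (toLin g n) = tmul (M'.lact a (toLin f m)) (toLin g n)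
        rw [toLin_lact]
      · simp only [map_add, hx, hy])
    (fun a x => by
      refine tensor_induction x ?_ (fun m n => ?_) (fun x y hx hy => ?_)
      · simp only [map_zero]
      · change tmul (toLin f m) (toLin g (N.ract a n)) = tmul (toLin f m) (N'.ract a (toLin g n))
        rw [toLin_ract]
      · simp only [map_add, hx, hy])
    (fun n x hx => by
      induction hx using Submodule.span_induction with
      | mem x hx =>
        obtain ⟨i, j, rfl, x, hx, y, hy, rfl⟩ := hx
        rw [tensorLift_tmul]
        exact tmul_mem_tensorGr rfl (toLin_mem f hx) (toLin_mem g hy)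
      | zero => rw [map_zero]; exact zero_mem _
      | add x y _ _ hx hy => rw [map_add]; exact add_mem hx hy
      | smul c x _ hx => rw [map_smul]; exact Submodule.smul_mem _ _ hx)

@[simp] lemma tensorMap_tmul {M M' : GrBimod.{w} 𝒜 ℬ} {N N' : GrBimod.{w} ℬ 𝒞} (f : M ⟶ M')
    (g : N ⟶ N') (m : M.carrier) (n : N.carrier) :
    toLin (tensorMap f g) (tmul m n) = tmul (toLin f m) (toLin g n) := rfl

lemma tensor_hom_ext {M : GrBimod.{w} 𝒜 ℬ} {N : GrBimod.{w} ℬ 𝒞} {K : GrBimod.{w} 𝒜 𝒞}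
    {f g : tensor M N ⟶ K} (h : ∀ m n, toLin f (tmul m n) = toLin g (tmul m n)) : f = g := by
  ext x
  refine tensor_induction x ?_ h (fun x y hx hy => ?_)
  · rw [map_zero, map_zero]
  rw [map_add, map_add, hx, hy]

variable (𝒜 ℬ 𝒞) in
/-- The tensor product over `B` as a bifunctor on graded bimodules. -/
def tensorFunctor :
    GrBimod.{w} 𝒜 ℬ ⥤ GrBimod.{w} ℬ 𝒞 ⥤ GrBimod.{w} 𝒜 𝒞 where
  obj M :=
    { obj := fun N => tensor M N
      map := fun g => tensorMap (𝟙 M) g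
      map_id := fun N => tensor_hom_ext fun m n => rfl
      map_comp := fun f g => tensor_hom_ext fun m n => rfl }
  map f :=
    { app := fun N => tensorMap f (𝟙 N)
      naturality := fun N N' g => tensor_hom_ext fun m n => rfl }
  map_id M := by ext N : 2; exact tensor_hom_ext fun m n => rfl
  map_comp f g := by ext N : 2; exact tensor_hom_ext fun m n => rfl

instance : (tensorFunctor.{w} 𝒜 ℬ 𝒞).Additive where
  map_add {M M' f g} := by
    ext N : 2
    exact tensor_hom_ext fun _ _ => add_tmul _ _ _

instance (M : GrBimod.{w} 𝒜 ℬ) : ((tensorFunctor.{w} 𝒜 ℬ 𝒞).obj M).Additive where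
  map_add := tensor_hom_ext fun _ _ => tmul_add _ _ _

end

/-! ### Tensor products of complexes -/

section

variable [GradedAlgebra ℬ]

/-- The tensor product over `B` of cochain complexes of graded bimodules: the total complex of the
double complex `K ^ p ⊗_B L ^ q`. -/
abbrev tensorComplex (K : CochainComplex (GrBimod.{w} 𝒜 ℬ) ℤ)
    (L : CochainComplex (GrBimod.{w} ℬ 𝒞) ℤ) : CochainComplex (GrBimod.{w} 𝒜 𝒞) ℤ :=
  ((tensorFunctor.{w} 𝒜 ℬ 𝒞).map₂CochainComplex.obj K).obj L

/-- The functor `K ⊗_B -` between homotopy categories, for a complex `K` of graded bimodules. -/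
def tensorLeftHomotopy (𝒞 : ℤ → Submodule ℂ C) (K : CochainComplex (GrBimod.{w} 𝒜 ℬ) ℤ) :
    HomotopyCategory (GrBimod.{w} ℬ 𝒞) (ComplexShape.up ℤ) ⥤
      HomotopyCategory (GrBimod.{w} 𝒜 𝒞) (ComplexShape.up ℤ) :=
  CategoryTheory.Quotient.lift _
    ((tensorFunctor.{w} 𝒜 ℬ 𝒞).map₂CochainComplex.obj K ⋙ HomotopyCategory.quotient _ _)
    (fun _ _ _ _ ⟨h⟩ => HomotopyCategory.eq_of_homotopy _ _
      (HomologicalComplex.mapBifunctorMapHomotopy₂ (𝟙 K) h (tensorFunctor.{w} 𝒜 ℬ 𝒞)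
        (ComplexShape.up ℤ)))

end

/-! ### Grading shift, regular bimodule, one-sided ideals -/

/-- The grading shift `M⟨k⟩`, with `M⟨k⟩_n = M_{n-k}`. -/
@[reducible] def shift (M : GrBimod.{w} 𝒜 ℬ) (k : ℤ) : GrBimod.{w} 𝒜 ℬ where
  carrier := M.carrier
  gr n := M.gr (n - k)
  isInternal := by
    refine isInternal_of (X := fun _ => M.carrier) (fun x => ?_)
      (fun i => Finsupp.lapply (i - k) ∘ₗ comps M.isInternal) (fun i j hij x hx => ?_)
      (fun i x hx h => ?_)
    · induction x using gr_induction M.isInternal with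
      | hom n x hx => exact Submodule.mem_iSup_of_mem (n + k) (by simpa using hx)
      | zero => exact zero_mem _
      | add x y hx hy => exact add_mem hx hy
    · have : j - k ≠ i - k := fun h => hij (by omega)
      simp [comps_of_mem _ hx, this]
    · simpa [comps_of_mem _ hx] using h
  lact := M.lact
  ract := M.ract
  act_comm := M.act_comm
  lact_mem {p n a m} ha hm := by
    have h := M.lact_mem ha hm
    rwa [← add_sub_assoc] at h
  ract_mem {p n a m} ha hm := by
    have h := M.ract_mem ha hm
    rwa [sub_add_eq_add_sub] at h

end GrBimod

/-- The trivial grading on `ℂ`, concentrated in degree `0`. -/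
def trivGr (n : ℤ) : Submodule ℂ ℂ := if n = 0 then ⊤ else ⊥

lemma mem_trivGr {n : ℤ} {c : ℂ} (h : c ∈ trivGr n) : n = 0 ∨ c = 0 := by
  by_cases hn : n = 0
  · exact Or.inl hn
  · exact Or.inr (by simpa [trivGr, hn] using h)

instance : SetLike.GradedMonoid trivGr where
  one_mem := by simp [trivGr]
  mul_mem i j a b ha hb := by
    rcases mem_trivGr ha with rfl | rfl
    · rcases mem_trivGr hb with rfl | rfl
      · simp [trivGr]
      · simp
    · simp

instance : GradedAlgebra trivGr :=
  GradedAlgebra.ofAlgHom trivGr (Algebra.ofId ℂ _) (by ext) (fun i x => by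
    obtain ⟨x, hx⟩ := x
    rcases mem_trivGr hx with rfl | rfl
    · rfl
    · rw [map_zero]
      exact (map_zero (DirectSum.of (fun i => trivGr i) i)).symm)

/-- Scalar multiplication as a right action of `ℂ`. -/
def scalarRight (X : Type*) [AddCommGroup X] [Module ℂ X] : ℂᵐᵒᵖ →ₐ[ℂ] Module.End ℂ X where
  toFun c := c.unop • 1
  map_one' := by simp
  map_mul' _ _ := by ext; simp [smul_smul, mul_comm]
  map_zero' := by simp
  map_add' _ _ := by simp [add_smul]
  commutes' _ := by ext; simp

@[simp] lemma scalarRight_apply {X : Type*} [AddCommGroup X] [Module ℂ X] (c : ℂᵐᵒᵖ) (x : X) :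
    scalarRight X c x = c.unop • x := rfl

/-- A left graded `A`-module is a graded `(A, ℂ)`-bimodule. -/
abbrev GrMod (𝒜 : ℤ → Submodule ℂ A) := GrBimod.{w} 𝒜 trivGr

/-- The left `A`-module underlying a graded bimodule. -/
@[reducible] def GrBimod.leftModule {𝒜 : ℤ → Submodule ℂ A} {ℬ : ℤ → Submodule ℂ B}
    (M : GrBimod.{w} 𝒜 ℬ) : Module A M.carrier :=
  Module.compHom M.carrier M.lact.toRingHom

/-- The property of being a finitely generated projective left `A`-module. -/
def IsFGProjective {𝒜 : ℤ → Submodule ℂ A} (M : GrMod.{w} 𝒜) : Prop :=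
  letI := M.leftModule
  Module.Finite A M.carrier ∧ Module.Projective A M.carrier

/-- The complexes of left graded `A`-modules that are bounded and have finitely generated
projective terms. -/
def isPerfect (𝒜 : ℤ → Submodule ℂ A) :
    ObjectProperty (HomotopyCategory (GrMod.{w} 𝒜) (ComplexShape.up ℤ)) := fun K =>
  (∀ n, IsFGProjective (K.as.X n)) ∧ ∃ a b : ℤ, ∀ n, n < a ∨ b < n → IsZero (K.as.X n)

/-- The bounded homotopy category of finitely generated projective left graded `A`-modules. -/
abbrev PerfCat (𝒜 : ℤ → Submodule ℂ A) := (isPerfect.{w} 𝒜).FullSubcategory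

end Bimod

section Regular

variable {A : Type w} [Ring A] [Algebra ℂ A] (𝒜 : ℤ → Submodule ℂ A) [GradedAlgebra 𝒜]

/-- The algebra `A` as a graded bimodule over itself. -/
@[reducible] def regular : GrBimod.{w} 𝒜 𝒜 where
  carrier := A
  gr := 𝒜
  isInternal := DirectSum.Decomposition.isInternal 𝒜
  lact := Algebra.lsmul ℂ ℂ A
  ract := Algebra.lsmul ℂ ℂ A
  act_comm a b m := by simp [mul_assoc]
  lact_mem ha hm := SetLike.mul_mem_graded ha hm
  ract_mem hb hm := SetLike.mul_mem_graded hm hb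

variable {𝒜}

/-- The left graded module `A e`, for `e` homogeneous of degree `0`. -/
@[reducible] def leftIdeal (e : A) (he : e ∈ 𝒜 0) : GrBimod.{w} 𝒜 trivGr where
  carrier := LinearMap.range (LinearMap.mulRight ℂ e)
  gr n := (𝒜 n).comap (LinearMap.range (LinearMap.mulRight ℂ e)).subtype
  isInternal := by
    refine isInternal_of (X := fun _ => A) ?_
      (fun i => Finsupp.lapply i ∘ₗ comps (DirectSum.Decomposition.isInternal 𝒜) ∘ₗ
        Submodule.subtype _) (fun i j hij x hx => ?_) (fun i x hx h => ?_)
    · rintro ⟨_, a, rfl⟩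
      induction a using gr_induction (DirectSum.Decomposition.isInternal 𝒜) with
      | hom n a ha =>
        refine Submodule.mem_iSup_of_mem n ?_
        simpa using SetLike.mul_mem_graded ha he
      | zero =>
        convert Submodule.zero_mem (iSup _) using 1
        ext
        simp
      | add x y hx hy =>
        convert add_mem hx hy
        simp [add_mul]
    · have hx' : (x : A) ∈ 𝒜 j := hx
      simp [comps_of_mem _ hx', hij.symm]
    · have hx' : (x : A) ∈ 𝒜 i := hx
      simpa [comps_of_mem _ hx'] using h
  lact :=
    { toFun := fun a => (LinearMap.mulLeft ℂ a).restrict (by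
        rintro _ ⟨b, rfl⟩
        exact ⟨a * b, by simp [mul_assoc]⟩)
      map_one' := by ext; simp
      map_mul' := fun _ _ => by ext; simp
      map_zero' := by ext; simp
      map_add' := fun _ _ => by ext; simp [add_mul]
      commutes' := fun _ => by ext; simp [Module.algebraMap_end_apply, Algebra.smul_def] }
  ract := scalarRight _
  act_comm a b m := by ext; simp
  lact_mem ha hm := SetLike.mul_mem_graded ha hm
  ract_mem {q n b m} hb hm := by
    rcases mem_trivGr hb with rfl | rfl
    · rw [add_zero]; exact Submodule.smul_mem _ _ hm
    · rw [MulOpposite.op_zero, map_zero]; exact zero_mem _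

/-- The right graded module `e A`, for `e` homogeneous of degree `0`. -/
@[reducible] def rightIdeal (e : A) (he : e ∈ 𝒜 0) : GrBimod.{w} trivGr 𝒜 where
  carrier := LinearMap.range (LinearMap.mulLeft ℂ e)
  gr n := (𝒜 n).comap (LinearMap.range (LinearMap.mulLeft ℂ e)).subtype
  isInternal := by
    refine isInternal_of (X := fun _ => A) ?_
      (fun i => Finsupp.lapply i ∘ₗ comps (DirectSum.Decomposition.isInternal 𝒜) ∘ₗ
        Submodule.subtype _) (fun i j hij x hx => ?_) (fun i x hx h => ?_)
    · rintro ⟨_, a, rfl⟩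
      induction a using gr_induction (DirectSum.Decomposition.isInternal 𝒜) with
      | hom n a ha =>
        refine Submodule.mem_iSup_of_mem n ?_
        simpa using SetLike.mul_mem_graded he ha
      | zero =>
        convert Submodule.zero_mem (iSup _) using 1
        ext
        simp
      | add x y hx hy =>
        convert add_mem hx hy
        simp [mul_add]
    · have hx' : (x : A) ∈ 𝒜 j := hx
      simp [comps_of_mem _ hx', hij.symm]
    · have hx' : (x : A) ∈ 𝒜 i := hx
      simpa [comps_of_mem _ hx'] using h
  lact := Algebra.ofId ℂ _
  ract :=
    { toFun := fun a => (LinearMap.mulRight ℂ a.unop).restrict (by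
        rintro _ ⟨b, rfl⟩
        exact ⟨b * a.unop, by simp [mul_assoc]⟩)
      map_one' := by ext; simp
      map_mul' := fun _ _ => by ext; simp [mul_assoc]
      map_zero' := by ext; simp
      map_add' := fun _ _ => by ext; simp [mul_add]
      commutes' := fun c => by
        ext x
        simp [Module.algebraMap_end_apply, Algebra.smul_def, Algebra.commutes c x.1] }
  act_comm a b m := by ext; simp [Algebra.ofId_apply]
  lact_mem {q n b m} hb hm := by
    rcases mem_trivGr hb with rfl | rfl
    · rw [zero_add]; exact Submodule.smul_mem _ _ hm
    · rw [map_zero]; exact zero_mem _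
  ract_mem {q n b m} hb hm := SetLike.mul_mem_graded (A := 𝒜) (i := n) (j := q) hm hb

end Regular

/-! ### The zig-zag algebra -/

section ZigZagAlgebra

variable {V : Type u} [Fintype V] (Γ : SimpleGraph V)

/-- Generators of the zig-zag algebra: the idempotents `e i`, an arrow `(i|j)` for each oriented
edge, and the loop `x i` of length two at each vertex. -/
inductive Gen : Type u
  | idem (i : V) : Gen
  | arrow (i j : V) (h : Γ.Adj i j) : Gen
  | loop (i : V) : Gen

variable {Γ}

/-- The path length of a generator. -/
def Gen.deg : Gen Γ → ℤ
  | .idem _ => 0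
  | .arrow _ _ _ => 1
  | .loop _ => 2

/-- The defining relations of the zig-zag algebra. The first six say that the `e i` are orthogonal
idempotents with sum `1` and give the endpoints of arrows and loops, so that products are
concatenations of paths. Then paths `(i|j|k)` with `i ≠ k` vanish, `(i|j|i) = x i` for every
neighbour `j` of `i`, and products of `x i` with an arrow or with itself vanish (there are no
nonzero paths of length at least `3`). -/
inductive Rel : FreeAlgebra ℂ (Gen Γ) → FreeAlgebra ℂ (Gen Γ) → Prop
  | idem_mul_self (i : V) : Rel (.ι ℂ (.idem i) * .ι ℂ (.idem i)) (.ι ℂ (.idem i))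
  | idem_mul_idem (i j : V) (h : i ≠ j) : Rel (.ι ℂ (.idem i) * .ι ℂ (.idem j)) 0
  | sum_idem : Rel (∑ i : V, .ι ℂ (.idem i)) 1
  | idem_mul_arrow (i j : V) (h : Γ.Adj i j) :
      Rel (.ι ℂ (.idem i) * .ι ℂ (.arrow i j h)) (.ι ℂ (.arrow i j h))
  | arrow_mul_idem (i j : V) (h : Γ.Adj i j) :
      Rel (.ι ℂ (.arrow i j h) * .ι ℂ (.idem j)) (.ι ℂ (.arrow i j h))
  | idem_mul_loop (i : V) : Rel (.ι ℂ (.idem i) * .ι ℂ (.loop i)) (.ι ℂ (.loop i))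
  | loop_mul_idem (i : V) : Rel (.ι ℂ (.loop i) * .ι ℂ (.idem i)) (.ι ℂ (.loop i))
  | straight (i j k : V) (h : Γ.Adj i j) (h' : Γ.Adj j k) (hik : i ≠ k) :
      Rel (.ι ℂ (.arrow i j h) * .ι ℂ (.arrow j k h')) 0
  | backtrack (i j : V) (h : Γ.Adj i j) (h' : Γ.Adj j i) :
      Rel (.ι ℂ (.arrow i j h) * .ι ℂ (.arrow j i h')) (.ι ℂ (.loop i))
  | loop_mul_arrow (i j : V) (h : Γ.Adj i j) :
      Rel (.ι ℂ (.loop i) * .ι ℂ (.arrow i j h)) 0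
  | arrow_mul_loop (i j : V) (h : Γ.Adj i j) :
      Rel (.ι ℂ (.arrow i j h) * .ι ℂ (.loop j)) 0
  | loop_mul_loop (i : V) : Rel (.ι ℂ (.loop i) * .ι ℂ (.loop i)) 0

variable (Γ) in
/-- The zig-zag algebra `A_Γ`. -/
def Alg : Type u := RingQuot (Rel (Γ := Γ))

instance : Ring (Alg Γ) := inferInstanceAs (Ring (RingQuot (Rel (Γ := Γ))))
instance : Algebra ℂ (Alg Γ) := inferInstanceAs (Algebra ℂ (RingQuot (Rel (Γ := Γ))))

/-- The quotient map from the free algebra. -/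
def mkAlg : FreeAlgebra ℂ (Gen Γ) →ₐ[ℂ] Alg Γ := RingQuot.mkAlgHom ℂ (Rel (Γ := Γ))

lemma mkAlg_rel {a b : FreeAlgebra ℂ (Gen Γ)} (h : Rel a b) : mkAlg a = mkAlg b :=
  RingQuot.mkAlgHom_rel ℂ h

/-- The image of a generator in the zig-zag algebra. -/
def gen (g : Gen Γ) : Alg Γ := mkAlg (.ι ℂ g)

/-- The idempotent `e i`. -/
def e (i : V) : Alg Γ := gen (.idem i)

/-- The arrow `(i|j)`. -/
def arr {i j : V} (h : Γ.Adj i j) : Alg Γ := gen (.arrow i j h)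

/-- The loop `x i`. -/
def loop (i : V) : Alg Γ := gen (.loop i)

lemma e_mul_self (i : V) : (e i : Alg Γ) * e i = e i := by
  simpa [gen, e, arr, loop] using mkAlg_rel (.idem_mul_self (Γ := Γ) i)
lemma e_mul_e {i j : V} (h : i ≠ j) : (e i : Alg Γ) * e j = 0 := by
  simpa [gen, e, arr, loop] using mkAlg_rel (.idem_mul_idem (Γ := Γ) i j h)
lemma sum_e : ∑ i, (e i : Alg Γ) = 1 := by
  simpa [gen, e, arr, loop] using mkAlg_rel (.sum_idem (Γ := Γ))
lemma e_mul_arr {i j : V} (h : Γ.Adj i j) : e i * arr h = arr h := by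
  simpa [gen, e, arr, loop] using mkAlg_rel (.idem_mul_arrow i j h)
lemma arr_mul_e {i j : V} (h : Γ.Adj i j) : arr h * e j = arr h := by
  simpa [gen, e, arr, loop] using mkAlg_rel (.arrow_mul_idem i j h)
lemma e_mul_loop (i : V) : (e i : Alg Γ) * loop i = loop i := by
  simpa [gen, e, arr, loop] using mkAlg_rel (.idem_mul_loop (Γ := Γ) i)
lemma loop_mul_e (i : V) : (loop i : Alg Γ) * e i = loop i := by
  simpa [gen, e, arr, loop] using mkAlg_rel (.loop_mul_idem (Γ := Γ) i)
lemma arr_mul_arr {i j k : V} (h : Γ.Adj i j) (h' : Γ.Adj j k) (hik : i ≠ k) :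
    arr h * arr h' = 0 := by
  simpa [gen, e, arr, loop] using mkAlg_rel (.straight i j k h h' hik)
lemma arr_mul_arr_self {i j : V} (h : Γ.Adj i j) (h' : Γ.Adj j i) : arr h * arr h' = loop i := by
  simpa [gen, e, arr, loop] using mkAlg_rel (.backtrack i j h h')
lemma loop_mul_arr {i j : V} (h : Γ.Adj i j) : loop i * arr h = 0 := by
  simpa [gen, e, arr, loop] using mkAlg_rel (.loop_mul_arrow i j h)
lemma arr_mul_loop {i j : V} (h : Γ.Adj i j) : arr h * loop j = 0 := by
  simpa [gen, e, arr, loop] using mkAlg_rel (.arrow_mul_loop i j h)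
lemma loop_mul_loop (i : V) : (loop i : Alg Γ) * loop i = 0 := by
  simpa [gen, e, arr, loop] using mkAlg_rel (.loop_mul_loop (Γ := Γ) i)

/-- Induction principle for the zig-zag algebra. -/
@[elab_as_elim]
lemma alg_induction {p : Alg Γ → Prop} (a : Alg Γ) (gen : ∀ g, p (gen g))
    (scalar : ∀ c : ℂ, p (algebraMap ℂ _ c)) (add : ∀ a b, p a → p b → p (a + b))
    (mul : ∀ a b, p a → p b → p (a * b)) : p a := by
  obtain ⟨a, rfl⟩ : ∃ b, mkAlg b = a := RingQuot.mkAlgHom_surjective ℂ _ a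
  induction a using FreeAlgebra.induction with
  | grade0 c => rw [AlgHom.commutes]; exact scalar c
  | grade1 g => exact gen g
  | mul a b ha hb => rw [map_mul]; exact mul _ _ ha hb
  | add a b ha hb => rw [map_add]; exact add _ _ ha hb

/-- The path-length grading of the zig-zag algebra: degree `n` is spanned by the products of
generators of total length `n`. -/
def algGr (n : ℤ) : Submodule ℂ (Alg Γ) :=
  Submodule.span ℂ {a | ∃ w : List (Gen Γ), (w.map Gen.deg).sum = n ∧ a = (w.map gen).prod}

lemma gen_mem (g : Gen Γ) : gen g ∈ algGr (Γ := Γ) g.deg :=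
  Submodule.subset_span ⟨[g], by simp, by simp⟩

lemma e_mem (i : V) : e i ∈ algGr (Γ := Γ) 0 := gen_mem (.idem i)
lemma arr_mem {i j : V} (h : Γ.Adj i j) : arr h ∈ algGr (Γ := Γ) 1 := gen_mem (.arrow i j h)
lemma loop_mem (i : V) : loop i ∈ algGr (Γ := Γ) 2 := gen_mem (.loop i)

instance : SetLike.GradedMonoid (algGr (Γ := Γ)) where
  one_mem := Submodule.subset_span ⟨[], by simp, by simp⟩
  mul_mem i j a b ha hb := by
    have : a * b ∈ algGr (Γ := Γ) i * algGr j := Submodule.mul_mem_mul ha hb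
    rw [algGr, algGr, Submodule.span_mul_span] at this
    refine Submodule.span_mono ?_ this
    rintro _ ⟨_, ⟨w, rfl, rfl⟩, _, ⟨w', rfl, rfl⟩, rfl⟩
    exact ⟨w ++ w', by simp, by simp⟩

lemma of_eq_of {i j : ℤ} {a b : Alg Γ} (ha : a ∈ algGr i) (hb : b ∈ algGr j) (hij : i = j)
    (hab : a = b) : DirectSum.of (fun n => algGr (Γ := Γ) n) i ⟨a, ha⟩ =
      DirectSum.of (fun n => algGr (Γ := Γ) n) j ⟨b, hb⟩ := by
  subst hij; subst hab; rfl

lemma of_eq_zero {i : ℤ} {a : Alg Γ} (ha : a ∈ algGr i) (h : a = 0) :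
    DirectSum.of (fun n => algGr (Γ := Γ) n) i ⟨a, ha⟩ = 0 := by
  subst h; exact map_zero _

/-- The decomposition of an element into its homogeneous components. -/
def algDecompose : Alg Γ →ₐ[ℂ] DirectSum ℤ fun n => algGr (Γ := Γ) n :=
  RingQuot.liftAlgHom ℂ ⟨FreeAlgebra.lift ℂ fun g => DirectSum.of _ g.deg ⟨gen g, gen_mem g⟩, by
    intro a b h
    induction h with
    | idem_mul_self i =>
      simp only [map_mul, FreeAlgebra.lift_ι_apply, DirectSum.of_mul_of]
      exact of_eq_of _ _ rfl (e_mul_self i)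
    | idem_mul_idem i j h =>
      simp only [map_mul, FreeAlgebra.lift_ι_apply, DirectSum.of_mul_of, map_zero]
      exact of_eq_zero _ (e_mul_e h)
    | sum_idem =>
      simp only [map_sum, FreeAlgebra.lift_ι_apply, map_one]
      have h1 : ∀ i : V, DirectSum.of (fun n => algGr (Γ := Γ) n) (Gen.deg (Γ := Γ) (.idem i))
          ⟨gen (.idem i), gen_mem (.idem i)⟩ =
          DirectSum.of (fun n => algGr (Γ := Γ) n) 0 ⟨e i, e_mem i⟩ := fun i => rfl
      simp only [h1]
      rw [← map_sum, DirectSum.one_def]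
      congr 1
      ext
      simpa using sum_e
    | idem_mul_arrow i j h =>
      simp only [map_mul, FreeAlgebra.lift_ι_apply, DirectSum.of_mul_of]
      exact of_eq_of _ _ rfl (e_mul_arr h)
    | arrow_mul_idem i j h =>
      simp only [map_mul, FreeAlgebra.lift_ι_apply, DirectSum.of_mul_of]
      exact of_eq_of _ _ rfl (arr_mul_e h)
    | idem_mul_loop i =>
      simp only [map_mul, FreeAlgebra.lift_ι_apply, DirectSum.of_mul_of]
      exact of_eq_of _ _ rfl (e_mul_loop i)
    | loop_mul_idem i =>
      simp only [map_mul, FreeAlgebra.lift_ι_apply, DirectSum.of_mul_of]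
      exact of_eq_of _ _ rfl (loop_mul_e i)
    | straight i j k h h' hik =>
      simp only [map_mul, FreeAlgebra.lift_ι_apply, DirectSum.of_mul_of, map_zero]
      exact of_eq_zero _ (arr_mul_arr h h' hik)
    | backtrack i j h h' =>
      simp only [map_mul, FreeAlgebra.lift_ι_apply, DirectSum.of_mul_of]
      exact of_eq_of _ _ rfl (arr_mul_arr_self h h')
    | loop_mul_arrow i j h =>
      simp only [map_mul, FreeAlgebra.lift_ι_apply, DirectSum.of_mul_of, map_zero]
      exact of_eq_zero _ (loop_mul_arr h)
    | arrow_mul_loop i j h =>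
      simp only [map_mul, FreeAlgebra.lift_ι_apply, DirectSum.of_mul_of, map_zero]
      exact of_eq_zero _ (arr_mul_loop h)
    | loop_mul_loop i =>
      simp only [map_mul, FreeAlgebra.lift_ι_apply, DirectSum.of_mul_of, map_zero]
      exact of_eq_zero _ (loop_mul_loop i)⟩

lemma algDecompose_gen (g : Gen Γ) :
    algDecompose (gen g) = DirectSum.of (fun n => algGr (Γ := Γ) n) g.deg ⟨gen g, gen_mem g⟩ := by
  exact (RingQuot.liftAlgHom_mkAlgHom_apply ..).trans (FreeAlgebra.lift_ι_apply _ _)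

lemma word_mem (w : List (Gen Γ)) : (w.map gen).prod ∈ algGr (Γ := Γ) (w.map Gen.deg).sum :=
  Submodule.subset_span ⟨w, rfl, rfl⟩

lemma algDecompose_word (w : List (Gen Γ)) :
    algDecompose (w.map gen).prod =
      DirectSum.of (fun n => algGr (Γ := Γ) n) (w.map Gen.deg).sum ⟨_, word_mem w⟩ := by
  induction w with
  | nil => exact map_one _
  | cons g w ih =>
    refine (map_mul algDecompose (gen g) (w.map gen).prod).trans ?_
    rw [ih, algDecompose_gen, DirectSum.of_mul_of]
    exact of_eq_of _ _ (by simp) (by simp)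

instance : GradedAlgebra (algGr (Γ := Γ)) :=
  GradedAlgebra.ofAlgHom _ algDecompose
    (by
      ext a
      induction a using alg_induction with
      | gen g => simp [algDecompose_gen]
      | scalar c => simp
      | add a b ha hb => rw [map_add, ha, hb, map_add]
      | mul a b ha hb => rw [map_mul, ha, hb, map_mul])
    (fun n a => by
      obtain ⟨a, ha⟩ := a
      induction ha using Submodule.span_induction with
      | mem a h =>
        obtain ⟨w, rfl, rfl⟩ := h
        exact algDecompose_word w
      | zero => rw [map_zero]; exact (map_zero _).symm
      | add a b ha hb h1 h2 => rw [map_add, h1, h2, ← map_add]; rfl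
      | smul c a ha h =>
        rw [map_smul, h]
        exact (map_smul (DirectSum.lof ℂ ℤ (fun n => algGr (Γ := Γ) n) n) c ⟨a, ha⟩).symm)

variable (Γ) in
/-- The path-length grading of `A_Γ`. -/
abbrev gr : ℤ → Submodule ℂ (Alg Γ) := algGr (Γ := Γ)

end ZigZagAlgebra

/-! ### The complexes `Σ_i` and `Σ_i⁻¹` -/

section Twists

open GrBimod

variable {V : Type u} [Fintype V] (Γ : SimpleGraph V)

/-- The left graded module `P_i = A_Γ e_i`. -/
abbrev P (i : V) : GrBimod.{u} (gr Γ) trivGr := leftIdeal (e i) (e_mem i)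

/-- The right graded module `Q_i = e_i A_Γ`. -/
abbrev Q (i : V) : GrBimod.{u} trivGr (gr Γ) := rightIdeal (e i) (e_mem i)

/-- The graded bimodule `P_i ⊗_ℂ Q_i`. -/
abbrev U (i : V) : GrBimod.{u} (gr Γ) (gr Γ) := tensor (P Γ i) (Q Γ i)

variable {Γ}

/-- An element `a = a e_i` of `A_Γ` as an element of `P_i`. -/
def toP {i : V} (a : Alg Γ) (ha : a * e i = a) : (P Γ i).carrier := ⟨a, a, ha⟩

/-- An element `a = e_i a` of `A_Γ` as an element of `Q_i`. -/
def toQ {i : V} (a : Alg Γ) (ha : e i * a = a) : (Q Γ i).carrier := ⟨a, a, ha⟩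

variable (Γ)

/-- The multiplication map `f : P_i ⊗ Q_i → A_Γ`, that is, the homomorphism of bimodules with
`f (e_i ⊗ e_i) = e_i`. -/
def f (i : V) : U Γ i ⟶ regular (gr Γ) :=
  have key : ∀ (p : (P Γ i).carrier) (c : ℂ) (q : (Q Γ i).carrier),
      (LinearMap.mul ℂ (Alg Γ)).compl₁₂ (Submodule.subtype _) (Submodule.subtype _)
        ((P Γ i).ract (MulOpposite.op c) p) q =
      (LinearMap.mul ℂ (Alg Γ)).compl₁₂ (Submodule.subtype _) (Submodule.subtype _)
        p ((Q Γ i).lact c q) := fun p c q => by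
    simp [Algebra.ofId_apply]
  mkHom (tensorLift ((LinearMap.mul ℂ (Alg Γ)).compl₁₂ (Submodule.subtype _)
      (Submodule.subtype _)) key)
    (fun a t => by
      induction t using tensor_induction with
      | zero => simp only [map_zero]
      | tmul p q => exact mul_assoc a p.1 q.1
      | add s t hs ht => simp only [map_add, hs, ht])
    (fun a t => by
      induction t using tensor_induction with
      | zero => simp only [map_zero]
      | tmul p q => exact (mul_assoc p.1 q.1 a.unop).symm
      | add s t hs ht => simp only [map_add, hs, ht])
    (fun n t ht => by
      induction ht using Submodule.span_induction with
      | mem t ht =>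
        obtain ⟨i, j, rfl, p, hp, q, hq, rfl⟩ := ht
        exact SetLike.mul_mem_graded (A := gr Γ) (i := i) (j := j) hp hq
      | zero => rw [map_zero]; exact zero_mem _
      | add x y _ _ hx hy => rw [map_add]; exact add_mem hx hy
      | smul c x _ hx => rw [map_smul]; exact Submodule.smul_mem _ _ hx)

lemma f_tmul (i : V) (p : (P Γ i).carrier) (q : (Q Γ i).carrier) :
    toLin (f Γ i) (tmul p q) = p.1 * q.1 := rfl

open Classical in
/-- The element `x_i ⊗ e_i + ∑_{j — i} (j|i) ⊗ (i|j) + e_i ⊗ x_i` of `P_i ⊗ Q_i`. -/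
def casimir (i : V) : (U Γ i).carrier :=
  tmul (toP (loop i) (loop_mul_e i)) (toQ (e i) (e_mul_self i)) +
    (∑ j : V, if h : Γ.Adj j i then
      tmul (toP (arr h) (arr_mul_e h)) (toQ (arr h.symm) (e_mul_arr h.symm)) else 0) +
    tmul (toP (e i) (e_mul_self i)) (toQ (loop i) (e_mul_loop i))

lemma casimir_mem (i : V) : casimir Γ i ∈ (U Γ i).gr 2 := by
  refine add_mem (add_mem ?_ (sum_mem fun j _ => ?_)) ?_
  · exact tmul_mem_tensorGr (p := 2) (q := 0) (by norm_num) (loop_mem i) (e_mem i)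
  · split_ifs with h
    · exact tmul_mem_tensorGr (p := 1) (q := 1) (by norm_num) (arr_mem h) (arr_mem h.symm)
    · exact zero_mem _
  · exact tmul_mem_tensorGr (p := 0) (q := 2) (by norm_num) (e_mem i) (loop_mem i)

section Central

variable {Γ}

lemma e_mul_arr_of_ne {i j k : V} (h : Γ.Adj i j) (hk : k ≠ i) : e k * arr h = 0 := by
  rw [← e_mul_arr h, ← mul_assoc, e_mul_e hk, zero_mul]
lemma arr_mul_e_of_ne {i j k : V} (h : Γ.Adj i j) (hk : j ≠ k) : arr h * e k = 0 := by
  rw [← arr_mul_e h, mul_assoc, e_mul_e hk, mul_zero]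
lemma e_mul_loop_of_ne {i k : V} (hk : k ≠ i) : (e k : Alg Γ) * loop i = 0 := by
  rw [← e_mul_loop, ← mul_assoc, e_mul_e hk, zero_mul]
lemma loop_mul_e_of_ne {i k : V} (hk : i ≠ k) : (loop i : Alg Γ) * e k = 0 := by
  rw [← loop_mul_e, mul_assoc, e_mul_e hk, mul_zero]
lemma loop_mul_loop' (i k : V) : (loop i : Alg Γ) * loop k = 0 := by
  by_cases h : i = k
  · subst h; exact loop_mul_loop i
  · rw [← loop_mul_e, mul_assoc, e_mul_loop_of_ne h, mul_zero]
lemma loop_mul_arr' (k : V) {i j : V} (h : Γ.Adj i j) : loop k * arr h = 0 := by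
  by_cases hk : k = i
  · subst hk; exact loop_mul_arr h
  · rw [← loop_mul_e, mul_assoc, e_mul_arr_of_ne h hk, mul_zero]
lemma arr_mul_loop' (k : V) {i j : V} (h : Γ.Adj i j) : arr h * loop k = 0 := by
  by_cases hk : j = k
  · subst hk; exact arr_mul_loop h
  · rw [← arr_mul_e h, mul_assoc, e_mul_loop_of_ne hk, mul_zero]
lemma arr_mul_arr_of_ne {i j k l : V} (h : Γ.Adj i j) (h' : Γ.Adj k l) (hjk : j ≠ k) :
    arr h * arr h' = 0 := by
  rw [← arr_mul_e h, mul_assoc, e_mul_arr_of_ne h' hjk, mul_zero]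

variable (Γ) in
/-- The tensor `a e_i ⊗ e_i b`. -/
def pq (i : V) (a b : Alg Γ) : (U Γ i).carrier :=
  tmul (M := P Γ i) (N := Q Γ i) ⟨a * e i, a, rfl⟩ ⟨e i * b, b, rfl⟩

lemma pq_eq {i : V} (a b : Alg Γ) (ha : a * e i = a) (hb : e i * b = b) :
    tmul (toP a ha) (toQ b hb) = pq Γ i a b := by
  have h1 : toP a ha = ⟨a * e i, a, rfl⟩ := Subtype.ext ha.symm
  have h2 : toQ b hb = ⟨e i * b, b, rfl⟩ := Subtype.ext hb.symm
  rw [h1, h2]; rfl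

lemma pq_zero_left (i : V) (b : Alg Γ) : pq Γ i 0 b = 0 := by
  have : (⟨0 * e i, 0, rfl⟩ : (P Γ i).carrier) = 0 := Subtype.ext (zero_mul _)
  rw [pq, this]; exact zero_tmul _

lemma pq_zero_right (i : V) (a : Alg Γ) : pq Γ i a 0 = 0 := by
  have : (⟨e i * 0, 0, rfl⟩ : (Q Γ i).carrier) = 0 := Subtype.ext (mul_zero _)
  rw [pq, this]; exact tmul_zero _

lemma lact_pq (i : V) (c a b : Alg Γ) : (U Γ i).lact c (pq Γ i a b) = pq Γ i (c * a) b := by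
  have : (P Γ i).lact c ⟨a * e i, a, rfl⟩ = ⟨c * a * e i, c * a, rfl⟩ :=
    Subtype.ext (mul_assoc c a (e i)).symm
  refine (tensor_lact_tmul _ _ _).trans ?_
  rw [this]; rfl

lemma ract_pq (i : V) (c a b : Alg Γ) :
    (U Γ i).ract (MulOpposite.op c) (pq Γ i a b) = pq Γ i a (b * c) := by
  have : (Q Γ i).ract (MulOpposite.op c) ⟨e i * b, b, rfl⟩ = ⟨e i * (b * c), b * c, rfl⟩ :=
    Subtype.ext (mul_assoc (e i) b c)
  refine (tensor_ract_tmul _ _ _).trans ?_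
  rw [this]; rfl

open Classical in
lemma casimir_eq (i : V) : casimir Γ i = pq Γ i (loop i) (e i) +
    (∑ j : V, if h : Γ.Adj j i then pq Γ i (arr h) (arr h.symm) else 0) +
    pq Γ i (e i) (loop i) := by
  simp only [casimir, pq_eq]

open Classical in
lemma lact_casimir (i : V) (c : Alg Γ) : (U Γ i).lact c (casimir Γ i) =
    pq Γ i (c * loop i) (e i) +
    (∑ j : V, if h : Γ.Adj j i then pq Γ i (c * arr h) (arr h.symm) else 0) +
    pq Γ i (c * e i) (loop i) := by
  rw [casimir_eq, map_add, map_add, lact_pq, lact_pq, map_sum]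
  congr 2
  refine Finset.sum_congr rfl fun j _ => ?_
  split_ifs
  · rw [lact_pq]
  · rw [map_zero]

open Classical in
lemma ract_casimir (i : V) (c : Alg Γ) : (U Γ i).ract (MulOpposite.op c) (casimir Γ i) =
    pq Γ i (loop i) (e i * c) +
    (∑ j : V, if h : Γ.Adj j i then pq Γ i (arr h) (arr h.symm * c) else 0) +
    pq Γ i (e i) (loop i * c) := by
  rw [casimir_eq, map_add, map_add, ract_pq, ract_pq, map_sum]
  congr 2
  refine Finset.sum_congr rfl fun j _ => ?_
  split_ifs
  · rw [ract_pq]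
  · rw [map_zero]

lemma casimir_central_gen (i : V) (c : Gen Γ) :
    (U Γ i).lact (gen c) (casimir Γ i) = (U Γ i).ract (MulOpposite.op (gen c)) (casimir Γ i) := by
  rw [lact_casimir, ract_casimir]
  cases c with
  | idem k =>
    change pq Γ i (e k * loop i) (e i) + _ + pq Γ i (e k * e i) (loop i) =
      pq Γ i (loop i) (e i * e k) + _ + pq Γ i (e i) (loop i * e k)
    by_cases hk : k = i
    · subst hk
      rw [e_mul_loop, e_mul_self, loop_mul_e]
      congr 2
      refine Finset.sum_congr rfl fun j _ => ?_
      split_ifs with h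
      · change pq Γ k (e k * arr h) _ = pq Γ k _ (arr h.symm * e k)
        rw [e_mul_arr_of_ne h h.ne', arr_mul_e_of_ne h.symm h.ne, pq_zero_left, pq_zero_right]
      · rfl
    · rw [e_mul_loop_of_ne hk, e_mul_e hk, e_mul_e (Ne.symm hk), loop_mul_e_of_ne (Ne.symm hk)]
      simp only [pq_zero_left, pq_zero_right]
      congr 2
      refine Finset.sum_congr rfl fun j _ => ?_
      split_ifs with h
      · change pq Γ i (e k * arr h) _ = pq Γ i _ (arr h.symm * e k)
        by_cases hj : k = j
        · subst hj; rw [e_mul_arr, arr_mul_e]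
        · rw [e_mul_arr_of_ne h hj, arr_mul_e_of_ne h.symm (Ne.symm hj), pq_zero_left,
            pq_zero_right]
      · rfl
  | arrow k l hkl =>
    change pq Γ i (arr hkl * loop i) (e i) + _ + pq Γ i (arr hkl * e i) (loop i) =
      pq Γ i (loop i) (e i * arr hkl) + _ + pq Γ i (e i) (loop i * arr hkl)
    rw [arr_mul_loop', loop_mul_arr', pq_zero_left, pq_zero_right, zero_add, add_zero]
    congr 1
    swap
    · by_cases hl : l = i
      · subst hl
        rw [arr_mul_e, Finset.sum_eq_single k, dif_pos hkl]
        · change _ = pq Γ l _ (arr hkl.symm * arr hkl)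
          rw [arr_mul_arr_self]
        · intro j _ hj
          split_ifs with h
          · change pq Γ l _ (arr h.symm * arr hkl) = 0
            rw [arr_mul_arr_of_ne _ _ hj, pq_zero_right]
          · rfl
        · simp
      · rw [arr_mul_e_of_ne hkl hl, pq_zero_left, Finset.sum_eq_zero]
        intro j _
        split_ifs with h
        · change pq Γ i _ (arr h.symm * arr hkl) = 0
          by_cases hj : j = k
          · subst hj
            rw [arr_mul_arr _ _ (Ne.symm hl), pq_zero_right]
          · rw [arr_mul_arr_of_ne _ _ hj, pq_zero_right]
        · rfl
    · by_cases hk : k = i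
      · subst hk
        rw [e_mul_arr, Finset.sum_eq_single l, dif_pos hkl.symm]
        · change pq Γ k (arr hkl * arr hkl.symm) _ = _
          rw [arr_mul_arr_self]
        · intro j _ hj
          split_ifs with h
          · change pq Γ k (arr hkl * arr h) _ = 0
            rw [arr_mul_arr_of_ne _ _ (Ne.symm hj), pq_zero_left]
          · rfl
        · simp
      · rw [e_mul_arr_of_ne hkl (Ne.symm hk), pq_zero_right, Finset.sum_eq_zero]
        intro j _
        split_ifs with h
        · change pq Γ i (arr hkl * arr h) _ = 0
          by_cases hj : l = j
          · subst hj
            rw [arr_mul_arr _ _ hk, pq_zero_left]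
          · rw [arr_mul_arr_of_ne _ _ hj, pq_zero_left]
        · rfl
  | loop k =>
    change pq Γ i (loop k * loop i) (e i) + _ + pq Γ i (loop k * e i) (loop i) =
      pq Γ i (loop i) (e i * loop k) + _ + pq Γ i (e i) (loop i * loop k)
    rw [loop_mul_loop', loop_mul_loop', pq_zero_left, pq_zero_right, zero_add, add_zero,
      Finset.sum_eq_zero, Finset.sum_eq_zero, zero_add, add_zero]
    · by_cases hk : k = i
      · subst hk; rw [loop_mul_e, e_mul_loop]
      · rw [loop_mul_e_of_ne hk, e_mul_loop_of_ne (Ne.symm hk), pq_zero_left, pq_zero_right]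
    · intro j _
      split_ifs with h
      · change pq Γ i _ (arr h.symm * loop k) = 0
        rw [arr_mul_loop', pq_zero_right]
      · rfl
    · intro j _
      split_ifs with h
      · change pq Γ i (loop k * arr h) _ = 0
        rw [loop_mul_arr', pq_zero_left]
      · rfl

lemma casimir_central (i : V) (a : Alg Γ) :
    (U Γ i).lact a (casimir Γ i) = (U Γ i).ract (MulOpposite.op a) (casimir Γ i) := by
  induction a using alg_induction with
  | gen c => exact casimir_central_gen i c
  | scalar c =>
    rw [← MulOpposite.algebraMap_apply, AlgHom.commutes, AlgHom.commutes]
  | add a b ha hb =>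
    rw [MulOpposite.op_add, map_add, map_add, LinearMap.add_apply, LinearMap.add_apply, ha, hb]
  | mul a b ha hb =>
    rw [MulOpposite.op_mul, map_mul, map_mul, Module.End.mul_apply, Module.End.mul_apply, hb,
      (U Γ i).act_comm, ha]

end Central

/-- The homomorphism `g : A_Γ → P_i ⊗ Q_i⟨-2⟩` sending `1` to
`x_i ⊗ e_i + ∑_{j — i} (j|i) ⊗ (i|j) + e_i ⊗ x_i`. -/
def g (i : V) : regular (gr Γ) ⟶ (U Γ i).shift (-2) :=
  mkHom ((U Γ i).lact.toLinearMap.flip (casimir Γ i))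
    (fun a b => by
      change (U Γ i).lact (a * b) _ = (U Γ i).lact a ((U Γ i).lact b _)
      rw [map_mul, Module.End.mul_apply])
    (fun a b => by
      change (U Γ i).lact (b * a.unop) _ = (U Γ i).ract a ((U Γ i).lact b _)
      rw [map_mul, Module.End.mul_apply, casimir_central, (U Γ i).act_comm, MulOpposite.op_unop])
    (fun n a ha => (U Γ i).lact_mem ha (casimir_mem Γ i))

lemma g_apply (i : V) (a : Alg Γ) : toLin (g Γ i) a = (U Γ i).lact a (casimir Γ i) := rfl

/-- The complex `Σ_i = (P_i ⊗ Q_i → A_Γ)`, with `A_Γ` in cohomological degree `0`. -/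
def twist (i : V) : CochainComplex (GrBimod.{u} (gr Γ) (gr Γ)) ℤ :=
  HomologicalComplex.double (f Γ i) (c := ComplexShape.up ℤ) (i₀ := -1) (i₁ := 0) (by simp)

/-- The complex `Σ_i⁻¹ = (A_Γ → P_i ⊗ Q_i⟨-2⟩)`, with `A_Γ` in cohomological degree `0`. -/
def twistInv (i : V) : CochainComplex (GrBimod.{u} (gr Γ) (gr Γ)) ℤ :=
  HomologicalComplex.double (g Γ i) (c := ComplexShape.up ℤ) (i₀ := 0) (i₁ := 1) (by simp)

/-- The bimodule `A_Γ` as a complex concentrated in cohomological degree `0`. -/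
def unitComplex : CochainComplex (GrBimod.{u} (gr Γ) (gr Γ)) ℤ :=
  (CochainComplex.singleFunctor _ 0).obj (regular (gr Γ))

/-- The category `C_Γ`: the bounded homotopy category of finitely generated projective left
graded `A_Γ`-modules. -/
abbrev CatΓ := PerfCat.{u} (gr Γ)

/-- The inclusion of `C_Γ` into the homotopy category of all complexes of left graded modules. -/
abbrev incl : CatΓ Γ ⥤ HomotopyCategory (GrMod.{u} (gr Γ)) (ComplexShape.up ℤ) :=
  (isPerfect.{u} (gr Γ)).ι

end Twists

/-! ### Artin–Tits groups and weak actions -/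

/-- The Artin–Tits group of a simply laced Coxeter graph. -/
def ArtinTits {V : Type u} (Γ : SimpleGraph V) : Type u :=
  PresentedGroup ({r | ∃ i j, Γ.Adj i j ∧ r = FreeGroup.of i * FreeGroup.of j * FreeGroup.of i *
      (FreeGroup.of j * FreeGroup.of i * FreeGroup.of j)⁻¹} ∪
    {r | ∃ i j, i ≠ j ∧ ¬ Γ.Adj i j ∧ r = FreeGroup.of i * FreeGroup.of j *
      (FreeGroup.of j * FreeGroup.of i)⁻¹})

instance {V : Type u} (Γ : SimpleGraph V) : Group (ArtinTits Γ) :=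
  inferInstanceAs (Group (PresentedGroup _))

/-- The standard generator `σ_i`. -/
def ArtinTits.σ {V : Type u} (Γ : SimpleGraph V) (i : V) : ArtinTits Γ := PresentedGroup.of i

/-- Autoequivalences are identified when the underlying functors are isomorphic. -/
def autSetoid (D : Type*) [Category D] : Setoid (D ≌ D) where
  r F G := Nonempty (F.functor ≅ G.functor)
  iseqv := ⟨fun _ => ⟨Iso.refl _⟩, fun ⟨h⟩ => ⟨h.symm⟩, fun ⟨h⟩ ⟨k⟩ => ⟨h.trans k⟩⟩

/-- The group of autoequivalences of a category up to natural isomorphism. -/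
def AutEq (D : Type*) [Category D] := Quotient (autSetoid D)

/-- The class of an autoequivalence. -/
def AutEq.mk {D : Type*} [Category D] (F : D ≌ D) : AutEq D := Quotient.mk (autSetoid D) F

/-- The product of the classes of `F` and `G` is the class of `F ∘ G`. -/
instance (D : Type*) [Category D] : Group (AutEq D) where
  mul := Quotient.map₂ (fun F G => G.trans F) (by
    rintro F F' ⟨h⟩ G G' ⟨k⟩
    exact ⟨Functor.isoWhiskerRight k _ ≪≫ Functor.isoWhiskerLeft _ h⟩)
  one := AutEq.mk CategoryTheory.Equivalence.refl
  inv := Quotient.map (fun F => F.symm) (by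
    rintro F G ⟨h⟩
    exact ⟨(F.toAdjunction.rightAdjointUniq (G.toAdjunction.ofNatIsoLeft h.symm))⟩)
  mul_assoc := by
    rintro ⟨F⟩ ⟨G⟩ ⟨H⟩
    exact Quotient.sound ⟨(Functor.associator _ _ _).symm⟩
  one_mul := by
    rintro ⟨F⟩
    exact Quotient.sound ⟨Functor.rightUnitor _⟩
  mul_one := by
    rintro ⟨F⟩
    exact Quotient.sound ⟨Functor.leftUnitor _⟩
  inv_mul_cancel := by
    rintro ⟨F⟩
    exact Quotient.sound ⟨F.unitIso.symm⟩

end ZigZag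

end

-- Everything rests on the identity Q_j ⊗_A P_k = e_j A e_k, which turns (P_i ⊗ Q_j) ⊗_A (P_k ⊗ Q_l)
-- into P_i ⊗ e_j A e_k ⊗ Q_l. The space e_j A e_k is spanned by e_j and x_j if j = k, by (j|k) if j
-- and k are adjacent, and is zero otherwise (`e_mul_mul_e_self`, `e_mul_mul_e_of_adj`,
-- `e_mul_mul_e_of_not_adj`). The relations give the spanning sets; that the spanning elements do
-- not collapse is seen in the representation `projRep`, whose coefficients `coeffX` and `coeffA`
-- also furnish the contractions that split the maps below.
--
-- Inverses. The total complex of Σ_i ⊗ Σ_i⁻¹ is a square with corners P_iQ_i, (P_iQ_i)(P_iQ_i)⟨-2⟩,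
-- A and P_iQ_i⟨-2⟩. The corner with a double product is a sum of two copies of P_iQ_i, one for x_i
-- and one for e_i. The map into it given by g is split by reading the coefficient of x_i, because
-- the Casimir element is dual to that functional; the multiplication out of it is split by
-- inserting e_i ⊗ e_i. Cancelling both pairs leaves A, and likewise in the other order.
--
-- Non-adjacent vertices. Since e_i A e_j = 0, the corner P_iQ_i ⊗ P_jQ_j vanishes, and the squares
-- of Σ_i ⊗ Σ_j and Σ_j ⊗ Σ_i are isomorphic.
--
-- Adjacent vertices. Σ_i ⊗ Σ_j ⊗ Σ_i is a cube. Its corner P_iQ_i ⊗ P_iQ_i receives the bottom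
-- corner, which meets the x_i-part because (i|j)(j|i) = x_i, and maps onto P_iQ_i through the
-- e_i-part. Gaussian elimination of these two pairs leaves P_iQ_j⟨1⟩ ⊕ P_jQ_i⟨1⟩ → P_iQ_i ⊕ P_jQ_j
-- → A, which is symmetric in i and j (`twist_twist_twist`, `twist_braid`).
--
-- To compute with total complexes, a complex is identified with a finite matrix of maps
-- (`MatrixData`, `MatrixData.Presents`). Homotopy equivalences then become matrix identities, whose
-- entries are compared on bimodule generators.
--
-- Action. The tensor product of complexes respects homotopies and is associative and unital, so
-- homotopy equivalences of bimodule complexes give isomorphisms of functors on the homotopy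
-- category. The functors preserve perfect complexes because A is finite-dimensional and (P_i ⊗ Q_i)
-- ⊗_A N is a summand of the free module A ⊗_ℂ N. Restricting to the full subcategory gives
-- autoequivalences that satisfy the defining relations of the Artin–Tits group.

universe v₄

noncomputable section

namespace ZigZag

namespace GrBimod

variable {A : Type v₁} [Ring A] [Algebra ℂ A] {B : Type v₂} [Ring B] [Algebra ℂ B]
  {C : Type v₃} [Ring C] [Algebra ℂ C] {𝒜 : ℤ → Submodule ℂ A} {ℬ : ℤ → Submodule ℂ B}
  {𝒞 : ℤ → Submodule ℂ C} [GradedAlgebra ℬ]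

/-! ### The total tensor product complex -/

section TensorMap

variable {M M' M'' : GrBimod.{w} 𝒜 ℬ} {N N' N'' : GrBimod.{w} ℬ 𝒞}

lemma tensorMap_comp (f : M ⟶ M') (f' : M' ⟶ M'') (g : N ⟶ N') (g' : N' ⟶ N'') :
    tensorMap (f ≫ f') (g ≫ g') = tensorMap f g ≫ tensorMap f' g' :=
  tensor_hom_ext fun _ _ => rfl

@[simp] lemma tensorMap_id : tensorMap (𝟙 M) (𝟙 N) = 𝟙 (tensor M N) :=
  tensor_hom_ext fun _ _ => rfl

@[simp] lemma tensorMap_zero_left (g : N ⟶ N') : tensorMap (0 : M ⟶ M') g = 0 :=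
  tensor_hom_ext fun _ _ => zero_tmul _

@[simp] lemma tensorMap_zero_right (f : M ⟶ M') : tensorMap f (0 : N ⟶ N') = 0 :=
  tensor_hom_ext fun _ _ => tmul_zero _

/-- `f ⊗ g` as a biadditive map. -/
def tensorMapHom : (M ⟶ M') →+ (N ⟶ N') →+ (tensor M N ⟶ tensor M' N') :=
  AddMonoidHom.mk' (fun f => AddMonoidHom.mk' (fun g => tensorMap f g)
    fun _ _ => tensor_hom_ext fun _ _ => tmul_add _ _ _)
    fun _ _ => AddMonoidHom.ext fun _ => tensor_hom_ext fun _ _ => add_tmul _ _ _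

lemma tensorMapHom_apply (f : M ⟶ M') (g : N ⟶ N') : tensorMapHom f g = tensorMap f g := rfl

lemma tensorMap_sum_left {ι : Type*} (s : Finset ι) (f : ι → (M ⟶ M')) (g : N ⟶ N') :
    tensorMap (∑ i ∈ s, f i) g = ∑ i ∈ s, tensorMap (f i) g := by
  simp only [← tensorMapHom_apply, map_sum, AddMonoidHom.finsetSum_apply]

lemma tensorMap_sum_right {ι : Type*} (s : Finset ι) (f : M ⟶ M') (g : ι → (N ⟶ N')) :
    tensorMap f (∑ i ∈ s, g i) = ∑ i ∈ s, tensorMap f (g i) := by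
  simp only [← tensorMapHom_apply, map_sum]

lemma tensorMap_neg_left (f : M ⟶ M') (g : N ⟶ N') : tensorMap (-f) g = -tensorMap f g := by
  simp only [← tensorMapHom_apply, map_neg, AddMonoidHom.neg_apply]

end TensorMap

variable (K : CochainComplex (GrBimod.{w} 𝒜 ℬ) ℤ) (L : CochainComplex (GrBimod.{w} ℬ 𝒞) ℤ)

/-- The inclusion of `K ^ p ⊗ L ^ q` into the total complex. -/
def tensorι (p q n : ℤ) (h : p + q = n) :
    tensor (K.X p) (L.X q) ⟶ (tensorComplex K L).X n :=
  HomologicalComplex.ιMapBifunctor K L (tensorFunctor.{w} 𝒜 ℬ 𝒞) (ComplexShape.up ℤ) p q n h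

variable {K L}

/-- The homomorphism out of a term of the total complex with given components. -/
def tensorDesc {n : ℤ} {N : GrBimod.{w} 𝒜 𝒞}
    (f : ∀ p q : ℤ, p + q = n → (tensor (K.X p) (L.X q) ⟶ N)) :
    (tensorComplex K L).X n ⟶ N :=
  HomologicalComplex.mapBifunctorDesc (F := tensorFunctor.{w} 𝒜 ℬ 𝒞) f

@[simp] lemma tensorι_desc {n : ℤ} {N : GrBimod.{w} 𝒜 𝒞}
    (f : ∀ p q : ℤ, p + q = n → (tensor (K.X p) (L.X q) ⟶ N)) (p q : ℤ) (h : p + q = n) :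
    tensorι K L p q n h ≫ tensorDesc f = f p q h :=
  HomologicalComplex.ι_mapBifunctorDesc (K₁ := K) (K₂ := L) (F := tensorFunctor.{w} 𝒜 ℬ 𝒞)
    (c := ComplexShape.up ℤ) f p q h

lemma tensorComplex_hom_ext {n : ℤ} {N : GrBimod.{w} 𝒜 𝒞} {f g : (tensorComplex K L).X n ⟶ N}
    (h : ∀ p q h, tensorι K L p q n h ≫ f = tensorι K L p q n h ≫ g) : f = g :=
  HomologicalComplex.mapBifunctor.hom_ext h

/-- These are the Koszul signs of the total complex: none for the differential of the left factor
and `(-1)^p` for that of the right factor. All signs in the squares and cubes below come from here.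
-/
lemma tensorι_d (p q n m : ℤ) (h : p + q = n) (hm : n + 1 = m) :
    tensorι K L p q n h ≫ (tensorComplex K L).d n m =
      tensorMap (K.d p (p + 1)) (𝟙 _) ≫ tensorι K L (p + 1) q m (by omega) +
        p.negOnePow • (tensorMap (𝟙 _) (L.d q (q + 1)) ≫ tensorι K L p (q + 1) m (by omega)) := by
  refine (congrArg _ (HomologicalComplex.mapBifunctor.d_eq K L (tensorFunctor.{w} 𝒜 ℬ 𝒞)
    (ComplexShape.up ℤ) n m)).trans ?_
  refine (Preadditive.comp_add _ _ _ _ _ _).trans ?_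
  refine congrArg₂ _ ?_ ?_
  · refine (HomologicalComplex.mapBifunctor.ι_D₁ K L _ _ n m p q h).trans ?_
    refine (HomologicalComplex.mapBifunctor.d₁_eq K L _ _ (i₁' := p + 1) rfl q m
      (show p + 1 + q = m by omega)).trans ?_
    exact one_smul _ _
  · refine (HomologicalComplex.mapBifunctor.ι_D₂ K L _ _ n m p q h).trans ?_
    exact (HomologicalComplex.mapBifunctor.d₂_eq K L _ _ p (i₂' := q + 1) rfl m
      (show p + (q + 1) = m by omega))

/-- The functoriality of the tensor product of complexes. -/
def tensorComplexMap {K K' : CochainComplex (GrBimod.{w} 𝒜 ℬ) ℤ}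
    {L L' : CochainComplex (GrBimod.{w} ℬ 𝒞) ℤ} (f : K ⟶ K') (g : L ⟶ L') :
    tensorComplex K L ⟶ tensorComplex K' L' :=
  HomologicalComplex.mapBifunctorMap f g (tensorFunctor.{w} 𝒜 ℬ 𝒞) (ComplexShape.up ℤ)

@[simp] lemma tensorι_map {K K' : CochainComplex (GrBimod.{w} 𝒜 ℬ) ℤ}
    {L L' : CochainComplex (GrBimod.{w} ℬ 𝒞) ℤ} (f : K ⟶ K') (g : L ⟶ L') (p q n : ℤ)
    (h : p + q = n) : tensorι K L p q n h ≫ (tensorComplexMap f g).f n =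
      tensorMap (f.f p) (g.f q) ≫ tensorι K' L' p q n h := by
  refine (HomologicalComplex.ι_mapBifunctorMap f g (tensorFunctor.{w} 𝒜 ℬ 𝒞)
    (ComplexShape.up ℤ) p q n h).trans ?_
  rw [← Category.assoc]
  exact congrArg (· ≫ _) (tensorMap_comp _ _ _ _).symm

end GrBimod

/-! ### Complexes presented by matrices -/

section Presentations

variable {C : Type*} [Category C] [Preadditive C]

/-- A finite family of objects placed in given degrees, with a matrix of degree `1`. -/
structure MatrixData (C : Type*) [Category C] [Preadditive C] where
  J : Type
  [fintype : Fintype J]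
  [decEq : DecidableEq J]
  deg : J → ℤ
  X : J → C
  D : ∀ j k, X j ⟶ X k
  D_deg : ∀ j k, deg k ≠ deg j + 1 → D j k = 0

attribute [instance] MatrixData.fintype MatrixData.decEq

namespace MatrixData

/-- The identity matrix. -/
def one (T : MatrixData C) (j k : T.J) : T.X j ⟶ T.X k :=
  if h : j = k then eqToHom (congrArg T.X h) else 0

@[simp] lemma one_self (T : MatrixData C) (j : T.J) : T.one j j = 𝟙 _ := by simp [one]

lemma one_of_ne (T : MatrixData C) {j k : T.J} (h : j ≠ k) : T.one j k = 0 := by simp [one, h]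

lemma one_comp_sum (T : MatrixData C) {j : T.J} {Y : C} (f : ∀ k, T.X k ⟶ Y) :
    ∑ k, T.one j k ≫ f k = f j := by
  rw [Finset.sum_eq_single j (fun k _ hk => by rw [one_of_ne _ hk.symm, zero_comp]) (by simp)]
  simp

/-- An identification of the complex `K` with the complex given by the matrix data `T`. -/
structure Presents (T : MatrixData C) (K : CochainComplex C ℤ) where
  ι : ∀ j n, T.X j ⟶ K.X n
  π : ∀ j n, K.X n ⟶ T.X j
  ι_eq_zero : ∀ j n, T.deg j ≠ n → ι j n = 0
  π_eq_zero : ∀ j n, T.deg j ≠ n → π j n = 0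
  ι_π : ∀ j k n, T.deg j = n → ι j n ≫ π k n = T.one j k
  total : ∀ n, ∑ j, π j n ≫ ι j n = 𝟙 (K.X n)
  ι_d : ∀ j n m, T.deg j = n → n + 1 = m → ι j n ≫ K.d n m = ∑ k, T.D j k ≫ ι k m

namespace Presents

variable {T T' T'' : MatrixData C} {K K' K'' : CochainComplex C ℤ}

/-- The homomorphism between terms of complexes given by a matrix. -/
def mat (M : T.Presents K) (M' : T'.Presents K') (r : ∀ j k, T.X j ⟶ T'.X k) (n m : ℤ) :
    K.X n ⟶ K'.X m :=
  ∑ j, ∑ k, M.π j n ≫ r j k ≫ M'.ι k m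

/-- Distinct entries are orthogonal, so only row `j` survives. The degree hypothesis is needed
because `ι_π` speaks only of `ι j n` with `n` the degree of `j`; the other inclusions are zero. -/
lemma ι_mat (M : T.Presents K) (M' : T'.Presents K') (r : ∀ j k, T.X j ⟶ T'.X k) {j : T.J}
    {n : ℤ} (h : T.deg j = n) (m : ℤ) : M.ι j n ≫ M.mat M' r n m = ∑ k, r j k ≫ M'.ι k m := by
  simp only [mat, Preadditive.comp_sum, ← Category.assoc, M.ι_π _ _ _ h]
  rw [Finset.sum_comm]
  refine Finset.sum_congr rfl fun k _ => ?_
  simp only [Category.assoc]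
  exact T.one_comp_sum fun j' => r j' k ≫ M'.ι k m

/-- By `total` the inclusions are jointly epimorphic; those in a wrong degree may be ignored because
the corresponding projections vanish. -/
lemma hom_ext (M : T.Presents K) {n : ℤ} {Y : C} {f g : K.X n ⟶ Y}
    (h : ∀ j, T.deg j = n → M.ι j n ≫ f = M.ι j n ≫ g) : f = g := by
  rw [← Category.id_comp f, ← Category.id_comp g, ← M.total]
  simp only [Preadditive.sum_comp, Category.assoc]
  refine Finset.sum_congr rfl fun j _ => ?_
  by_cases hj : T.deg j = n
  · rw [h j hj]
  · simp [M.π_eq_zero j n hj]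

lemma d_eq_mat (M : T.Presents K) {n m : ℤ} (h : n + 1 = m) : K.d n m = M.mat M T.D n m :=
  M.hom_ext fun j hj => by rw [M.ι_d j n m hj h, M.ι_mat _ _ hj]

lemma mat_one (M : T.Presents K) (n : ℤ) : M.mat M T.one n n = 𝟙 _ :=
  M.hom_ext fun j hj => by
    rw [M.ι_mat _ _ hj, Category.comp_id]
    exact T.one_comp_sum fun k => M.ι k n

/-- The matrix product sums over all intermediate indices, whereas the composite only passes through
those of degree `m`. Homogeneity of `r` reconciles the two: from degree `n` it reaches nothing else.
-/
lemma mat_comp (M : T.Presents K) (M' : T'.Presents K') (M'' : T''.Presents K'')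
    {r : ∀ j k, T.X j ⟶ T'.X k} {s : ∀ j k, T'.X j ⟶ T''.X k} {n m l e : ℤ}
    (hr : ∀ j k, T'.deg k ≠ T.deg j + e → r j k = 0) (h : n + e = m) :
    M.mat M' r n m ≫ M'.mat M'' s m l = M.mat M'' (fun j l => ∑ k, r j k ≫ s k l) n l :=
  M.hom_ext fun j hj => by
    rw [← Category.assoc, M.ι_mat _ _ hj, M.ι_mat _ _ hj, Preadditive.sum_comp]
    simp only [Preadditive.sum_comp, Category.assoc]
    rw [Finset.sum_comm]
    refine Finset.sum_congr rfl fun k _ => ?_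
    by_cases hk : T'.deg k = m
    · rw [M'.ι_mat _ _ hk, Preadditive.comp_sum]
    · simp [hr j k (by omega)]

lemma mat_add (M : T.Presents K) (M' : T'.Presents K') (r s : ∀ j k, T.X j ⟶ T'.X k) (n m : ℤ) :
    M.mat M' (fun j k => r j k + s j k) n m = M.mat M' r n m + M.mat M' s n m := by
  simp [mat, Finset.sum_add_distrib]

lemma mat_eq_zero (M : T.Presents K) (M' : T'.Presents K') {r : ∀ j k, T.X j ⟶ T'.X k}
    {n m e : ℤ} (hr : ∀ j k, T'.deg k ≠ T.deg j + e → r j k = 0) (h : n + e ≠ m) :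
    M.mat M' r n m = 0 :=
  M.hom_ext fun j hj => by
    rw [M.ι_mat _ _ hj, comp_zero]
    refine Finset.sum_eq_zero fun k _ => ?_
    by_cases hk : T'.deg k = m
    · rw [hr j k (by omega), zero_comp]
    · rw [M'.ι_eq_zero k m hk, comp_zero]

/-- Entries between other degrees meet a zero inclusion or projection, so matrix identities need to
be checked only in the degrees concerned. -/
lemma mat_congr (M : T.Presents K) (M' : T'.Presents K') {r s : ∀ j k, T.X j ⟶ T'.X k} {n m : ℤ}
    (h : ∀ j k, T.deg j = n → T'.deg k = m → r j k = s j k) : M.mat M' r n m = M.mat M' s n m := by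
  refine Finset.sum_congr rfl fun j _ => Finset.sum_congr rfl fun k _ => ?_
  by_cases hj : T.deg j = n
  · by_cases hk : T'.deg k = m
    · rw [h j k hj hk]
    · rw [M'.ι_eq_zero k m hk, comp_zero, comp_zero, comp_zero, comp_zero]
  · rw [M.π_eq_zero j n hj, zero_comp, zero_comp]

/-- The morphism of complexes given by a matrix. -/
def hom (M : T.Presents K) (M' : T'.Presents K') (r : ∀ j k, T.X j ⟶ T'.X k)
    (hr : ∀ j k, T'.deg k ≠ T.deg j → r j k = 0)
    (comm : ∀ j l, T'.deg l = T.deg j + 1 → ∑ k, T.D j k ≫ r k l = ∑ k, r j k ≫ T'.D k l) : K ⟶ K' where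
  f n := M.mat M' r n n
  comm' n m hnm := by
    rw [M'.d_eq_mat hnm, M.d_eq_mat hnm, M.mat_comp M' M' (e := 0) (by simpa using hr) (by simp),
      M.mat_comp M M' T.D_deg hnm]
    have : n + 1 = m := hnm
    exact M.mat_congr M' fun j l hj hl => (comm j l (by omega)).symm

/-- A homotopy equivalence given by matrices `r`, `h` and a matrix `θ` of degree `-1` such that
`h ∘ r` is the identity up to the homotopy `θ` and `r ∘ h` is the identity. -/
def homotopyEquiv (M : T.Presents K) (M' : T'.Presents K')
    (r : ∀ j k, T.X j ⟶ T'.X k) (h : ∀ j k, T'.X j ⟶ T.X k) (θ : ∀ j k, T.X j ⟶ T.X k)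
    (hr : ∀ j k, T'.deg k ≠ T.deg j → r j k = 0)
    (hh : ∀ j k, T.deg k ≠ T'.deg j → h j k = 0)
    (hθ : ∀ j k, T.deg k ≠ T.deg j + -1 → θ j k = 0)
    (comm : ∀ j l, T'.deg l = T.deg j + 1 → ∑ k, T.D j k ≫ r k l = ∑ k, r j k ≫ T'.D k l)
    (comm' : ∀ j l, T.deg l = T'.deg j + 1 → ∑ k, T'.D j k ≫ h k l = ∑ k, h j k ≫ T.D k l)
    (hrh : ∀ j l, T.deg l = T.deg j → ∑ k, r j k ≫ h k l =
      (∑ k, T.D j k ≫ θ k l + ∑ k, θ j k ≫ T.D k l) + T.one j l)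
    (hhr : ∀ j l, T'.deg l = T'.deg j → ∑ k, h j k ≫ r k l = T'.one j l) : HomotopyEquiv K K' where
  hom := M.hom M' r hr comm
  inv := M'.hom M h hh comm'
  homotopyHomInvId :=
    { hom := fun n m => M.mat M θ n m
      zero := fun n m hnm => M.mat_eq_zero M hθ fun h => hnm (by
        simp only [ComplexShape.up_Rel]; omega)
      comm := fun n => by
        -- In degree `n` the homotopy formula is a sum of three matrices: the differential leaving
        -- `n` followed by `θ`, then `θ` followed by the differential entering `n`, and the
        -- identity.
        rw [dNext_eq _ (show (ComplexShape.up ℤ).Rel n (n + 1) from rfl),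
          prevD_eq _ (show (ComplexShape.up ℤ).Rel (n - 1) n by simp), M.d_eq_mat rfl,
          M.d_eq_mat (sub_add_cancel n 1), M.mat_comp M M T.D_deg rfl,
          M.mat_comp M M hθ (by omega), HomologicalComplex.id_f, ← M.mat_one,
          ← mat_add, ← mat_add]
        refine (M.mat_comp M' M (e := 0) (by simpa using hr) (by simp)).trans ?_
        exact M.mat_congr M fun j l hj hl => hrh j l (by omega) }
  -- `hhr` is a strict identity of matrices, so the homotopy on this side is an equality.
  homotopyInvHomId := Homotopy.ofEq (by
    ext n
    refine (M'.mat_comp M M' (e := 0) (by simpa using hh) (by simp)).trans ?_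
    rw [HomologicalComplex.id_f, ← M'.mat_one]
    exact M'.mat_congr M' fun j l hj hl => hhr j l (by omega))

end Presents

/-- `tot` has in degree `n` the biproduct over the indices of that degree, while the matrix
identities sum over all of `J`; this passes between the two. -/
lemma sum_deg (T : MatrixData C) (n : ℤ) {G : Type*} [AddCommMonoid G] (f : T.J → G)
    (hf : ∀ k, T.deg k ≠ n → f k = 0) : ∑ k : {k // T.deg k = n}, f k = ∑ k, f k := by
  rw [← Finset.sum_subtype (Finset.univ.filter fun k => T.deg k = n) (by simp) f]
  exact Finset.sum_filter_of_ne fun k _ hk => by_contra fun h => hk (hf k h)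

/-- The complex given by matrix data of square zero. -/
@[reducible] def tot [HasFiniteBiproducts C] (T : MatrixData C)
    (hD : ∀ j l, ∑ k, T.D j k ≫ T.D k l = 0) : CochainComplex C ℤ where
  X n := ⨁ fun j : {j // T.deg j = n} => T.X j
  d n m := biproduct.matrix fun j k => T.D j k
  shape n m h := by
    ext k j
    rw [biproduct.matrix_π, biproduct.ι_desc, T.D_deg, zero_comp, comp_zero]
    intro h'
    apply h
    simp only [ComplexShape.up_Rel]
    rw [← j.2, ← k.2, h']
  d_comp_d' n m l hnm hml := by
    ext k j
    simp only [biproduct.ι_matrix_assoc, biproduct.matrix_π, comp_zero, zero_comp,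
      biproduct.lift_desc, Category.assoc]
    rw [T.sum_deg m fun k' => T.D j k' ≫ T.D k' k]
    · exact hD _ _
    · intro k' hk'
      rw [T.D_deg, zero_comp]
      have := j.2
      simp only [ComplexShape.up_Rel] at hnm
      omega

/-- The tautological presentation of the complex given by matrix data. -/
def totPresents [HasFiniteBiproducts C] (T : MatrixData C)
    (hD : ∀ j l, ∑ k, T.D j k ≫ T.D k l = 0) : T.Presents (T.tot hD) where
  ι j n := if h : T.deg j = n then
    biproduct.ι (fun j : {j // T.deg j = n} => T.X j) ⟨j, h⟩ else 0
  π j n := if h : T.deg j = n then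
    biproduct.π (fun j : {j // T.deg j = n} => T.X j) ⟨j, h⟩ else 0
  ι_eq_zero j n h := dif_neg h
  π_eq_zero j n h := dif_neg h
  ι_π j k n h := by
    rw [dif_pos h]
    by_cases hk : T.deg k = n
    · rw [dif_pos hk]
      by_cases hjk : j = k
      · subst hjk
        rw [one_self]
        exact biproduct.ι_π_self _ _
      · rw [one_of_ne _ hjk]
        exact biproduct.ι_π_ne _ fun h' => hjk (congrArg Subtype.val h')
    · rw [dif_neg hk, comp_zero, one_of_ne]
      rintro rfl
      exact hk h
  total n := by
    refine (T.sum_deg n _ fun k hk => ?_).symm.trans ?_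
    · rw [dif_neg hk, zero_comp]
    · refine Eq.trans ?_ biproduct.total
      refine Finset.sum_congr rfl fun k _ => ?_
      rw [dif_pos k.2, dif_pos k.2]
  ι_d j n m h hm := by
    refine Eq.trans ?_ (T.sum_deg m _ fun k hk => ?_)
    · rw [dif_pos h]
      change biproduct.ι (fun j : {j // T.deg j = n} => T.X j) ⟨j, h⟩ ≫
        biproduct.matrix (fun (j : {j // T.deg j = n}) (k : {k // T.deg k = m}) =>
          T.D j k) = _
      rw [biproduct.ι_matrix, biproduct.lift_eq]
      refine Finset.sum_congr rfl fun k _ => ?_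
      rw [dif_pos k.2]
    · rw [dif_neg hk, comp_zero]

/-- Matrix data for a complex with a single term. -/
@[reducible] def single (X : C) (n : ℤ) : MatrixData C where
  J := Unit
  deg _ := n
  X _ := X
  D _ _ := 0
  D_deg _ _ _ := rfl

/-- Matrix data for a complex with two terms: `false` is the source and `true` the target. -/
@[reducible] def double {X₀ X₁ : C} (φ : X₀ ⟶ X₁) (n : ℤ) : MatrixData C where
  J := Bool
  deg b := match b with | false => n | true => n + 1
  X b := match b with | false => X₀ | true => X₁
  D | false, true => φ | false, false => 0 | true, _ => 0
  D_deg j k h := by cases j <;> cases k <;> first | rfl | exact absurd rfl h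

variable [HasZeroObject C]

/-- The presentation of a complex concentrated in one degree. -/
def singlePresents (X : C) :
    (single X 0).Presents ((HomologicalComplex.single C (ComplexShape.up ℤ) 0).obj X) where
  ι _ n := if h : n = 0 then (HomologicalComplex.singleObjXIsoOfEq _ 0 X n h).inv else 0
  π _ n := if h : n = 0 then (HomologicalComplex.singleObjXIsoOfEq _ 0 X n h).hom else 0
  ι_eq_zero j n h := dif_neg (Ne.symm h)
  π_eq_zero j n h := dif_neg (Ne.symm h)
  ι_π j k n h := by
    obtain rfl : 0 = n := h
    rw [dif_pos rfl, dif_pos rfl, Iso.inv_hom_id]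
    exact (one_self _ _).symm
  total n := by
    rw [Finset.univ_unique, Finset.sum_singleton]
    by_cases h : n = 0
    · subst h
      rw [dif_pos rfl, dif_pos rfl, Iso.hom_inv_id]
    · exact (HomologicalComplex.isZero_single_obj_X _ 0 X n h).eq_of_src _ _
  ι_d j n m h hm := by
    obtain rfl : 0 = n := h
    rw [HomologicalComplex.single_obj_d, comp_zero]
    simp only [zero_comp, Finset.sum_const_zero]

/-- The presentation of a complex concentrated in two degrees. -/
def doublePresents {X₀ X₁ : C} (φ : X₀ ⟶ X₁) {n m : ℤ} (h : n + 1 = m)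
    (hnm : (ComplexShape.up ℤ).Rel n m) :
    (double φ n).Presents (HomologicalComplex.double φ hnm) where
  ι
  | false, k => if hk : k = n then (HomologicalComplex.doubleXIso₀ φ hnm).inv ≫
      eqToHom (by rw [hk]) else 0
  | true, k => if hk : k = m then (HomologicalComplex.doubleXIso₁ φ hnm (by omega)).inv ≫
      eqToHom (by rw [hk]) else 0
  π
  | false, k => if hk : k = n then eqToHom (by rw [hk]) ≫
      (HomologicalComplex.doubleXIso₀ φ hnm).hom else 0
  | true, k => if hk : k = m then eqToHom (by rw [hk]) ≫
      (HomologicalComplex.doubleXIso₁ φ hnm (by omega)).hom else 0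
  ι_eq_zero j k hj := by
    subst h
    cases j <;> exact dif_neg (Ne.symm hj)
  π_eq_zero j k hj := by
    subst h
    cases j <;> exact dif_neg (Ne.symm hj)
  ι_π j k l hj := by
    subst h
    cases j <;> obtain rfl := hj <;> cases k <;> simp [one]
  total k := by
    subst h
    rw [Fintype.sum_bool]
    by_cases h0 : k = n
    · subst h0
      simp
    · by_cases h1 : k = n + 1
      · subst h1
        simp
      · exact (HomologicalComplex.isZero_double_X φ hnm k h0 h1).eq_of_src _ _
  ι_d j k l hj hl := by
    subst h
    rw [Fintype.sum_bool]
    cases j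
    · obtain rfl : n = k := hj
      subst hl
      simp [HomologicalComplex.double_d φ hnm (by omega)]
    · obtain rfl : n + 1 = k := hj
      rw [HomologicalComplex.double_d_eq_zero₀ _ _ _ _ (by omega)]
      simp

end MatrixData

end Presentations

/-! ### Presentation of the tensor product of two presented complexes -/

namespace MatrixData

open GrBimod

variable {A : Type v₁} [Ring A] [Algebra ℂ A] {B : Type v₂} [Ring B] [Algebra ℂ B]
  {C : Type v₃} [Ring C] [Algebra ℂ C] {𝒜 : ℤ → Submodule ℂ A} {ℬ : ℤ → Submodule ℂ B}
  {𝒞 : ℤ → Submodule ℂ C} [GradedAlgebra ℬ]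

/-- The tensor product of matrix data. -/
@[reducible] def tensor (T : MatrixData (GrBimod.{w} 𝒜 ℬ)) (S : MatrixData (GrBimod.{w} ℬ 𝒞)) :
    MatrixData (GrBimod.{w} 𝒜 𝒞) where
  J := T.J × S.J
  deg j := T.deg j.1 + S.deg j.2
  X j := GrBimod.tensor (T.X j.1) (S.X j.2)
  D j k := tensorMap (T.D j.1 k.1) (S.one j.2 k.2) +
    (T.deg j.1).negOnePow • tensorMap (T.one j.1 k.1) (S.D j.2 k.2)
  D_deg j k h := by
    obtain ⟨j, j'⟩ := j
    obtain ⟨k, k'⟩ := k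
    dsimp only at h ⊢
    have h1 : tensorMap (T.D j k) (S.one j' k') = 0 := by
      by_cases hk : j' = k'
      · subst hk
        rw [T.D_deg _ _ (by omega), tensorMap_zero_left]
      · rw [S.one_of_ne hk, tensorMap_zero_right]
    have h2 : tensorMap (T.one j k) (S.D j' k') = 0 := by
      by_cases hk : j = k
      · subst hk
        rw [S.D_deg _ _ (by omega), tensorMap_zero_right]
      · rw [T.one_of_ne hk, tensorMap_zero_left]
    rw [h1, h2, smul_zero, add_zero]

variable {T : MatrixData (GrBimod.{w} 𝒜 ℬ)} {S : MatrixData (GrBimod.{w} ℬ 𝒞)}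
  {K : CochainComplex (GrBimod.{w} 𝒜 ℬ) ℤ} {L : CochainComplex (GrBimod.{w} ℬ 𝒞) ℤ}

/-- A Kronecker product of identity matrices is an identity matrix. This is the orthogonality of the
summands needed in `Presents.tensor`. -/
lemma tensorMap_one_one (j k : T.J) (j' k' : S.J) :
    tensorMap (T.one j k) (S.one j' k') = (T.tensor S).one (j, j') (k, k') := by
  by_cases h : j = k
  · by_cases h' : j' = k'
    · subst h h'
      rw [one_self, one_self, one_self, tensorMap_id]
    · rw [one_of_ne _ h', tensorMap_zero_right, one_of_ne]
      exact fun h => h' (congrArg Prod.snd h)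
  · rw [one_of_ne _ h, tensorMap_zero_left, one_of_ne]
    exact fun h' => h (congrArg Prod.fst h')

/-- An entry of the differential ends in degree `deg j + 1`, which agrees with the degree of its
target only propositionally; here the indices of an inclusion are changed without casts. -/
lemma Presents.tensor_ι_congr (M : T.Presents K) (N : S.Presents L) {j : T.J} {j' : S.J}
    {p q m : ℤ} (hp : T.deg j = p) (hq : S.deg j' = q) (h : T.deg j + S.deg j' = m)
    (h' : p + q = m) : tensorMap (M.ι j (T.deg j)) (N.ι j' (S.deg j')) ≫ tensorι K L _ _ m h =
      tensorMap (M.ι j p) (N.ι j' q) ≫ tensorι K L p q m h' := by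
  subst hp hq
  rfl

/-- The presentation of the tensor product of two presented complexes. -/
def Presents.tensor (M : T.Presents K) (N : S.Presents L) :
    (T.tensor S).Presents (tensorComplex K L) where
  ι j n := if h : T.deg j.1 + S.deg j.2 = n then
    tensorMap (M.ι j.1 (T.deg j.1)) (N.ι j.2 (S.deg j.2)) ≫ tensorι K L _ _ n h else 0
  π j n := tensorDesc fun p q _ => tensorMap (M.π j.1 p) (N.π j.2 q)
  ι_eq_zero j n h := dif_neg h
  π_eq_zero j n h := tensorComplex_hom_ext fun p q hpq => by
    change T.deg j.1 + S.deg j.2 ≠ n at h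
    rw [tensorι_desc, comp_zero]
    by_cases hp : T.deg j.1 = p
    · rw [N.π_eq_zero j.2 q (by omega), tensorMap_zero_right]
    · rw [M.π_eq_zero _ _ hp, tensorMap_zero_left]
  ι_π j k n h := by
    rw [dif_pos h, Category.assoc, tensorι_desc, ← tensorMap_comp, M.ι_π _ _ _ rfl,
      N.ι_π _ _ _ rfl, tensorMap_one_one]
  total n := tensorComplex_hom_ext fun p q hpq => by
    -- On `K^p ⊗ L^q` each pair of indices contributes a tensor product of two projectors. Summed
    -- over the pairs they give the identity, by `total` for both factors.
    have key : ∀ j : T.J × S.J, (tensorι K L p q n hpq ≫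
        tensorDesc fun p q _ => tensorMap (M.π j.1 p) (N.π j.2 q)) ≫
        (if h : T.deg j.1 + S.deg j.2 = n then tensorMap (M.ι j.1 (T.deg j.1))
          (N.ι j.2 (S.deg j.2)) ≫ tensorι K L _ _ n h else 0) =
        tensorMap (M.π j.1 p ≫ M.ι j.1 p) (N.π j.2 q ≫ N.ι j.2 q) ≫ tensorι K L p q n hpq := by
      rintro ⟨j, j'⟩
      dsimp only
      rw [tensorι_desc]
      by_cases hp : T.deg j = p
      · by_cases hq : S.deg j' = q
        · subst hp hq
          rw [dif_pos hpq, ← Category.assoc, tensorMap_comp]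
        · rw [N.π_eq_zero _ _ hq, tensorMap_zero_right, zero_comp, zero_comp,
            tensorMap_zero_right, zero_comp]
      · rw [M.π_eq_zero _ _ hp, tensorMap_zero_left, zero_comp, zero_comp,
            tensorMap_zero_left, zero_comp]
    rw [Preadditive.comp_sum, Category.comp_id]
    simp only [← Category.assoc]
    rw [Finset.sum_congr rfl fun j _ => key j, ← Preadditive.sum_comp, Fintype.sum_prod_type]
    simp only [← tensorMap_sum_right, ← tensorMap_sum_left, M.total, N.total, tensorMap_id]
    rw [Category.id_comp]
  ι_d j n m h hm := by
    obtain ⟨j, j'⟩ := j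
    subst h
    change T.deg j + S.deg j' + 1 = m at hm
    -- Both sides split into the differential of the left factor and the signed differential of the
    -- right factor. In each part the identity matrix of the other factor collapses the double sum
    -- to a single one.
    rw [dif_pos rfl, Category.assoc, tensorι_d _ _ _ _ _ hm, Preadditive.comp_add,
      Linear.comp_units_smul, ← Category.assoc, ← Category.assoc, ← tensorMap_comp,
      ← tensorMap_comp, Category.comp_id, Category.comp_id, M.ι_d j _ _ rfl rfl,
      N.ι_d j' _ _ rfl rfl, tensorMap_sum_left, tensorMap_sum_right, Preadditive.sum_comp,
      Preadditive.sum_comp]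
    simp only [Preadditive.add_comp, Finset.sum_add_distrib, Linear.units_smul_comp]
    refine congrArg₂ _ ?_ ?_
    · rw [Fintype.sum_prod_type]
      refine Finset.sum_congr rfl fun k _ => ?_
      rw [Finset.sum_eq_single j' (fun k' _ hk' => by
        rw [S.one_of_ne hk'.symm, tensorMap_zero_right, zero_comp]) (by simp), one_self]
      by_cases hk : T.deg k = T.deg j + 1
      · rw [dif_pos (by dsimp only; omega), M.tensor_ι_congr N hk rfl, ← Category.assoc,
          ← tensorMap_comp, Category.id_comp]
      · rw [T.D_deg _ _ hk, zero_comp, tensorMap_zero_left, tensorMap_zero_left, zero_comp,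
          zero_comp]
    · rw [← Finset.smul_sum, Fintype.sum_prod_type, Finset.sum_comm]
      congr 1
      refine Finset.sum_congr rfl fun k _ => ?_
      rw [Finset.sum_eq_single j (fun k' _ hk' => by
        rw [T.one_of_ne hk'.symm, tensorMap_zero_left, zero_comp]) (by simp), one_self]
      by_cases hk : S.deg k = S.deg j' + 1
      · rw [dif_pos (by dsimp only; omega), M.tensor_ι_congr N rfl hk, ← Category.assoc,
          ← tensorMap_comp, Category.id_comp]
      · rw [S.D_deg _ _ hk, zero_comp, tensorMap_zero_right, tensorMap_zero_right, zero_comp,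
          zero_comp]

end MatrixData

/-! ### The structure of the zig-zag algebra -/

section Structure

variable {V : Type u} [Fintype V] {Γ : SimpleGraph V}

instance : Finite (Gen Γ) :=
  Finite.of_injective (fun g : Gen Γ => (match g with
    | .idem i => Sum.inl i
    | .arrow i j _ => Sum.inr (Sum.inl (i, j))
    | .loop i => Sum.inr (Sum.inr i) : V ⊕ (V × V) ⊕ V)) (by
      rintro (_ | _ | _) (_ | _ | _) h <;> simp_all)

/-- The product of two generators is zero or a generator. -/
lemma gen_mul_gen (a b : Gen Γ) :
    gen a * gen b = 0 ∨ ∃ c : Gen Γ, gen a * gen b = gen c ∧ c.deg = a.deg + b.deg := by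
  cases a with
  | idem i =>
    cases b with
    | idem j =>
      by_cases h : i = j
      · subst h; exact Or.inr ⟨.idem i, e_mul_self i, rfl⟩
      · exact Or.inl (e_mul_e h)
    | arrow j k hjk =>
      by_cases h : i = j
      · subst h; exact Or.inr ⟨.arrow i k hjk, e_mul_arr hjk, rfl⟩
      · exact Or.inl (e_mul_arr_of_ne hjk h)
    | loop j =>
      by_cases h : i = j
      · subst h; exact Or.inr ⟨.loop i, e_mul_loop i, rfl⟩
      · exact Or.inl (e_mul_loop_of_ne h)
  | arrow i j hij =>
    cases b with
    | idem k =>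
      by_cases h : j = k
      · subst h; exact Or.inr ⟨.arrow i j hij, arr_mul_e hij, rfl⟩
      · exact Or.inl (arr_mul_e_of_ne hij h)
    | arrow k l hkl =>
      by_cases h : j = k
      · subst h
        by_cases h : i = l
        · subst h; exact Or.inr ⟨.loop i, arr_mul_arr_self hij hkl, rfl⟩
        · exact Or.inl (arr_mul_arr hij hkl h)
      · exact Or.inl (arr_mul_arr_of_ne hij hkl h)
    | loop k => exact Or.inl (arr_mul_loop' k hij)
  | loop i =>
    cases b with
    | idem j =>
      by_cases h : i = j
      · subst h; exact Or.inr ⟨.loop i, loop_mul_e i, rfl⟩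
      · exact Or.inl (loop_mul_e_of_ne h)
    | arrow j k hjk => exact Or.inl (loop_mul_arr' i hjk)
    | loop j => exact Or.inl (loop_mul_loop' i j)

/-- By `gen_mul_gen` the span of the generators is closed under multiplication, and it contains 1 as
the sum of the idempotents. -/
lemma span_gen : Submodule.span ℂ (Set.range (gen (Γ := Γ))) = ⊤ := by
  rw [eq_top_iff]
  rintro a -
  induction a using alg_induction with
  | gen g => exact Submodule.subset_span ⟨g, rfl⟩
  | scalar c =>
    rw [Algebra.algebraMap_eq_smul_one, ← sum_e]
    exact Submodule.smul_mem _ _ (sum_mem fun i _ => Submodule.subset_span ⟨.idem i, rfl⟩)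
  | add a b ha hb => exact add_mem ha hb
  | mul a b ha hb =>
    have h := Submodule.mul_mem_mul ha hb
    rw [Submodule.span_mul_span] at h
    refine Submodule.span_le.2 ?_ h
    rintro _ ⟨_, ⟨g, rfl⟩, _, ⟨g', rfl⟩, rfl⟩
    rcases gen_mul_gen g g' with h | ⟨c, h, -⟩
    · exact (congrArg (· ∈ Submodule.span ℂ (Set.range (gen (Γ := Γ)))) h).mpr (zero_mem _)
    · exact Submodule.subset_span ⟨c, h.symm⟩

lemma alg_lin_ext {X : Type*} [AddCommGroup X] [Module ℂ X] {φ ψ : Alg Γ →ₗ[ℂ] X}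
    (h : ∀ g : Gen Γ, φ (gen g) = ψ (gen g)) : φ = ψ :=
  LinearMap.ext_on_range span_gen h

instance : Module.Finite ℂ (Alg Γ) :=
  ⟨⟨(Set.finite_range gen).toFinset, by rw [Set.Finite.coe_toFinset, span_gen]⟩⟩

/-- A nonempty word collapses to zero or to one generator of the same total degree; the empty word
is the sum of the idempotents, all of degree 0. Hence a functional can be shown to vanish in a given
degree by testing the generators of that degree. -/
lemma mem_span_gen_of_mem {n : ℤ} {a : Alg Γ} (ha : a ∈ algGr n) :
    a ∈ Submodule.span ℂ {b | ∃ g : Gen Γ, g.deg = n ∧ b = gen g} := by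
  refine Submodule.span_le.2 ?_ ha
  rintro _ ⟨w, rfl, rfl⟩
  rcases w with _ | ⟨g, w⟩
  · change (1 : Alg Γ) ∈ _
    rw [← sum_e]
    exact sum_mem fun i _ => Submodule.subset_span ⟨.idem i, rfl, rfl⟩
  · suffices h : ((g :: w).map gen).prod = 0 ∨
        ∃ c : Gen Γ, ((g :: w).map gen).prod = gen c ∧ c.deg = ((g :: w).map Gen.deg).sum by
      rcases h with h | ⟨c, h, hc⟩
      · rw [h]; exact zero_mem _
      · exact Submodule.subset_span ⟨c, hc, h⟩
    clear ha
    induction w generalizing g with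
    | nil => exact Or.inr ⟨g, by simp, by simp⟩
    | cons g' w ih =>
      rw [List.map_cons, List.prod_cons, List.map_cons (f := Gen.deg), List.sum_cons]
      rcases ih g' with h | ⟨c, h, hc⟩
      · exact Or.inl (by rw [h, mul_zero])
      · rw [h, ← hc]
        exact gen_mul_gen g c

lemma map_eq_zero_of_mem {X : Type*} [AddCommGroup X] [Module ℂ X] (φ : Alg Γ →ₗ[ℂ] X) {n : ℤ}
    (h : ∀ g : Gen Γ, g.deg = n → φ (gen g) = 0) {a : Alg Γ} (ha : a ∈ algGr n) : φ a = 0 := by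
  refine (Submodule.span_le (p := LinearMap.ker φ)).2 ?_ (mem_span_gen_of_mem ha)
  rintro _ ⟨g, hg, rfl⟩
  exact h g hg

open Classical in
/-- The action of the generators on the left module `P_j`, with basis `e_j`, the arrows `(k|j)`
and `x_j`; basis vectors are also present for vertices `k` not adjacent to `j`. -/
def projGen (j : V) : Gen Γ → Module.End ℂ (ℂ × (V → ℂ) × ℂ)
  | .idem k =>
    { toFun := fun x => (if k = j then x.1 else 0, fun l => if k = l then x.2.1 l else 0,
        if k = j then x.2.2 else 0)
      map_add' := fun x y => by ext <;> simp <;> split_ifs <;> simp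
      map_smul' := fun c x => by ext <;> simp }
  | .arrow k l _ =>
    { toFun := fun x => (0, fun m => if m = k ∧ l = j then x.1 else 0,
        if k = j then x.2.1 l else 0)
      map_add' := fun x y => by ext <;> simp <;> split_ifs <;> simp
      map_smul' := fun c x => by ext <;> simp }
  | .loop k =>
    { toFun := fun x => (0, 0, if k = j then x.1 else 0)
      map_add' := fun x y => by ext <;> simp; split_ifs <;> simp
      map_smul' := fun c x => by ext <;> simp }

/-- The representation of the zig-zag algebra with generators acting by `projGen`. -/
def projRep (j : V) : Alg Γ →ₐ[ℂ] Module.End ℂ (ℂ × (V → ℂ) × ℂ) :=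
  RingQuot.liftAlgHom ℂ ⟨FreeAlgebra.lift ℂ (projGen j), by
    intro a b h
    induction h with
    | sum_idem =>
      classical
      simp only [map_sum, FreeAlgebra.lift_ι_apply, map_one]
      refine LinearMap.ext fun x => ?_
      rw [LinearMap.sum_apply]
      refine Prod.ext ?_ (Prod.ext ?_ ?_)
      · simp [Prod.fst_sum, projGen]
      · ext; simp [Prod.fst_sum, Prod.snd_sum, projGen]
      · simp [Prod.snd_sum, projGen]
    | _ =>
      simp only [map_mul, FreeAlgebra.lift_ι_apply, map_zero]
      refine LinearMap.ext fun x => ?_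
      refine Prod.ext ?_ (Prod.ext (funext fun l => ?_) ?_) <;> simp [projGen] <;> grind [SimpleGraph.irrefl]⟩

lemma projRep_gen (j : V) (g : Gen Γ) : projRep j (gen g) = projGen j g :=
  (RingQuot.liftAlgHom_mkAlgHom_apply ..).trans (FreeAlgebra.lift_ι_apply _ _)

/-- The coefficient of `e_j` in an element of `A_Γ`. -/
def coeffE (j : V) : Alg Γ →ₗ[ℂ] ℂ :=
  LinearMap.fst ℂ ℂ ((V → ℂ) × ℂ) ∘ₗ (projRep j).toLinearMap.flip (1, 0, 0)

/-- The coefficient of `(i|j)` in an element of `A_Γ`. -/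
def coeffA (i j : V) : Alg Γ →ₗ[ℂ] ℂ :=
  LinearMap.proj i ∘ₗ LinearMap.fst ℂ (V → ℂ) ℂ ∘ₗ LinearMap.snd ℂ ℂ ((V → ℂ) × ℂ) ∘ₗ
    (projRep j).toLinearMap.flip (1, 0, 0)

/-- The coefficient of `x_j` in an element of `A_Γ`. -/
def coeffX (j : V) : Alg Γ →ₗ[ℂ] ℂ :=
  LinearMap.snd ℂ (V → ℂ) ℂ ∘ₗ LinearMap.snd ℂ ℂ ((V → ℂ) × ℂ) ∘ₗ
    (projRep j).toLinearMap.flip (1, 0, 0)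

lemma coeffE_gen (j : V) (g : Gen Γ) : coeffE j (gen g) = (projGen j g (1, 0, 0)).1 := by
  rw [← projRep_gen]; rfl
lemma coeffA_gen (i j : V) (g : Gen Γ) : coeffA i j (gen g) = (projGen j g (1, 0, 0)).2.1 i := by
  rw [← projRep_gen]; rfl
lemma coeffX_gen (j : V) (g : Gen Γ) : coeffX j (gen g) = (projGen j g (1, 0, 0)).2.2 := by
  rw [← projRep_gen]; rfl

@[simp] lemma coeffX_e (j k : V) : coeffX (Γ := Γ) j (e k) = 0 := by
  simp [e, coeffX_gen, projGen]
-- In particular x_j is not zero, which the presentation by generators and relations does not make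
-- visible. This value makes the contraction along x_j a splitting.
@[simp] lemma coeffX_loop (j : V) : coeffX (Γ := Γ) j (loop j) = 1 := by
  simp [loop, coeffX_gen, projGen]
@[simp] lemma coeffX_arr (j : V) {k l : V} (h : Γ.Adj k l) : coeffX j (arr h) = 0 := by
  simp [arr, coeffX_gen, projGen]
@[simp] lemma coeffA_arr {k l : V} (h : Γ.Adj k l) : coeffA k l (arr h) = 1 := by
  simp [arr, coeffA_gen, projGen]

/-- Homogeneity of the functional, in degree 2, is what `contr` requires in order to produce a
degree-preserving homomorphism. -/
lemma coeffX_eq_zero (j : V) {n : ℤ} (hn : n ≠ 2) {a : Alg Γ} (ha : a ∈ algGr n) :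
    coeffX j a = 0 := by
  refine map_eq_zero_of_mem (coeffX j) (fun g hg => ?_) ha
  cases g with
  | loop k => exact absurd hg.symm hn
  | idem k => exact coeffX_e j k
  | arrow k l h => exact coeffX_arr j h

lemma coeffA_eq_zero (i j : V) {n : ℤ} (hn : n ≠ 1) {a : Alg Γ} (ha : a ∈ algGr n) :
    coeffA i j a = 0 := by
  refine map_eq_zero_of_mem (coeffA i j) (fun g hg => ?_) ha
  cases g with
  | arrow k l h => exact absurd hg.symm hn
  | idem k => simp [coeffA_gen, projGen]
  | loop k => simp [coeffA_gen, projGen]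

/-- The space `e_i A e_i` is spanned by `e_i` and `x_i`. -/
lemma e_mul_mul_e_self (i : V) (a : Alg Γ) :
    e i * a * e i = coeffE i a • e i + coeffX i a • loop i := by
  have : LinearMap.mulRight ℂ (e i) ∘ₗ LinearMap.mulLeft ℂ (e i) =
      (coeffE (Γ := Γ) i).smulRight (e i) + (coeffX (Γ := Γ) i).smulRight (loop i) := by
    refine alg_lin_ext fun g => ?_
    change e i * gen g * e i = coeffE i (gen g) • e i + coeffX i (gen g) • loop i
    rw [coeffE_gen, coeffX_gen]
    cases g with
    | idem k =>
      change e i * e k * e i = _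
      by_cases h : k = i
      · subst h; simp [projGen, e_mul_self]
      · simp [projGen, h, e_mul_e (Ne.symm h)]
    | arrow k l hkl =>
      change e i * arr hkl * e i = _
      by_cases h : i = k
      · subst h; rw [e_mul_arr, arr_mul_e_of_ne _ hkl.ne']; simp [projGen]
      · rw [e_mul_arr_of_ne _ h]; simp [projGen]
    | loop k =>
      change e i * loop k * e i = _
      by_cases h : k = i
      · subst h; simp [projGen, e_mul_loop, loop_mul_e]
      · simp [projGen, h, e_mul_loop_of_ne (Ne.symm h)]
  exact LinearMap.congr_fun this a

/-- For adjacent `i` and `j`, the space `e_i A e_j` is spanned by `(i|j)`. -/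
lemma e_mul_mul_e_of_adj {i j : V} (hij : Γ.Adj i j) (a : Alg Γ) :
    e i * a * e j = coeffA i j a • arr hij := by
  have : LinearMap.mulRight ℂ (e j) ∘ₗ LinearMap.mulLeft ℂ (e i) =
      (coeffA (Γ := Γ) i j).smulRight (arr hij) := by
    refine alg_lin_ext fun g => ?_
    change e i * gen g * e j = coeffA i j (gen g) • arr hij
    rw [coeffA_gen]
    cases g with
    | idem k =>
      change e i * e k * e j = _
      by_cases h : i = k
      · subst h; simp [projGen, e_mul_self, e_mul_e hij.ne]
      · simp [projGen, e_mul_e h]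
    | arrow k l hkl =>
      change e i * arr hkl * e j = _
      by_cases h : i = k
      · subst h
        by_cases h : l = j
        · subst h; simp [projGen, e_mul_arr, arr_mul_e]
        · rw [e_mul_arr, arr_mul_e_of_ne _ h]; simp [projGen, h]
      · rw [e_mul_arr_of_ne _ h]; simp [projGen, h]
    | loop k =>
      change e i * loop k * e j = _
      by_cases h : i = k
      · subst h; rw [e_mul_loop, loop_mul_e_of_ne hij.ne]; simp [projGen]
      · rw [e_mul_loop_of_ne h]; simp [projGen]
  exact LinearMap.congr_fun this a

/-- For distinct non-adjacent `i` and `j`, the space `e_i A e_j` vanishes. -/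
lemma e_mul_mul_e_of_not_adj {i j : V} (hne : i ≠ j) (hij : ¬ Γ.Adj i j) (a : Alg Γ) :
    e i * a * e j = 0 := by
  have : LinearMap.mulRight ℂ (e j) ∘ₗ LinearMap.mulLeft ℂ (e i) =
      (0 : Alg Γ →ₗ[ℂ] Alg Γ) := by
    refine alg_lin_ext fun g => ?_
    change e i * gen g * e j = 0
    cases g with
    | idem k =>
      change e i * e k * e j = _
      by_cases h : i = k
      · subst h; rw [e_mul_self, e_mul_e hne]
      · rw [e_mul_e h, zero_mul]
    | arrow k l hkl =>
      change e i * arr hkl * e j = _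
      by_cases h : i = k
      · subst h
        rw [e_mul_arr, arr_mul_e_of_ne]
        rintro rfl
        exact hij hkl
      · rw [e_mul_arr_of_ne _ h, zero_mul]
    | loop k =>
      change e i * loop k * e j = _
      by_cases h : i = k
      · subst h; rw [e_mul_loop, loop_mul_e_of_ne hne]
      · rw [e_mul_loop_of_ne h, zero_mul]
  exact LinearMap.congr_fun this a

end Structure

open GrBimod

/-! ### Actions on elements -/

namespace GrBimod

section

variable {A : Type v₁} [Ring A] [Algebra ℂ A] {B : Type v₂} [Ring B] [Algebra ℂ B]
  {𝒜 : ℤ → Submodule ℂ A} {ℬ : ℤ → Submodule ℂ B}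

/-- The left action of `A` on a graded bimodule. -/
def lsm {M : GrBimod.{w} 𝒜 ℬ} (a : A) (m : M.carrier) : M.carrier := M.lact a m

/-- The right action of `B` on a graded bimodule. -/
def rsm {M : GrBimod.{w} 𝒜 ℬ} (b : B) (m : M.carrier) : M.carrier :=
  M.ract (MulOpposite.op b) m

end

end GrBimod

/-! ### Unit isomorphisms for the tensor product -/

section Unit

variable {A : Type w} [Ring A] [Algebra ℂ A] {B : Type v₂} [Ring B] [Algebra ℂ B]
  {𝒜 : ℤ → Submodule ℂ A} {ℬ : ℤ → Submodule ℂ B} [GradedAlgebra 𝒜]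

/-- The isomorphism `A ⊗_A M ≅ M`. -/
def lunit (M : GrBimod.{w} 𝒜 ℬ) : tensor (regular 𝒜) M ≅ M where
  hom := mkHom (tensorLift (M := regular 𝒜) (N := M) M.lact.toLinearMap
      (fun a b m => by
        change M.lact (a * b) m = M.lact a (M.lact b m)
        rw [map_mul, Module.End.mul_apply]))
    (fun a x => by
      refine tensor_induction x ?_ (fun b m => ?_) (fun x y hx hy => ?_)
      · simp only [map_zero]
      · change M.lact (a * b) m = M.lact a (M.lact b m)
        rw [map_mul, Module.End.mul_apply]
      · simp only [map_add, hx, hy])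
    (fun a x => by
      refine tensor_induction x ?_ (fun b m => ?_) (fun x y hx hy => ?_)
      · simp only [map_zero]
      · exact M.act_comm b a m
      · simp only [map_add, hx, hy])
    (fun n x hx => by
      induction hx using Submodule.span_induction with
      | mem x hx =>
        obtain ⟨i, j, rfl, x, hx, y, hy, rfl⟩ := hx
        exact M.lact_mem hx hy
      | zero => rw [map_zero]; exact zero_mem _
      | add x y _ _ hx hy => rw [map_add]; exact add_mem hx hy
      | smul c x _ hx => rw [map_smul]; exact Submodule.smul_mem _ _ hx)
  inv := mkHom (tmulBilin (regular 𝒜) M 1)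
    (fun a m => by
      refine (ract_tmul (M := regular 𝒜) (1 : A) a m).symm.trans ?_
      exact congrArg (fun x : A => tmul (M := regular 𝒜) x m)
        ((one_mul a).trans (mul_one a).symm))
    (fun a m => rfl)
    (fun n m hm => tmul_mem_tensorGr (zero_add n) SetLike.GradedOne.one_mem hm)
  hom_inv_id := tensor_hom_ext fun a m => by
    refine (ract_tmul (M := regular 𝒜) (1 : A) a m).symm.trans ?_
    exact congrArg (fun x : A => tmul (M := regular 𝒜) x m) (one_mul a)
  inv_hom_id := by
    ext m
    change M.lact 1 m = m
    rw [map_one, Module.End.one_apply]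

lemma lunit_hom_tmul (M : GrBimod.{w} 𝒜 ℬ) (a : A) (m : M.carrier) :
    toLin (lunit M).hom (tmul (M := regular 𝒜) a m) = M.lact a m := rfl

lemma lunit_inv_apply (M : GrBimod.{w} 𝒜 ℬ) (m : M.carrier) :
    toLin (lunit M).inv m = tmul (M := regular 𝒜) (1 : A) m := rfl

/-- The isomorphism `M ⊗_A A ≅ M`. -/
def runit (M : GrBimod.{w} ℬ 𝒜) : tensor M (regular 𝒜) ≅ M where
  hom := mkHom (tensorLift (M := M) (N := regular 𝒜)
      ((M.ract.toLinearMap ∘ₗ (MulOpposite.opLinearEquiv ℂ).toLinearMap).flip)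
      (fun m b a => by
        change M.ract (MulOpposite.op a) (M.ract (MulOpposite.op b) m) =
          M.ract (MulOpposite.op (b * a)) m
        rw [MulOpposite.op_mul, map_mul, Module.End.mul_apply]))
    (fun a x => by
      refine tensor_induction x ?_ (fun m b => ?_) (fun x y hx hy => ?_)
      · simp only [map_zero]
      · exact (M.act_comm a (MulOpposite.op b) m).symm
      · simp only [map_add, hx, hy])
    (fun a x => by
      refine tensor_induction x ?_ (fun m b => ?_) (fun x y hx hy => ?_)
      · simp only [map_zero]
      · change M.ract (MulOpposite.op (b * a.unop)) m = M.ract a (M.ract (MulOpposite.op b) m)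
        rw [MulOpposite.op_mul, map_mul, Module.End.mul_apply, MulOpposite.op_unop]
      · simp only [map_add, hx, hy])
    (fun n x hx => by
      induction hx using Submodule.span_induction with
      | mem x hx =>
        obtain ⟨i, j, rfl, x, hx, y, hy, rfl⟩ := hx
        exact M.ract_mem hy hx
      | zero => rw [map_zero]; exact zero_mem _
      | add x y _ _ hx hy => rw [map_add]; exact add_mem hx hy
      | smul c x _ hx => rw [map_smul]; exact Submodule.smul_mem _ _ hx)
  inv := mkHom ((tmulBilin M (regular 𝒜)).flip (1 : A))
    (fun a m => rfl)
    (fun a m => by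
      refine (ract_tmul (N := regular 𝒜) m a.unop (1 : A)).trans ?_
      exact congrArg (fun x : A => tmul (N := regular 𝒜) m x)
        ((mul_one _).trans (one_mul _).symm))
    (fun n m hm => tmul_mem_tensorGr (add_zero n) hm SetLike.GradedOne.one_mem)
  hom_inv_id := tensor_hom_ext fun m a => by
    refine (ract_tmul (N := regular 𝒜) m a (1 : A)).trans ?_
    exact congrArg (fun x : A => tmul (N := regular 𝒜) m x) (mul_one a)
  inv_hom_id := by
    ext m
    change M.ract (MulOpposite.op 1) m = m
    rw [MulOpposite.op_one, map_one, Module.End.one_apply]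

lemma runit_hom_tmul (M : GrBimod.{w} ℬ 𝒜) (m : M.carrier) (a : A) :
    toLin (runit M).hom (tmul (N := regular 𝒜) m a) = M.ract (MulOpposite.op a) m := rfl

lemma runit_inv_apply (M : GrBimod.{w} ℬ 𝒜) (m : M.carrier) :
    toLin (runit M).inv m = tmul (N := regular 𝒜) m (1 : A) := rfl

end Unit

/-! ### Homomorphisms between bimodules `P_i ⊗ Q_j` -/

section Free

variable {V : Type u} [Fintype V] (Γ : SimpleGraph V)

/-- The graded bimodule `P_i ⊗_ℂ Q_j⟨p⟩`. -/
abbrev Bs (i j : V) (p : ℤ) : GrBimod.{u} (gr Γ) (gr Γ) := (tensor (P Γ i) (Q Γ j)).shift p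

/-- The tensor `a e_i ⊗ e_j b`. -/
def bs (i j : V) (p : ℤ) (a b : Alg Γ) : (Bs Γ i j p).carrier :=
  tmul (M := P Γ i) (N := Q Γ j) ⟨a * e i, a, rfl⟩ ⟨e j * b, b, rfl⟩

/-- The tensor `a e_i ⊗ e_j b` as a bilinear map. -/
def bsBilin (i j : V) (p : ℤ) : Alg Γ →ₗ[ℂ] Alg Γ →ₗ[ℂ] (Bs Γ i j p).carrier :=
  (tmulBilin (P Γ i) (Q Γ j)).compl₁₂ (LinearMap.mulRight ℂ (e i)).rangeRestrict
    (LinearMap.mulLeft ℂ (e j)).rangeRestrict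

variable {Γ} {i j k l : V} {p q r : ℤ}

lemma lact_bs (c a b : Alg Γ) :
    (Bs Γ i j p).lact c (bs Γ i j p a b) = bs Γ i j p (c * a) b := by
  have : (P Γ i).lact c ⟨a * e i, a, rfl⟩ = ⟨c * a * e i, c * a, rfl⟩ :=
    Subtype.ext (mul_assoc c a (e i)).symm
  refine (tensor_lact_tmul _ _ _).trans ?_
  rw [this]; rfl

lemma ract_bs (c a b : Alg Γ) :
    (Bs Γ i j p).ract (MulOpposite.op c) (bs Γ i j p a b) = bs Γ i j p a (b * c) := by
  have : (Q Γ j).ract (MulOpposite.op c) ⟨e j * b, b, rfl⟩ = ⟨e j * (b * c), b * c, rfl⟩ :=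
    Subtype.ext (mul_assoc (e j) b c)
  refine (tensor_ract_tmul _ _ _).trans ?_
  rw [this]; rfl

@[simp] lemma lsm_bs (c a b : Alg Γ) :
    lsm (M := Bs Γ i j p) c (bs Γ i j p a b) = bs Γ i j p (c * a) b := lact_bs c a b

@[simp] lemma rsm_bs (c a b : Alg Γ) :
    rsm (M := Bs Γ i j p) c (bs Γ i j p a b) = bs Γ i j p a (b * c) := ract_bs c a b

lemma bsBilin_apply (a b : Alg Γ) : bsBilin Γ i j p a b = bs Γ i j p a b := rfl

lemma bs_add_left (a a' b : Alg Γ) :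
    bs Γ i j p (a + a') b = bs Γ i j p a b + bs Γ i j p a' b := by
  simp only [← bsBilin_apply, map_add, LinearMap.add_apply]
lemma bs_add_right (a b b' : Alg Γ) :
    bs Γ i j p a (b + b') = bs Γ i j p a b + bs Γ i j p a b' := by
  simp only [← bsBilin_apply, map_add]
@[simp] lemma bs_smul_left (c : ℂ) (a b : Alg Γ) :
    bs Γ i j p (c • a) b = c • bs Γ i j p a b := by
  simp only [← bsBilin_apply, map_smul, LinearMap.smul_apply]
@[simp] lemma bs_smul_right (c : ℂ) (a b : Alg Γ) :
    bs Γ i j p a (c • b) = c • bs Γ i j p a b := by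
  simp only [← bsBilin_apply, map_smul]
@[simp] lemma bs_zero_left (b : Alg Γ) : bs Γ i j p 0 b = 0 := by
  simp only [← bsBilin_apply, map_zero, LinearMap.zero_apply]
@[simp] lemma bs_mul_e (a b : Alg Γ) : bs Γ i j p (a * e i) b = bs Γ i j p a b := by
  unfold bs
  congr 2
  rw [mul_assoc, e_mul_self]
@[simp] lemma bs_e_mul (a b : Alg Γ) : bs Γ i j p a (e j * b) = bs Γ i j p a b := by
  unfold bs
  congr 2
  rw [← mul_assoc, e_mul_self]
@[simp] lemma bs_e_left (b : Alg Γ) : bs Γ i j p (e i) b = bs Γ i j p 1 b := by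
  rw [← bs_mul_e 1, one_mul]
@[simp] lemma bs_e_right (a : Alg Γ) : bs Γ i j p a (e j) = bs Γ i j p a 1 := by
  rw [← bs_e_mul a 1, mul_one]

@[elab_as_elim]
lemma Bs_induction {φ : (Bs Γ i j p).carrier → Prop} (x : (Bs Γ i j p).carrier) (zero : φ 0)
    (bs : ∀ a b, φ (bs Γ i j p a b)) (add : ∀ x y, φ x → φ y → φ (x + y)) : φ x := by
  refine tensor_induction x zero ?_ add
  rintro ⟨_, a, rfl⟩ ⟨_, b, rfl⟩
  exact bs a b

lemma bs_mem {m n d : ℤ} {a b : Alg Γ} (ha : a ∈ gr Γ m) (hb : b ∈ gr Γ n) (h : m + n + p = d) :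
    bs Γ i j p a b ∈ (Bs Γ i j p).gr d := by
  refine tmul_mem_tensorGr (p := m) (q := n) (by omega) ?_ ?_
  · have := SetLike.mul_mem_graded ha (e_mem i)
    rwa [add_zero] at this
  · have := SetLike.mul_mem_graded (e_mem j) hb
    rwa [zero_add] at this

lemma one_mem_gr : (1 : Alg Γ) ∈ gr Γ 0 := SetLike.GradedOne.one_mem

@[elab_as_elim]
lemma Bs_gr_induction {n : ℤ} {φ : (Bs Γ i j p).carrier → Prop} {x : (Bs Γ i j p).carrier}
    (hx : x ∈ (Bs Γ i j p).gr n) (zero : φ 0)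
    (bs : ∀ r s, r + s + p = n → ∀ a ∈ gr Γ r, ∀ b ∈ gr Γ s, φ (bs Γ i j p a b))
    (add : ∀ x y, φ x → φ y → φ (x + y)) (smul : ∀ (c : ℂ) x, φ x → φ (c • x)) : φ x := by
  induction hx using Submodule.span_induction with
  | mem t ht =>
    obtain ⟨r, s, h, a, ha, b, hb, rfl⟩ := ht
    -- Elements of A e_i are fixed by e_i on the right, so the homogeneous element itself can serve
    -- as the argument of `bs`; a preimage under multiplication by e_i need not be homogeneous.
    have h1 : a.1 * e i = a.1 := by
      obtain ⟨_, a, rfl⟩ := a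
      change a * e i * e i = a * e i
      rw [mul_assoc, e_mul_self]
    have h2 : e j * b.1 = b.1 := by
      obtain ⟨_, b, rfl⟩ := b
      change e j * (e j * b) = e j * b
      rw [← mul_assoc, e_mul_self]
    have : tmul a b = ZigZag.bs Γ i j p a.1 b.1 :=
      congrArg₂ (tmul (M := P Γ i) (N := Q Γ j)) (Subtype.ext h1.symm) (Subtype.ext h2.symm)
    rw [this]
    exact bs r s (by omega) _ ha _ hb
  | zero => exact zero
  | add x y _ _ hx hy => exact add x y hx hy
  | smul c x _ hx => exact smul c x hx

section

variable {M : GrBimod.{u} (gr Γ) (gr Γ)}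

/-- The linear map `P_i ⊗ Q_j → M`, `p ⊗ q ↦ p m q`. -/
def freeLin (i j : V) (p : ℤ) (m : M.carrier) : (Bs Γ i j p).carrier →ₗ[ℂ] M.carrier :=
  tensorLift (LinearMap.mk₂ ℂ (fun p q => M.lact p.1 (M.ract (MulOpposite.op q.1) m))
    (fun p p' q => by simp) (fun c p q => by simp) (fun p q q' => by simp)
    (fun c p q => by simp)) (fun p c q => by simp [Algebra.ofId_apply])

lemma freeLin_bs (m : M.carrier) (a b : Alg Γ) :
    freeLin i j p m (bs Γ i j p a b) = M.lact (a * e i) (M.ract (MulOpposite.op (e j * b)) m) :=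
  tensorLift_tmul _ _ _ _

/-- The homomorphism `P_i ⊗ Q_j⟨p⟩ → M` sending `e_i ⊗ e_j` to `e_i m e_j`. -/
def free (i j : V) (p : ℤ) (m : M.carrier) (hm : m ∈ M.gr p) : Bs Γ i j p ⟶ M :=
  mkHom (freeLin i j p m)
    (fun c x => by
      refine Bs_induction x ?_ (fun a b => ?_) (fun x y hx hy => ?_)
      · simp only [map_zero]
      · rw [lact_bs, freeLin_bs, freeLin_bs, mul_assoc, map_mul M.lact c]; rfl
      · simp only [map_add, hx, hy])
    (fun c x => by
      induction c using MulOpposite.rec' with | _ c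
      refine Bs_induction x ?_ (fun a b => ?_) (fun x y hx hy => ?_)
      · simp only [map_zero]
      · rw [ract_bs, freeLin_bs, freeLin_bs, ← mul_assoc, MulOpposite.op_mul, map_mul M.ract,
          ← M.act_comm]
        rfl
      · simp only [map_add, hx, hy])
    fun n x hx => by
      refine Bs_gr_induction hx ?_ (fun r s h a ha b hb => ?_) (fun x y hx hy => ?_)
        (fun c x hx => ?_)
      · rw [map_zero]; exact zero_mem _
      · rw [freeLin_bs]
        have h1 := M.lact_mem (SetLike.mul_mem_graded ha (e_mem i))
          (M.ract_mem (SetLike.mul_mem_graded (e_mem j) hb) hm)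
        convert h1 using 2
        omega
      · rw [map_add]; exact add_mem hx hy
      · rw [map_smul]; exact Submodule.smul_mem _ _ hx

lemma free_bs (m : M.carrier) (hm : m ∈ M.gr p) (a b : Alg Γ) :
    toLin (free i j p m hm) (bs Γ i j p a b) =
      lsm (M := M) (a * e i) (rsm (M := M) (e j * b) m) := freeLin_bs m a b

/-- The tensor `bs Γ i j p 1 1` is e_i ⊗ e_j, which generates the bimodule. -/
lemma bs_hom_ext {f g : Bs Γ i j p ⟶ M}
    (h : toLin f (bs Γ i j p 1 1) = toLin g (bs Γ i j p 1 1)) : f = g := by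
  ext x
  refine Bs_induction x ?_ (fun a b => ?_) (fun x y hx hy => ?_)
  · rw [map_zero, map_zero]
  · have : bs Γ i j p a b =
        (Bs Γ i j p).lact a ((Bs Γ i j p).ract (MulOpposite.op b) (bs Γ i j p 1 1)) := by
      rw [ract_bs, lact_bs, mul_one, one_mul]
    rw [this, toLin_lact, toLin_ract, toLin_lact, toLin_ract, h]
  · rw [map_add, map_add, hx, hy]

lemma regular_hom_ext {f g : regular (gr Γ) ⟶ M}
    (h : toLin f (1 : Alg Γ) = toLin g (1 : Alg Γ)) : f = g := by
  ext x
  have : x = (regular (gr Γ)).lact x (1 : Alg Γ) := (mul_one x).symm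
  rw [this, toLin_lact, toLin_lact, h]

end

end Free

open GrBimod

section Free

variable {V : Type u} [Fintype V] (Γ : SimpleGraph V)

/-! ### Tensor products of bimodules `P_i ⊗ Q_j` -/

/-- The element `(a e_i ⊗ e_j) ⊗ (c e_k ⊗ e_l d)`. -/
def tb (i j : V) (p : ℤ) (k l : V) (q : ℤ) (a c d : Alg Γ) :
    (tensor (Bs Γ i j p) (Bs Γ k l q)).carrier :=
  tmul (M := Bs Γ i j p) (N := Bs Γ k l q) (bs Γ i j p a 1) (bs Γ k l q c d)

/-- The element `(a e_i ⊗ e_j b) ⊗ 1`. -/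
def tr (i j : V) (p : ℤ) (a b : Alg Γ) : (tensor (Bs Γ i j p) (regular (gr Γ))).carrier :=
  tmul (M := Bs Γ i j p) (N := regular (gr Γ)) (bs Γ i j p a b) (1 : Alg Γ)

/-- The element `1 ⊗ (a e_i ⊗ e_j b)`. -/
def tl (i j : V) (p : ℤ) (a b : Alg Γ) : (tensor (regular (gr Γ)) (Bs Γ i j p)).carrier :=
  tmul (M := regular (gr Γ)) (N := Bs Γ i j p) (1 : Alg Γ) (bs Γ i j p a b)

/-- The element `a ⊗ 1`. -/
def tu (a : Alg Γ) : (tensor (regular (gr Γ)) (regular (gr Γ))).carrier :=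
  tmul (M := regular (gr Γ)) (N := regular (gr Γ)) a (1 : Alg Γ)

variable {Γ} {i j k l : V} {p q r : ℤ}

-- Balancing over A moves `b` across the middle tensor sign. Every product thus acquires the normal
-- form `tb`, with the element of e_j A e_k collected in one place.
@[simp] lemma tmul_bs_bs (a b c d : Alg Γ) :
    tmul (M := Bs Γ i j p) (N := Bs Γ k l q) (bs Γ i j p a b) (bs Γ k l q c d) =
      tb Γ i j p k l q a (b * c) d := by
  rw [tb, ← lact_bs, ← ract_tmul, ract_bs, one_mul]

@[simp] lemma tmul_bs_reg (a b c : Alg Γ) :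
    tmul (M := Bs Γ i j p) (N := regular (gr Γ)) (bs Γ i j p a b) c = tr Γ i j p a (b * c) := by
  rw [tr, ← ract_bs, ract_tmul]
  exact congrArg _ (mul_one c).symm

@[simp] lemma tmul_reg_bs (a b c : Alg Γ) :
    tmul (M := regular (gr Γ)) (N := Bs Γ i j p) c (bs Γ i j p a b) = tl Γ i j p (c * a) b := by
  rw [tl, ← lact_bs, ← ract_tmul]
  exact congrArg (fun x => tmul (M := regular (gr Γ)) (N := Bs Γ i j p) x _) (one_mul c).symm

@[simp] lemma tmul_reg_reg (a b : Alg Γ) :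
    tmul (M := regular (gr Γ)) (N := regular (gr Γ)) a b = tu Γ (a * b) := by
  have h : tmul (M := regular (gr Γ)) (N := regular (gr Γ)) (a * b : Alg Γ) (1 : Alg Γ) =
      tmul (M := regular (gr Γ)) (N := regular (gr Γ)) a (b * 1 : Alg Γ) :=
    ract_tmul (M := regular (gr Γ)) (N := regular (gr Γ)) a b (1 : Alg Γ)
  rw [tu, h, mul_one]

lemma lact_tb (x a c d : Alg Γ) :
    (tensor (Bs Γ i j p) (Bs Γ k l q)).lact x (tb Γ i j p k l q a c d) =
      tb Γ i j p k l q (x * a) c d := by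
  unfold tb; rw [tensor_lact_tmul, lact_bs]
lemma ract_tb (x a c d : Alg Γ) :
    (tensor (Bs Γ i j p) (Bs Γ k l q)).ract (MulOpposite.op x) (tb Γ i j p k l q a c d) =
      tb Γ i j p k l q a c (d * x) := by
  unfold tb; rw [tensor_ract_tmul, ract_bs]

@[simp] lemma lsm_regular (a b : Alg Γ) : lsm (M := regular (gr Γ)) a b = (a * b : Alg Γ) := rfl
@[simp] lemma rsm_regular (a b : Alg Γ) : rsm (M := regular (gr Γ)) a b = (b * a : Alg Γ) := rfl
@[simp] lemma lsm_tb (x a c d : Alg Γ) :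
    lsm (M := tensor (Bs Γ i j p) (Bs Γ k l q)) x (tb Γ i j p k l q a c d) =
      tb Γ i j p k l q (x * a) c d := lact_tb x a c d
@[simp] lemma rsm_tb (x a c d : Alg Γ) :
    rsm (M := tensor (Bs Γ i j p) (Bs Γ k l q)) x (tb Γ i j p k l q a c d) =
      tb Γ i j p k l q a c (d * x) := ract_tb x a c d

@[simp] lemma tb_zero_mid (a d : Alg Γ) : tb Γ i j p k l q a 0 d = 0 := by
  rw [tb, bs_zero_left, GrBimod.tmul_zero]
lemma tb_add_mid (a c c' d : Alg Γ) :
    tb Γ i j p k l q a (c + c') d = tb Γ i j p k l q a c d + tb Γ i j p k l q a c' d := by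
  unfold tb; rw [bs_add_left, GrBimod.tmul_add]
@[simp] lemma tb_smul_mid (x : ℂ) (a c d : Alg Γ) :
    tb Γ i j p k l q a (x • c) d = x • tb Γ i j p k l q a c d := by
  unfold tb
  rw [bs_smul_left]
  exact map_smul (tmulBilin (Bs Γ i j p) (Bs Γ k l q) (bs Γ i j p a 1)) _ _

@[simp] lemma tb_mul_e_left (a c d : Alg Γ) :
    tb Γ i j p k l q (a * e i) c d = tb Γ i j p k l q a c d := by unfold tb; rw [bs_mul_e]
@[simp] lemma tb_e_left (c d : Alg Γ) :
    tb Γ i j p k l q (e i) c d = tb Γ i j p k l q 1 c d := by unfold tb; rw [bs_e_left]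
@[simp] lemma tb_mul_e_mid (a c d : Alg Γ) :
    tb Γ i j p k l q a (c * e k) d = tb Γ i j p k l q a c d := by unfold tb; rw [bs_mul_e]
@[simp] lemma tb_e_mul_mid (a c d : Alg Γ) :
    tb Γ i j p k l q a (e j * c) d = tb Γ i j p k l q a c d := by
  rw [← tmul_bs_bs, bs_e_right, tmul_bs_bs, one_mul]
@[simp] lemma tb_e_mid (a d : Alg Γ) :
    tb Γ i j p j l q a (e j) d = tb Γ i j p j l q a 1 d := by unfold tb; rw [bs_e_left]
@[simp] lemma tb_e_mul_right (a c d : Alg Γ) :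
    tb Γ i j p k l q a c (e l * d) = tb Γ i j p k l q a c d := by unfold tb; rw [bs_e_mul]
@[simp] lemma tb_e_right (a c : Alg Γ) :
    tb Γ i j p k l q a c (e l) = tb Γ i j p k l q a c 1 := by unfold tb; rw [bs_e_right]
@[simp] lemma tr_e_right (a : Alg Γ) : tr Γ i j p a (e j) = tr Γ i j p a 1 := by
  unfold tr; rw [bs_e_right]
@[simp] lemma tl_e_left (b : Alg Γ) : tl Γ i j p (e i) b = tl Γ i j p 1 b := by
  unfold tl; rw [bs_e_left]

@[elab_as_elim]
lemma tb_induction {φ : (tensor (Bs Γ i j p) (Bs Γ k l q)).carrier → Prop}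
    (x : (tensor (Bs Γ i j p) (Bs Γ k l q)).carrier) (zero : φ 0)
    (tb : ∀ a c d, φ (tb Γ i j p k l q a c d)) (add : ∀ x y, φ x → φ y → φ (x + y)) : φ x := by
  refine tensor_induction x zero (fun m n => ?_) add
  refine Bs_induction m ?_ (fun a b => ?_) (fun x y hx hy => ?_)
  · rw [GrBimod.zero_tmul]; exact zero
  · refine Bs_induction n ?_ (fun c d => ?_) (fun x y hx hy => ?_)
    · rw [GrBimod.tmul_zero]; exact zero
    · rw [tmul_bs_bs]; exact tb _ _ _
    · rw [GrBimod.tmul_add]; exact add _ _ hx hy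
  · rw [GrBimod.add_tmul]; exact add _ _ hx hy

section

variable {M : GrBimod.{u} (gr Γ) (gr Γ)}

/-- The two bimodule actions absorb the outer factors, so a homomorphism is determined by its values
on the middle space e_j A e_k. -/
lemma tb_hom_ext {f g : tensor (Bs Γ i j p) (Bs Γ k l q) ⟶ M}
    (h : ∀ c, toLin f (tb Γ i j p k l q 1 (e j * c * e k) 1) =
      toLin g (tb Γ i j p k l q 1 (e j * c * e k) 1)) : f = g := by
  ext x
  refine tb_induction x ?_ (fun a c d => ?_) (fun x y hx hy => ?_)
  · rw [map_zero, map_zero]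
  · have : tb Γ i j p k l q a c d = (tensor (Bs Γ i j p) (Bs Γ k l q)).lact a
        ((tensor (Bs Γ i j p) (Bs Γ k l q)).ract (MulOpposite.op d)
          (tb Γ i j p k l q 1 (e j * c * e k) 1)) := by
      rw [ract_tb, lact_tb, mul_one, one_mul, tb_mul_e_mid, tb_e_mul_mid]
    rw [this, toLin_lact, toLin_ract, toLin_lact, toLin_ract, h]
  · rw [map_add, map_add, hx, hy]

/-- The middle space e_j A e_j is spanned by e_j and x_j, so two values suffice. -/
lemma tb_hom_ext_self {f g : tensor (Bs Γ i j p) (Bs Γ j l q) ⟶ M}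
    (h1 : toLin f (tb Γ i j p j l q 1 1 1) = toLin g (tb Γ i j p j l q 1 1 1))
    (h2 : toLin f (tb Γ i j p j l q 1 (loop j) 1) = toLin g (tb Γ i j p j l q 1 (loop j) 1)) :
    f = g :=
  tb_hom_ext fun c => by
    rw [e_mul_mul_e_self, tb_add_mid, tb_smul_mid, tb_smul_mid, tb_e_mid, map_add, map_add,
      map_smul, map_smul, map_smul, map_smul, h1, h2]

lemma tb_hom_ext_adj (hjk : Γ.Adj j k) {f g : tensor (Bs Γ i j p) (Bs Γ k l q) ⟶ M}
    (h : toLin f (tb Γ i j p k l q 1 (arr hjk) 1) = toLin g (tb Γ i j p k l q 1 (arr hjk) 1)) :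
    f = g :=
  tb_hom_ext fun c => by
    rw [e_mul_mul_e_of_adj hjk, tb_smul_mid, map_smul, map_smul, h]

/-- The middle space is zero, hence so is the whole tensor product; used with identities and zero
maps this recognises a zero object. -/
lemma tb_hom_ext_not_adj (hne : j ≠ k) (hjk : ¬ Γ.Adj j k)
    (f g : tensor (Bs Γ i j p) (Bs Γ k l q) ⟶ M) : f = g :=
  tb_hom_ext fun c => by
    rw [e_mul_mul_e_of_not_adj hne hjk, tb_zero_mid, map_zero, map_zero]

lemma tr_hom_ext {f g : tensor (Bs Γ i j p) (regular (gr Γ)) ⟶ M}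
    (h : toLin f (tr Γ i j p 1 1) = toLin g (tr Γ i j p 1 1)) : f = g := by
  rw [← cancel_epi (runit (Bs Γ i j p)).inv]
  exact bs_hom_ext h

lemma tl_hom_ext {f g : tensor (regular (gr Γ)) (Bs Γ i j p) ⟶ M}
    (h : toLin f (tl Γ i j p 1 1) = toLin g (tl Γ i j p 1 1)) : f = g := by
  rw [← cancel_epi (lunit (Bs Γ i j p)).inv]
  exact bs_hom_ext h

end

lemma runit_tr (a b : Alg Γ) :
    toLin (runit (Bs Γ i j p)).hom (tr Γ i j p a b) = bs Γ i j p a b := by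
  refine (runit_hom_tmul _ _ _).trans ?_
  rw [ract_bs, mul_one]
lemma lunit_tl (a b : Alg Γ) :
    toLin (lunit (Bs Γ i j p)).hom (tl Γ i j p a b) = bs Γ i j p a b := by
  refine (lunit_hom_tmul _ _ _).trans ?_
  rw [lact_bs, one_mul]
lemma runit_tu (a : Alg Γ) : toLin (runit (regular (gr Γ))).hom (tu Γ a) = a :=
  one_mul a |> fun _ => (runit_hom_tmul _ _ _).trans (mul_one a)

lemma tb_mem {m n s d : ℤ} {a b c : Alg Γ} (ha : a ∈ gr Γ m) (hb : b ∈ gr Γ n) (hc : c ∈ gr Γ s)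
    (h : m + n + s + p + q = d) :
    tb Γ i j p k l q a b c ∈ (tensor (Bs Γ i j p) (Bs Γ k l q)).gr d :=
  tmul_mem_tensorGr (p := m + 0 + p) (q := n + s + q) (by omega) (bs_mem ha one_mem_gr rfl)
    (bs_mem hb hc rfl)

/-! ### Contractions -/

/-- The linear map `e_j ⊗ q ↦ φ(p' ) e_i ⊗ q'` -/
def contrAux (φ : Alg Γ →ₗ[ℂ] ℂ) (i k l : V) (q r : ℤ) :
    (Bs Γ k l q).carrier →ₗ[ℂ] (Bs Γ i l r).carrier :=
  tensorLift (M := P Γ k) (N := Q Γ l) (LinearMap.mk₂ ℂ (fun a b => φ a.1 • bs Γ i l r 1 b.1)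
    (fun p p' q => by simp [add_smul]) (fun c p q => by simp [mul_smul])
    (fun p q q' => by simp [bs_add_right]) (fun c p q => by simp [smul_comm c]))
    (fun p c q => by simp [Algebra.ofId_apply, smul_smul])

lemma contrAux_bs (φ : Alg Γ →ₗ[ℂ] ℂ) (a b : Alg Γ) :
    contrAux φ i k l q r (bs Γ k l q a b) = φ (a * e k) • bs Γ i l r 1 b := by
  refine (tensorLift_tmul (M := P Γ k) (N := Q Γ l) _ _ _ _).trans ?_
  refine congrArg (fun x : (Bs Γ i l r).carrier => φ (a * e k) • x) ?_
  exact bs_e_mul 1 b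

/-- The bilinear map `(p ⊗ q, p' ⊗ q') ↦ φ(q p') p ⊗ q'`. -/
def contrBilin (φ : Alg Γ →ₗ[ℂ] ℂ) (i j : V) (p : ℤ) (k l : V) (q r : ℤ) :
    (Bs Γ i j p).carrier →ₗ[ℂ] (Bs Γ k l q).carrier →ₗ[ℂ] (Bs Γ i l r).carrier :=
  tensorLift (M := P Γ i) (N := Q Γ j) (LinearMap.mk₂ ℂ
      (fun a b => ((Bs Γ i l r).lact a.1) ∘ₗ contrAux φ i k l q r ∘ₗ (Bs Γ k l q).lact b.1)
      (fun a a' b => by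
        rw [Submodule.coe_add, map_add, LinearMap.add_comp])
      (fun c a b => by
        rw [Submodule.coe_smul, map_smul, LinearMap.smul_comp])
      (fun a b b' => by
        rw [Submodule.coe_add, map_add, LinearMap.comp_add, LinearMap.comp_add])
      (fun c a b => by
        rw [Submodule.coe_smul, map_smul, LinearMap.comp_smul, LinearMap.comp_smul]))
    (fun a c b => by
      simp [Algebra.ofId_apply])

lemma contrBilin_bs (φ : Alg Γ →ₗ[ℂ] ℂ) (a c : Alg Γ) (x : (Bs Γ k l q).carrier) :
    contrBilin φ i j p k l q r (bs Γ i j p a c) x = (Bs Γ i l r).lact (a * e i)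
      (contrAux φ i k l q r ((Bs Γ k l q).lact (e j * c) x)) :=
  LinearMap.congr_fun (tensorLift_tmul (M := P Γ i) (N := Q Γ j) _ _ _ _) x

lemma contrBilin_bs_bs (φ : Alg Γ →ₗ[ℂ] ℂ) (a b c d : Alg Γ) :
    contrBilin φ i j p k l q r (bs Γ i j p a b) (bs Γ k l q c d) =
      φ (e j * (b * c) * e k) • bs Γ i l r a d := by
  rw [contrBilin_bs, lact_bs, contrAux_bs, map_smul, lact_bs, mul_one, bs_mul_e, mul_assoc (e j)]

/-- The linear map `(p ⊗ q) ⊗ (p' ⊗ q') ↦ φ(q p') p ⊗ q'`. -/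
def contrLin (φ : Alg Γ →ₗ[ℂ] ℂ) (i j : V) (p : ℤ) (k l : V) (q r : ℤ) :
    TensorCarrier (Bs Γ i j p) (Bs Γ k l q) →ₗ[ℂ] (Bs Γ i l r).carrier :=
  tensorLift (contrBilin φ i j p k l q r)
    (fun m b n => by
      refine Bs_induction m ?_ (fun a c => ?_) (fun x y hx hy => ?_)
      · rw [map_zero, map_zero, LinearMap.zero_apply, LinearMap.zero_apply]
      · rw [ract_bs, contrBilin_bs, contrBilin_bs, ← mul_assoc, map_mul (Bs Γ k l q).lact (e j * c) b,
          Module.End.mul_apply]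
      · rw [map_add, map_add, map_add, LinearMap.add_apply, LinearMap.add_apply, hx, hy])

lemma contrLin_tb (φ : Alg Γ →ₗ[ℂ] ℂ) (a c d : Alg Γ) :
    contrLin φ i j p k l q r (tb Γ i j p k l q a c d) =
      φ (e j * c * e k) • bs Γ i l r a d := by
  refine (tensorLift_tmul _ _ _ _).trans ?_
  rw [contrBilin_bs_bs, one_mul]

/-- The homomorphism `(p ⊗ q) ⊗ (p' ⊗ q') ↦ φ(q p') p ⊗ q'`, for a functional `φ` which vanishes
on homogeneous elements of degree different from `d`. -/
def contr (φ : Alg Γ →ₗ[ℂ] ℂ) {d : ℤ} (hφ : ∀ {n : ℤ}, n ≠ d → ∀ {a : Alg Γ}, a ∈ algGr n → φ a = 0)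
    (i j : V) (p : ℤ) (k l : V) (q r : ℤ) (hr : p + q + d = r) :
    tensor (Bs Γ i j p) (Bs Γ k l q) ⟶ Bs Γ i l r :=
  mkHom (contrLin φ i j p k l q r)
    (fun x t => by
      refine tb_induction t ?_ (fun a c d => ?_) (fun x y hx hy => ?_)
      · simp only [map_zero]
      · rw [lact_tb, contrLin_tb, contrLin_tb, map_smul, lact_bs]
      · simp only [map_add, hx, hy])
    (fun x t => by
      induction x using MulOpposite.rec' with | _ x
      refine tb_induction t ?_ (fun a c d => ?_) (fun x y hx hy => ?_)
      · simp only [map_zero]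
      · rw [ract_tb, contrLin_tb, contrLin_tb, map_smul, ract_bs]
      · simp only [map_add, hx, hy])
    (fun n x hx => by
      induction hx using Submodule.span_induction with
      | mem x hx =>
        obtain ⟨m, n, rfl, x, hx, y, hy, rfl⟩ := hx
        refine Bs_gr_induction hx ?_ (fun s t h a ha b hb => ?_) (fun x x' hx hx' => ?_)
          (fun c x hx => ?_)
        · rw [GrBimod.zero_tmul, map_zero]; exact zero_mem _
        · refine Bs_gr_induction hy ?_ (fun s' t' h' a' ha' b' hb' => ?_) (fun x x' hx hx' => ?_)
            (fun c x hx => ?_)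
          · rw [GrBimod.tmul_zero, map_zero]; exact zero_mem _
          · rw [tmul_bs_bs, contrLin_tb]
            -- If the middle product has degree different from `d`, then `φ` kills it; otherwise the
            -- degree of the outer factors is the expected one by `hr`.
            by_cases hd : t + s' = d
            · exact Submodule.smul_mem _ _ (bs_mem ha hb' (by omega))
            · have h1 := SetLike.mul_mem_graded (SetLike.mul_mem_graded (e_mem j)
                (SetLike.mul_mem_graded hb ha')) (e_mem k)
              rw [hφ (by omega) h1, zero_smul]
              exact zero_mem _
          · rw [GrBimod.tmul_add, map_add]; exact add_mem hx hx'
          · have : tmul (M := Bs Γ i j p) (N := Bs Γ k l q) (bs Γ i j p a b) (c • x) =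
              c • tmul (bs Γ i j p a b) x :=
              map_smul (tmulBilin (Bs Γ i j p) (Bs Γ k l q) (bs Γ i j p a b)) c x
            rw [this, map_smul]; exact Submodule.smul_mem _ _ hx
        · rw [GrBimod.add_tmul, map_add]; exact add_mem hx hx'
        · have : tmul (M := Bs Γ i j p) (N := Bs Γ k l q) (c • x) y = c • tmul x y := by
            rw [← tmulBilin_apply, map_smul]; rfl
          rw [this, map_smul]; exact Submodule.smul_mem _ _ hx
      | zero => rw [map_zero]; exact zero_mem _
      | add x y _ _ hx hy => rw [map_add]; exact add_mem hx hy
      | smul c x _ hx => rw [map_smul]; exact Submodule.smul_mem _ _ hx)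

lemma contr_tb (φ : Alg Γ →ₗ[ℂ] ℂ) {d : ℤ}
    (hφ : ∀ {n : ℤ}, n ≠ d → ∀ {a : Alg Γ}, a ∈ algGr n → φ a = 0) (hr : p + q + d = r)
    (a b c : Alg Γ) : toLin (contr φ hφ i j p k l q r hr) (tb Γ i j p k l q a b c) =
      φ (e j * b * e k) • bs Γ i l r a c := contrLin_tb φ a b c

end Free

/-! ### Square, cube and pentagon shaped matrix data -/

namespace MatrixData

section

variable {C : Type*} [Category C] [Preadditive C]

/-- Transport of a presentation along isomorphisms of the objects. -/
def Presents.congr {T : MatrixData C} {K : CochainComplex C ℤ} (M : T.Presents K)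
    {X' : T.J → C} {D' : ∀ j k, X' j ⟶ X' k} (hD' : ∀ j k, T.deg k ≠ T.deg j + 1 → D' j k = 0)
    (φ : ∀ j, T.X j ≅ X' j)
    (hD : ∀ j k, T.deg k = T.deg j + 1 → T.D j k ≫ (φ k).hom = (φ j).hom ≫ D' j k) :
    (MatrixData.mk T.J T.deg X' D' hD').Presents K where
  ι j n := (φ j).inv ≫ M.ι j n
  π j n := M.π j n ≫ (φ j).hom
  ι_eq_zero j n h := by rw [M.ι_eq_zero j n h, comp_zero]
  π_eq_zero j n h := by rw [M.π_eq_zero j n h, zero_comp]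
  ι_π j k n h := by
    rw [Category.assoc, ← Category.assoc (M.ι j n), M.ι_π j k n h]
    by_cases hjk : j = k
    · subst hjk
      rw [one_self, Category.id_comp, Iso.inv_hom_id]
      exact (one_self _ _).symm
    · refine Eq.trans ?_ (one_of_ne _ hjk).symm
      rw [T.one_of_ne hjk, zero_comp, comp_zero]
  total n := by simpa using M.total n
  ι_d j n m h hm := by
    rw [Category.assoc, M.ι_d j n m h hm, Preadditive.comp_sum]
    refine Finset.sum_congr rfl fun k _ => ?_
    rw [← Category.assoc, ← Category.assoc]
    congr 1
    by_cases hk : T.deg k = T.deg j + 1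
    · rw [Iso.eq_comp_inv, Category.assoc, hD j k hk, Iso.inv_hom_id_assoc]
    · rw [T.D_deg j k hk, comp_zero]
      exact (zero_comp.symm.trans (congrArg (· ≫ (φ k).inv) (hD' j k hk).symm))

/-- Matrix data for the total complex of a square `X → Y₁ ⊕ Y₂ → W`. -/
@[reducible] def square {X Y₁ Y₂ W : C} (α : X ⟶ Y₁) (β : X ⟶ Y₂) (γ : Y₁ ⟶ W) (δ : Y₂ ⟶ W)
    (n m : ℤ) : MatrixData C where
  J := Bool × Bool
  deg j := (match j.1 with | false => n | true => n + 1) +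
    (match j.2 with | false => m | true => m + 1)
  X
  | (false, false) => X
  | (false, true) => Y₁
  | (true, false) => Y₂
  | (true, true) => W
  D
  | (false, false), (false, true) => α
  | (false, false), (true, false) => β
  | (false, true), (true, true) => γ
  | (true, false), (true, true) => δ
  | _, _ => 0
  D_deg := by
    rintro ⟨_ | _, _ | _⟩ ⟨_ | _, _ | _⟩ h <;> first | rfl | exact absurd (by ring) h

/-- Matrix data for the total complex of a cube. -/
@[reducible] def cube {X Y₁ Y₂ Y₃ W₁ W₂ W₃ Z : C} (x₁ : X ⟶ Y₁) (x₂ : X ⟶ Y₂) (x₃ : X ⟶ Y₃)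
    (y₁₁ : Y₁ ⟶ W₁) (y₁₃ : Y₁ ⟶ W₃) (y₂₁ : Y₂ ⟶ W₁) (y₂₂ : Y₂ ⟶ W₂) (y₃₂ : Y₃ ⟶ W₂)
    (y₃₃ : Y₃ ⟶ W₃) (w₁ : W₁ ⟶ Z) (w₂ : W₂ ⟶ Z) (w₃ : W₃ ⟶ Z) (n m k : ℤ) : MatrixData C where
  J := (Bool × Bool) × Bool
  deg j := ((match j.1.1 with | false => n | true => n + 1) +
    (match j.1.2 with | false => m | true => m + 1)) +
    (match j.2 with | false => k | true => k + 1)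
  X
  | ((false, false), false) => X
  | ((false, true), false) => Y₁
  | ((false, false), true) => Y₂
  | ((true, false), false) => Y₃
  | ((false, true), true) => W₁
  | ((true, false), true) => W₂
  | ((true, true), false) => W₃
  | ((true, true), true) => Z
  D
  | ((false, false), false) => fun
    | ((false, true), false) => x₁
    | ((false, false), true) => x₂
    | ((true, false), false) => x₃
    | _ => 0
  | ((false, true), false) => fun
    | ((false, true), true) => y₁₁
    | ((true, true), false) => y₁₃
    | _ => 0
  | ((false, false), true) => fun
    | ((false, true), true) => y₂₁
    | ((true, false), true) => y₂₂
    | _ => 0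
  | ((true, false), false) => fun
    | ((true, false), true) => y₃₂
    | ((true, true), false) => y₃₃
    | _ => 0
  | ((false, true), true) => fun
    | ((true, true), true) => w₁
    | _ => 0
  | ((true, false), true) => fun
    | ((true, true), true) => w₂
    | _ => 0
  | ((true, true), false) => fun
    | ((true, true), true) => w₃
    | _ => 0
  | ((true, true), true) => fun
    | _ => 0
  D_deg := by
    rintro ⟨⟨_ | _, _ | _⟩, _ | _⟩ ⟨⟨_ | _, _ | _⟩, _ | _⟩ h <;>
      first | rfl | exact absurd (by ring) h

/-- Matrix data for a complex `X₁ ⊕ X₂ → Y₁ ⊕ Y₂ → Z` in degrees `-2`, `-1` and `0`. -/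
@[reducible] def penta {X₁ X₂ Y₁ Y₂ Z : C} (x₁₁ : X₁ ⟶ Y₁) (x₁₂ : X₁ ⟶ Y₂) (x₂₁ : X₂ ⟶ Y₁)
    (x₂₂ : X₂ ⟶ Y₂) (y₁ : Y₁ ⟶ Z) (y₂ : Y₂ ⟶ Z) : MatrixData C where
  J := Option (Bool × Bool)
  deg
  | some (false, _) => -2
  | some (true, _) => -1
  | none => 0
  X
  | some (false, false) => X₁
  | some (false, true) => X₂
  | some (true, false) => Y₁
  | some (true, true) => Y₂
  | none => Z
  D
  | some (false, false), some (true, false) => x₁₁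
  | some (false, false), some (true, true) => x₁₂
  | some (false, true), some (true, false) => x₂₁
  | some (false, true), some (true, true) => x₂₂
  | some (true, false), none => y₁
  | some (true, true), none => y₂
  | _, _ => 0
  D_deg := by
    rintro (_ | ⟨_ | _, _ | _⟩) (_ | ⟨_ | _, _ | _⟩) h <;>
      first | rfl | exact absurd (by norm_num) h

end

/-! ### Gaussian elimination in a square -/

section

variable {C : Type*} [Category C] [Preadditive C] {X Y₁ Y₂ W Z : C} {α : X ⟶ Y₁} {β : X ⟶ Y₂}
  {γ : Y₁ ⟶ W} {δ : Y₂ ⟶ W} {n m : ℤ} {K K' : CochainComplex C ℤ}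

/-- Gaussian elimination in a square of which only `Y₁` survives. -/
def Presents.squareHomotopyEquiv (M : (square α β γ δ n m).Presents K)
    (M' : (single Z 0).Presents K') (hnm : n + m = -1)
    (r₁ : Y₁ ⟶ Z) (r₂ : Y₂ ⟶ Z) (h₁ : Z ⟶ Y₁) (h₂ : Z ⟶ Y₂)
    (θ₁ : Y₁ ⟶ X) (θ₂ : Y₂ ⟶ X) (θ₁' : W ⟶ Y₁) (θ₂' : W ⟶ Y₂)
    (e1 : α ≫ r₁ + β ≫ r₂ = 0) (e2 : h₁ ≫ γ + h₂ ≫ δ = 0)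
    (e3 : α ≫ θ₁ + β ≫ θ₂ + 𝟙 X = 0) (e4 : θ₁' ≫ γ + θ₂' ≫ δ + 𝟙 W = 0)
    (e5 : r₁ ≫ h₁ = γ ≫ θ₁' + θ₁ ≫ α + 𝟙 Y₁) (e6 : r₁ ≫ h₂ = γ ≫ θ₂' + θ₁ ≫ β)
    (e7 : r₂ ≫ h₁ = δ ≫ θ₁' + θ₂ ≫ α) (e8 : r₂ ≫ h₂ = δ ≫ θ₂' + θ₂ ≫ β + 𝟙 Y₂)
    (e9 : h₁ ≫ r₁ + h₂ ≫ r₂ = 𝟙 Z) : HomotopyEquiv K K' :=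
  -- The maps `r` and `h` live on the two middle terms, and the homotopy has components from the
  -- middle terms to `X` and from `W` to the middle terms. `e1` and `e2` are the chain map
  -- conditions, `e3` to `e8` are the entries of the homotopy relation on `X`, on `W` and on the
  -- middle terms, and `e9` says that the other composite is the identity.
  M.homotopyEquiv M'
    (fun | (false, true), _ => r₁ | (true, false), _ => r₂ | (false, false), _ => 0
         | (true, true), _ => 0)
    (fun | _, (false, true) => h₁ | _, (true, false) => h₂ | _, (false, false) => 0
         | _, (true, true) => 0)
    (fun | (false, true), (false, false) => θ₁ | (true, false), (false, false) => θ₂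
         | (true, true), (false, true) => θ₁' | (true, true), (true, false) => θ₂' | _, _ => 0)
    (by rintro ⟨_ | _, _ | _⟩ _ h <;> first | rfl | (simp at h; omega))
    (by rintro _ ⟨_ | _, _ | _⟩ h <;> first | rfl | (simp at h; omega))
    (by
      rintro ⟨_ | _, _ | _⟩ ⟨_ | _, _ | _⟩ h <;>
        first | rfl | (simp at h; omega))
    (by
      rintro ⟨_ | _, _ | _⟩ _ <;>
        simp only [Fintype.sum_prod_type, Fintype.sum_bool, Finset.univ_unique,
          Finset.sum_singleton, comp_zero, zero_comp, add_zero, zero_add, implies_true]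
      exact fun _ => (add_comm _ _).trans e1)
    (by
      rintro _ ⟨_ | _, _ | _⟩ <;>
        simp only [Fintype.sum_prod_type, Fintype.sum_bool, Finset.univ_unique,
          Finset.sum_singleton, comp_zero, zero_comp, add_zero, zero_add, implies_true]
      exact fun _ => ((add_comm _ _).trans e2).symm)
    (by
      rintro ⟨_ | _, _ | _⟩ ⟨_ | _, _ | _⟩ - <;>
        simp only [Fintype.sum_prod_type, Fintype.sum_bool, Finset.univ_unique,
          Finset.sum_singleton, comp_zero, zero_comp, add_zero, zero_add, one, Prod.mk.injEq,
          reduceCtorEq, and_true, and_false, dite_false]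
      · rw [add_comm (β ≫ _)]; exact e3.symm
      · exact e5
      · exact e6
      · exact e7
      · exact e8
      · rw [add_comm (θ₂' ≫ _)]; exact e4.symm)
    (by
      rintro j _ -
      simp only [Fintype.sum_prod_type, Fintype.sum_bool, comp_zero, add_zero, zero_add]
      rw [add_comm, e9]
      exact ((single Z 0).one_self j).symm)

end

end MatrixData

/-! ### Gaussian elimination in a cube -/

namespace MatrixData

section

variable {C : Type*} [Category C] [Preadditive C] {X Y₁ Y₂ Y₃ W₁ W₂ W₃ Z X₁ X₂ V₁ V₂ A : C}
  {x₁ : X ⟶ Y₁} {x₂ : X ⟶ Y₂} {x₃ : X ⟶ Y₃}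
  {y₁₁ : Y₁ ⟶ W₁} {y₁₃ : Y₁ ⟶ W₃} {y₂₁ : Y₂ ⟶ W₁} {y₂₂ : Y₂ ⟶ W₂} {y₃₂ : Y₃ ⟶ W₂}
  {y₃₃ : Y₃ ⟶ W₃} {w₁ : W₁ ⟶ Z} {w₂ : W₂ ⟶ Z} {w₃ : W₃ ⟶ Z}
  {s₁₁ : X₁ ⟶ V₁} {s₁₂ : X₁ ⟶ V₂} {s₂₁ : X₂ ⟶ V₁} {s₂₂ : X₂ ⟶ V₂} {t₁ : V₁ ⟶ A} {t₂ : V₂ ⟶ A}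
  {K K' : CochainComplex C ℤ}

set_option maxHeartbeats 2000000 in
/-- Gaussian elimination in a cube for the two components `X → Y₁` and `Y₁ → W₁`, the first of
which is a split monomorphism and the second a complementary split epimorphism. -/
def Presents.cubeHomotopyEquiv
    (M : (cube x₁ x₂ x₃ y₁₁ y₁₃ y₂₁ y₂₂ y₃₂ y₃₃ w₁ w₂ w₃ (-1) (-1) (-1)).Presents K)
    (M' : (penta s₁₁ s₁₂ s₂₁ s₂₂ t₁ t₂).Presents K')
    (i₂ : Y₂ ≅ X₁) (i₃ : Y₃ ≅ X₂) (k₂ : W₂ ≅ V₂) (k₃ : W₃ ≅ V₁) (l : Z ≅ A)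
    (θ : Y₁ ⟶ X) (τ : W₁ ⟶ Y₁)
    (d1 : x₁ ≫ y₁₃ + x₃ ≫ y₃₃ = 0) (d2 : x₂ ≫ y₂₂ + x₃ ≫ y₃₂ = 0)
    (d3 : y₁₁ ≫ w₁ + y₁₃ ≫ w₃ = 0) (hθ : x₁ ≫ θ + 𝟙 X = 0) (hτ : τ ≫ y₁₁ + 𝟙 W₁ = 0)
    (hτθ : τ ≫ θ = 0) (hid : θ ≫ x₂ ≫ y₂₁ ≫ τ = y₁₁ ≫ τ + θ ≫ x₁ + 𝟙 Y₁)
    (c1 : y₂₁ ≫ τ ≫ y₁₃ ≫ k₃.hom = i₂.hom ≫ s₁₁) (c2 : y₂₂ ≫ k₂.hom = i₂.hom ≫ s₁₂)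
    (c3 : y₃₃ ≫ k₃.hom = i₃.hom ≫ s₂₁) (c4 : y₃₂ ≫ k₂.hom = i₃.hom ≫ s₂₂)
    (c5 : w₂ ≫ l.hom = k₂.hom ≫ t₂) (c6 : w₃ ≫ l.hom = k₃.hom ≫ t₁) : HomotopyEquiv K K' := by
  -- The hypotheses are put in a form followed by an arbitrary map, so that they rewrite inside
  -- right-associated composites.
  have d1' : ∀ {T : C} (f : W₃ ⟶ T), x₁ ≫ y₁₃ ≫ f = -(x₃ ≫ y₃₃ ≫ f) := fun f => by
    simpa using congrArg (· ≫ f) (eq_neg_of_add_eq_zero_left d1)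
  have d2' : ∀ {T : C} (f : W₂ ⟶ T), x₂ ≫ y₂₂ ≫ f = -(x₃ ≫ y₃₂ ≫ f) := fun f => by
    simpa using congrArg (· ≫ f) (eq_neg_of_add_eq_zero_left d2)
  have hτ' : ∀ {T : C} (f : W₁ ⟶ T), τ ≫ y₁₁ ≫ f = -f := fun f => by
    simpa using congrArg (· ≫ f) (eq_neg_of_add_eq_zero_left hτ)
  have hθ' : ∀ {T : C} (f : X ⟶ T), x₁ ≫ θ ≫ f = -f := fun f => by
    simpa using congrArg (· ≫ f) (eq_neg_of_add_eq_zero_left hθ)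
  have d3' : ∀ {T : C} (f : Z ⟶ T), y₁₃ ≫ w₃ ≫ f = -(y₁₁ ≫ w₁ ≫ f) := fun f => by
    simpa using congrArg (· ≫ f) (eq_neg_of_add_eq_zero_right d3)
  have hτθ' : ∀ {T : C} (f : X ⟶ T), τ ≫ θ ≫ f = 0 := fun f => by
    simpa using congrArg (· ≫ f) hτθ
  have hid' : ∀ {T : C} (f : Y₁ ⟶ T),
      θ ≫ x₂ ≫ y₂₁ ≫ τ ≫ f = y₁₁ ≫ τ ≫ f + θ ≫ x₁ ≫ f + f := fun f => by
    simpa using congrArg (· ≫ f) hid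
  have c1' : i₂.inv ≫ y₂₁ ≫ τ ≫ y₁₃ = s₁₁ ≫ k₃.inv := by
    rw [Iso.eq_comp_inv, ← cancel_epi i₂.hom]
    simpa using c1
  have c2' : i₂.inv ≫ y₂₂ = s₁₂ ≫ k₂.inv := by
    rw [Iso.inv_comp_eq, ← Category.assoc, Iso.eq_comp_inv, c2]
  have c3' : i₃.inv ≫ y₃₃ = s₂₁ ≫ k₃.inv := by
    rw [Iso.inv_comp_eq, ← Category.assoc, Iso.eq_comp_inv, c3]
  have c4' : i₃.inv ≫ y₃₂ = s₂₂ ≫ k₂.inv := by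
    rw [Iso.inv_comp_eq, ← Category.assoc, Iso.eq_comp_inv, c4]
  have c5' : k₂.inv ≫ w₂ = t₂ ≫ l.inv := by
    rw [Iso.inv_comp_eq, ← Category.assoc, Iso.eq_comp_inv, c5]
  have c6' : k₃.inv ≫ w₃ = t₁ ≫ l.inv := by
    rw [Iso.inv_comp_eq, ← Category.assoc, Iso.eq_comp_inv, c6]
  -- The terms `X` and `W₁` are cancelled against complementary parts of `Y₁`, with partial inverses
  -- `θ` and `τ` up to sign. As usual in Gaussian elimination, `r` and `h` are the given
  -- isomorphisms on the surviving terms, corrected by zigzags: through `θ` on `Y₁`, and through `τ`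
  -- on `W₁` and into `Y₁`. The new entry `s₁₁` from `X₁` to `V₁` is the zigzag `Y₂ → W₁ → Y₁ → W₃`,
  -- which is the content of `c1`. With p = -θ x₁ and q = -y₁₁ τ, written in order of composition,
  -- `hid` says that 1 - p - q is the cross term through `Y₂`. Since x₁ y₁₁ = -x₂ y₂₁ in a complex,
  -- this amounts to (1 - p)(1 - q) = 0.
  refine M.homotopyEquiv M'
    (fun
      | ((false, true), false) => fun
        | some (false, false) => θ ≫ x₂ ≫ i₂.hom
        | some (false, true) => θ ≫ x₃ ≫ i₃.hom
        | some (true, _) => 0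
        | none => 0
      | ((false, false), true) => fun
        | some (false, false) => i₂.hom
        | some (false, true) => 0
        | some (true, _) => 0
        | none => 0
      | ((true, false), false) => fun
        | some (false, false) => 0
        | some (false, true) => i₃.hom
        | some (true, _) => 0
        | none => 0
      | ((false, true), true) => fun
        | some (true, false) => τ ≫ y₁₃ ≫ k₃.hom
        | some (true, true) => 0
        | some (false, _) => 0
        | none => 0
      | ((true, false), true) => fun
        | some (true, false) => 0
        | some (true, true) => k₂.hom
        | some (false, _) => 0
        | none => 0
      | ((true, true), false) => fun
        | some (true, false) => k₃.hom
        | some (true, true) => 0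
        | some (false, _) => 0
        | none => 0
      | ((true, true), true) => fun
        | some _ => 0
        | none => l.hom
      | ((false, false), false) => fun _ => 0)
    (fun
      | some (false, false) => fun
        | ((false, true), false) => i₂.inv ≫ y₂₁ ≫ τ
        | ((false, false), true) => i₂.inv
        | ((true, _), _) => 0
        | ((false, false), false) => 0
        | ((false, true), true) => 0
      | some (false, true) => fun
        | ((true, false), false) => i₃.inv
        | ((false, _), _) => 0
        | ((true, true), _) => 0
        | ((true, false), true) => 0
      | some (true, true) => fun
        | ((true, false), true) => k₂.inv
        | ((false, _), _) => 0
        | ((true, true), _) => 0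
        | ((true, false), false) => 0
      | some (true, false) => fun
        | ((true, true), false) => k₃.inv
        | ((false, _), _) => 0
        | ((true, false), _) => 0
        | ((true, true), true) => 0
      | none => fun
        | ((true, true), true) => l.inv
        | ((false, _), _) => 0
        | ((true, false), _) => 0
        | ((true, true), false) => 0)
    (fun
      | ((false, true), false) => fun
        | ((false, false), false) => θ
        | ((true, _), _) => 0
        | ((false, true), _) => 0
        | ((false, false), true) => 0
      | ((false, true), true) => fun
        | ((false, true), false) => τ
        | ((true, _), _) => 0
        | ((false, false), _) => 0
        | ((false, true), true) => 0
      | ((true, _), _) => fun _ => 0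
      | ((false, false), _) => fun _ => 0) ?_ ?_ ?_ ?_ ?_ ?_ ?_
  · rintro ⟨⟨_ | _, _ | _⟩, _ | _⟩ (_ | ⟨_ | _, _ | _⟩) h <;>
      first | rfl | exact absurd (by norm_num) h
  · rintro (_ | ⟨_ | _, _ | _⟩) ⟨⟨_ | _, _ | _⟩, _ | _⟩ h <;>
      first | rfl | exact absurd (by norm_num) h
  · rintro ⟨⟨_ | _, _ | _⟩, _ | _⟩ ⟨⟨_ | _, _ | _⟩, _ | _⟩ h <;>
      first | rfl | exact absurd (by norm_num) h
  · rintro ⟨⟨_ | _, _ | _⟩, _ | _⟩ (_ | ⟨_ | _, _ | _⟩) h <;>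
      first | (norm_num at h; done) | clear h
    all_goals simp only [Fintype.sum_prod_type, Fintype.sum_option, Fintype.sum_bool, comp_zero,
        zero_comp, add_zero, zero_add, Category.assoc, c2, c3, c4, c5, c6]
    · rw [hθ', neg_add_cancel]
    · rw [hθ', add_neg_cancel]
    · exact c1
    -- The entry from `Y₁` to `V₁`: `hid` replaces the zigzag through `X` and `W₁`, and `d1` cancels
    -- what comes from `X` against the path through `Y₃`.
    · rw [← c3, ← c1, hid', d1', Preadditive.comp_neg]
      abel
    · rw [← c4, ← c2, d2', Preadditive.comp_neg, add_neg_cancel]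
    · rw [← c6, d3', Preadditive.comp_neg, hτ', neg_neg]
  · rintro (_ | ⟨_ | _, _ | _⟩) ⟨⟨_ | _, _ | _⟩, _ | _⟩ h <;>
      first | (norm_num at h; done) | clear h
    all_goals simp only [Fintype.sum_prod_type, Fintype.sum_option, Fintype.sum_bool, comp_zero,
        zero_comp, add_zero, zero_add, Category.assoc, c1', c2', c3', c4', c5', c6']
    rw [eq_neg_of_add_eq_zero_left hτ, Preadditive.comp_neg, Preadditive.comp_neg,
      Category.comp_id, neg_add_cancel]
  · rintro ⟨⟨_ | _, _ | _⟩, _ | _⟩ ⟨⟨_ | _, _ | _⟩, _ | _⟩ h <;>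
      first | (norm_num at h; done) | clear h
    all_goals
      simp only [Fintype.sum_prod_type, Fintype.sum_option, Fintype.sum_bool, comp_zero, zero_comp,
        add_zero, zero_add, Category.assoc, one, Prod.mk.injEq, reduceCtorEq, and_true, and_false,
        dite_false, dite_true, eqToHom_refl, Iso.hom_inv_id, Iso.hom_inv_id_assoc, Category.comp_id]
    -- Only the diagonal entries at `X`, `Y₁` and `W₁` need a hypothesis. The off-diagonal ones
    -- agree because the corrections in `r` and `h` are `θ` and `τ` composed with differentials.
    · exact hθ.symm
    · exact hid
    · exact hτ.symm
  · rintro (_ | ⟨_ | _, _ | _⟩) (_ | ⟨_ | _, _ | _⟩) h <;>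
      first | (norm_num at h; done) | clear h
    all_goals
      simp only [Fintype.sum_prod_type, Fintype.sum_bool, comp_zero, zero_comp,
        add_zero, zero_add, Category.assoc, one, hτθ', Iso.inv_hom_id, Option.some.injEq,
        Prod.mk.injEq, reduceCtorEq, and_false, dite_true, dite_false, eqToHom_refl]

end

end MatrixData

/-! ### Presentations of products of two-term complexes, and the symmetric five-term complex -/

namespace MatrixData

open GrBimod

section

variable {A : Type v₁} [Ring A] [Algebra ℂ A] {B : Type v₂} [Ring B] [Algebra ℂ B]
  {C : Type v₃} [Ring C] [Algebra ℂ C] {𝒜 : ℤ → Submodule ℂ A} {ℬ : ℤ → Submodule ℂ B}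
  {𝒞 : ℤ → Submodule ℂ C} [GradedAlgebra ℬ]
  {K : CochainComplex (GrBimod.{w} 𝒜 ℬ) ℤ} {L : CochainComplex (GrBimod.{w} ℬ 𝒞) ℤ}
  {n m k : ℤ}

/-- The presentation of the tensor product of two complexes with two terms. -/
def Presents.tensorDouble {M₀ M₁ : GrBimod.{w} 𝒜 ℬ} {N₀ N₁ : GrBimod.{w} ℬ 𝒞}
    {φ : M₀ ⟶ M₁} {ψ : N₀ ⟶ N₁} (M : (double φ n).Presents K) (N : (double ψ m).Presents L)
    {X Y₁ Y₂ W : GrBimod.{w} 𝒜 𝒞} {α : X ⟶ Y₁} {β : X ⟶ Y₂} {γ : Y₁ ⟶ W} {δ : Y₂ ⟶ W}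
    (a : GrBimod.tensor M₀ N₀ ≅ X) (b : GrBimod.tensor M₀ N₁ ≅ Y₁)
    (c : GrBimod.tensor M₁ N₀ ≅ Y₂) (d : GrBimod.tensor M₁ N₁ ≅ W)
    (hα : (n.negOnePow • tensorMap (𝟙 M₀) ψ) ≫ b.hom = a.hom ≫ α)
    (hβ : tensorMap φ (𝟙 N₀) ≫ c.hom = a.hom ≫ β)
    (hγ : tensorMap φ (𝟙 N₁) ≫ d.hom = b.hom ≫ γ)
    (hδ : ((n + 1).negOnePow • tensorMap (𝟙 M₁) ψ) ≫ d.hom = c.hom ≫ δ) :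
    (square α β γ δ n m).Presents (tensorComplex K L) :=
  (M.tensor N).congr (square α β γ δ n m).D_deg
    (fun
      | (false, false) => a
      | (false, true) => b
      | (true, false) => c
      | (true, true) => d)
    (by
      rintro ⟨_ | _, _ | _⟩ ⟨_ | _, _ | _⟩ h <;>
        first | (simp at h; omega) | clear h
      all_goals
        simp only [one, reduceCtorEq, dite_true, dite_false, eqToHom_refl, tensorMap_zero_left,
          tensorMap_zero_right, smul_zero, add_zero, zero_add]
      all_goals
        first
          | exact hα
          | exact hβ
          | exact hγ
          | exact hδ
          | exact zero_comp.trans comp_zero.symm)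

/-- The presentation of the tensor product of a square and a complex with two terms. -/
def Presents.squareTensorDouble {X Y₁ Y₂ W : GrBimod.{w} 𝒜 ℬ} {N₀ N₁ : GrBimod.{w} ℬ 𝒞}
    {α : X ⟶ Y₁} {β : X ⟶ Y₂} {γ : Y₁ ⟶ W} {δ : Y₂ ⟶ W} {ψ : N₀ ⟶ N₁}
    (M : (square α β γ δ n m).Presents K) (N : (double ψ k).Presents L) :
    (cube (tensorMap α (𝟙 N₀)) ((n + m).negOnePow • tensorMap (𝟙 X) ψ) (tensorMap β (𝟙 N₀))
      ((n + (m + 1)).negOnePow • tensorMap (𝟙 Y₁) ψ) (tensorMap γ (𝟙 N₀))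
      (tensorMap α (𝟙 N₁)) (tensorMap β (𝟙 N₁))
      ((n + 1 + m).negOnePow • tensorMap (𝟙 Y₂) ψ) (tensorMap δ (𝟙 N₀))
      (tensorMap γ (𝟙 N₁)) (tensorMap δ (𝟙 N₁))
      ((n + 1 + (m + 1)).negOnePow • tensorMap (𝟙 W) ψ) n m k).Presents (tensorComplex K L) :=
  (M.tensor N).congr (cube _ _ _ _ _ _ _ _ _ _ _ _ n m k).D_deg
    (fun
      | ((false, false), false) => Iso.refl _
      | ((false, true), false) => Iso.refl _
      | ((false, false), true) => Iso.refl _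
      | ((true, false), false) => Iso.refl _
      | ((false, true), true) => Iso.refl _
      | ((true, false), true) => Iso.refl _
      | ((true, true), false) => Iso.refl _
      | ((true, true), true) => Iso.refl _)
    (by
      rintro ⟨⟨_ | _, _ | _⟩, _ | _⟩ ⟨⟨_ | _, _ | _⟩, _ | _⟩ h <;>
        first | (simp at h; omega) | clear h
      all_goals
        simp only [one, reduceCtorEq, dite_true, dite_false, eqToHom_refl, tensorMap_zero_left,
          tensorMap_zero_right, smul_zero, add_zero, zero_add, Iso.refl_hom, Prod.mk.injEq,
          and_true, and_false]
        exact (Category.comp_id _).trans (Category.id_comp _).symm)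

end

section

variable {C : Type*} [Category C] [Preadditive C] {X₁ X₂ V₁ V₂ A : C}
  {s₁₁ : X₁ ⟶ V₁} {s₁₂ : X₁ ⟶ V₂} {s₂₁ : X₂ ⟶ V₁} {s₂₂ : X₂ ⟶ V₂} {t₁ : V₁ ⟶ A} {t₂ : V₂ ⟶ A}
  {K K' : CochainComplex C ℤ}

set_option maxHeartbeats 1000000 in
/-- The symmetry of the data for a complex `X₁ ⊕ X₂ → Y₁ ⊕ Y₂ → Z`. -/
def Presents.pentaHomotopyEquiv (M : (penta s₁₁ s₁₂ s₂₁ s₂₂ t₁ t₂).Presents K)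
    (M' : (penta s₂₂ s₂₁ s₁₂ s₁₁ t₂ t₁).Presents K') : HomotopyEquiv K K' :=
  M.homotopyEquiv M'
    (fun
      | some (false, false) => fun | some (false, true) => 𝟙 _ | _ => 0
      | some (false, true) => fun | some (false, false) => 𝟙 _ | _ => 0
      | some (true, false) => fun | some (true, true) => 𝟙 _ | _ => 0
      | some (true, true) => fun | some (true, false) => 𝟙 _ | _ => 0
      | none => fun | none => 𝟙 _ | _ => 0)
    (fun
      | some (false, false) => fun | some (false, true) => 𝟙 _ | _ => 0
      | some (false, true) => fun | some (false, false) => 𝟙 _ | _ => 0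
      | some (true, false) => fun | some (true, true) => 𝟙 _ | _ => 0
      | some (true, true) => fun | some (true, false) => 𝟙 _ | _ => 0
      | none => fun | none => 𝟙 _ | _ => 0)
    (fun _ _ => 0)
    (by
      rintro (_ | ⟨_ | _, _ | _⟩) (_ | ⟨_ | _, _ | _⟩) h <;>
        first | rfl | exact absurd rfl h)
    (by
      rintro (_ | ⟨_ | _, _ | _⟩) (_ | ⟨_ | _, _ | _⟩) h <;>
        first | rfl | exact absurd rfl h)
    (fun _ _ _ => rfl)
    (by
      rintro (_ | ⟨_ | _, _ | _⟩) (_ | ⟨_ | _, _ | _⟩) h <;> first | (norm_num at h; done) | clear h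
      all_goals simp only [Fintype.sum_option, Fintype.sum_prod_type, Fintype.sum_bool, comp_zero,
          zero_comp, add_zero, zero_add, Category.comp_id, Category.id_comp])
    (by
      rintro (_ | ⟨_ | _, _ | _⟩) (_ | ⟨_ | _, _ | _⟩) h <;> first | (norm_num at h; done) | clear h
      all_goals simp only [Fintype.sum_option, Fintype.sum_prod_type, Fintype.sum_bool, comp_zero,
          zero_comp, add_zero, zero_add, Category.comp_id, Category.id_comp])
    (by
      rintro (_ | ⟨_ | _, _ | _⟩) (_ | ⟨_ | _, _ | _⟩) h <;> first | (norm_num at h; done) | clear h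
      all_goals simp only [Fintype.sum_option, Fintype.sum_prod_type, Fintype.sum_bool, comp_zero,
          zero_comp, add_zero, zero_add, Category.comp_id, one, Option.some.injEq, Prod.mk.injEq,
          reduceCtorEq, and_false, dite_true, dite_false, eqToHom_refl])
    (by
      rintro (_ | ⟨_ | _, _ | _⟩) (_ | ⟨_ | _, _ | _⟩) h <;> first | (norm_num at h; done) | clear h
      all_goals simp only [Fintype.sum_option, Fintype.sum_prod_type, Fintype.sum_bool, comp_zero,
          zero_comp, add_zero, zero_add, Category.comp_id, one, Option.some.injEq, Prod.mk.injEq,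
          reduceCtorEq, and_false, dite_true, dite_false, eqToHom_refl])

/-- Only the two entries from degree -2 to degree 0 are composites of nonzero maps. The identity is
what `tot` requires in order to realise the five terms as a complex. -/
lemma penta_sq (h₁ : s₁₁ ≫ t₁ + s₁₂ ≫ t₂ = 0) (h₂ : s₂₁ ≫ t₁ + s₂₂ ≫ t₂ = 0) (j l) :
    ∑ k, (penta s₁₁ s₁₂ s₂₁ s₂₂ t₁ t₂).D j k ≫ (penta s₁₁ s₁₂ s₂₁ s₂₂ t₁ t₂).D k l = 0 := by
  obtain (_ | ⟨_ | _, _ | _⟩) := j <;> obtain (_ | ⟨_ | _, _ | _⟩) := l <;>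
    simp only [Fintype.sum_option, Fintype.sum_prod_type, Fintype.sum_bool, comp_zero,
      zero_comp, add_zero, zero_add]
  · rw [add_comm, h₁]
  · rw [add_comm, h₂]

end

end MatrixData

open GrBimod

/-- Transport of the presentation of a complex with two terms along isomorphisms. -/
def MatrixData.Presents.doubleCongr {C : Type*} [Category C] [Preadditive C]
    {X₀ X₁ X₀' X₁' : C} {φ : X₀ ⟶ X₁} {φ' : X₀' ⟶ X₁'} {n : ℤ} {K : CochainComplex C ℤ}
    (M : (MatrixData.double φ n).Presents K) (a : X₀ ≅ X₀') (b : X₁ ≅ X₁')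
    (h : φ ≫ b.hom = a.hom ≫ φ') : (MatrixData.double φ' n).Presents K :=
  M.congr (MatrixData.double φ' n).D_deg
    (fun
      | false => a
      | true => b)
    (by
      rintro (_ | _) (_ | _) -
      · exact zero_comp.trans comp_zero.symm
      · exact h
      · exact zero_comp.trans comp_zero.symm
      · exact zero_comp.trans comp_zero.symm)

/-! ### Evaluation of homomorphisms on generators -/

namespace GrBimod

section

variable {A : Type v₁} [Ring A] [Algebra ℂ A] {B : Type v₂} [Ring B] [Algebra ℂ B]
  {𝒜 : ℤ → Submodule ℂ A} {ℬ : ℤ → Submodule ℂ B} {M N K : GrBimod.{w} 𝒜 ℬ}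

/-- The value of a homomorphism at an element. -/
def ev (f : M ⟶ N) (x : M.carrier) : N.carrier := toLin f x

@[simp] lemma ev_comp (f : M ⟶ N) (g : N ⟶ K) (x : M.carrier) :
    ev (f ≫ g) x = ev g (ev f x) := rfl
@[simp] lemma ev_id (x : M.carrier) : ev (𝟙 M) x = x := rfl
@[simp] lemma ev_add (f g : M ⟶ N) (x : M.carrier) : ev (f + g) x = ev f x + ev g x := rfl
@[simp] lemma ev_neg (f : M ⟶ N) (x : M.carrier) : ev (-f) x = -ev f x := rfl
@[simp] lemma ev_zero (x : M.carrier) : ev (0 : M ⟶ N) x = 0 := rfl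
lemma ev_map_zero (f : M ⟶ N) : ev f 0 = 0 := map_zero _
lemma ev_map_add (f : M ⟶ N) (x y : M.carrier) : ev f (x + y) = ev f x + ev f y := map_add _ x y

end

end GrBimod

section Twists

variable {V : Type u} [Fintype V] {Γ : SimpleGraph V} {i j k l : V} {p q r : ℤ}

section

variable {M N : GrBimod.{u} (gr Γ) (gr Γ)}

@[simp] lemma ev_free (m : M.carrier) (hm : m ∈ M.gr p) (a b : Alg Γ) :
    ev (free i j p m hm) (bs Γ i j p a b) =
      lsm (M := M) (a * e i) (rsm (M := M) (e j * b) m) := free_bs m hm a b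

@[simp] lemma ev_contr (φ : Alg Γ →ₗ[ℂ] ℂ) {d : ℤ}
    (hφ : ∀ {n : ℤ}, n ≠ d → ∀ {a : Alg Γ}, a ∈ algGr n → φ a = 0) (hr : p + q + d = r)
    (a b c : Alg Γ) : ev (contr φ hφ i j p k l q r hr) (tb Γ i j p k l q a b c) =
      φ (e j * b * e k) • bs Γ i l r a c := contr_tb φ hφ hr a b c

@[simp] lemma ev_runit_tr (a b : Alg Γ) :
    ev (runit (Bs Γ i j p)).hom (tr Γ i j p a b) = bs Γ i j p a b := runit_tr a b
@[simp] lemma ev_lunit_tl (a b : Alg Γ) :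
    ev (lunit (Bs Γ i j p)).hom (tl Γ i j p a b) = bs Γ i j p a b := lunit_tl a b
@[simp] lemma ev_runit_tu (a : Alg Γ) : ev (runit (regular (gr Γ))).hom (tu Γ a) = a :=
  runit_tu a
@[simp] lemma ev_runit_inv_bs (a b : Alg Γ) :
    ev (runit (Bs Γ i j p)).inv (bs Γ i j p a b) = tr Γ i j p a b := rfl
@[simp] lemma ev_lunit_inv_bs (a b : Alg Γ) :
    ev (lunit (Bs Γ i j p)).inv (bs Γ i j p a b) = tl Γ i j p a b := rfl
@[simp] lemma ev_runit_inv_reg (a : Alg Γ) :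
    ev (runit (regular (gr Γ))).inv a = tu Γ a := rfl

@[simp] lemma ev_tensorMap_tb (f : Bs Γ i j p ⟶ M) (g : Bs Γ k l q ⟶ N) (a c d : Alg Γ) :
    ev (tensorMap f g) (tb Γ i j p k l q a c d) =
      tmul (M := M) (N := N) (ev f (bs Γ i j p a 1)) (ev g (bs Γ k l q c d)) := rfl
@[simp] lemma ev_tensorMap_tr (f : Bs Γ i j p ⟶ M) (g : regular (gr Γ) ⟶ N) (a b : Alg Γ) :
    ev (tensorMap f g) (tr Γ i j p a b) =
      tmul (M := M) (N := N) (ev f (bs Γ i j p a b)) (ev g (1 : Alg Γ)) := rfl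
@[simp] lemma ev_tensorMap_tl (f : regular (gr Γ) ⟶ M) (g : Bs Γ i j p ⟶ N) (a b : Alg Γ) :
    ev (tensorMap f g) (tl Γ i j p a b) =
      tmul (M := M) (N := N) (ev f (1 : Alg Γ)) (ev g (bs Γ i j p a b)) := rfl
@[simp] lemma ev_tensorMap_tu (f : regular (gr Γ) ⟶ M) (g : regular (gr Γ) ⟶ N) (a : Alg Γ) :
    ev (tensorMap f g) (tu Γ a) =
      tmul (M := M) (N := N) (ev f a) (ev g (1 : Alg Γ)) := rfl

end

/-! ### The complexes Σ_i and Σ_i⁻¹ in terms of generators, and the Casimir element -/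

variable (Γ)

/-- The homomorphism `P_i ⊗ Q_i → A`, `p ⊗ q ↦ p q`. -/
def fb (i : V) : Bs Γ i i 0 ⟶ regular (gr Γ) :=
  free (M := regular (gr Γ)) i i 0 (1 : Alg Γ) one_mem_gr

variable {Γ}

@[simp] lemma ev_fb (a b : Alg Γ) : ev (fb Γ i) (bs Γ i i 0 a b) = (a * e i * b : Alg Γ) := by
  refine (ev_free (M := regular (gr Γ)) (1 : Alg Γ) one_mem_gr a b).trans ?_
  rw [rsm_regular, lsm_regular, one_mul, ← mul_assoc, mul_assoc a, e_mul_self]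

variable (Γ)

/-- The identification of `P_i ⊗ Q_i` with its trivial shift. -/
def shiftZeroIso (i : V) : U Γ i ≅ Bs Γ i i 0 where
  hom := mkHom LinearMap.id (fun _ _ => rfl) (fun _ _ => rfl)
    (fun n m hm => by
      change m ∈ (U Γ i).gr (n - 0)
      rw [sub_zero]
      exact hm)
  inv := mkHom LinearMap.id (fun _ _ => rfl) (fun _ _ => rfl)
    (fun n m hm => by
      change m ∈ (U Γ i).gr (n - 0) at hm
      rw [sub_zero] at hm
      exact hm)
  hom_inv_id := rfl
  inv_hom_id := rfl

lemma shiftZeroIso_inv_bs (i : V) (a b : Alg Γ) :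
    ev (shiftZeroIso Γ i).inv (bs Γ i i 0 a b) = pq Γ i a b := rfl

lemma ev_f_pq (i : V) (a b : Alg Γ) : ev (f Γ i) (pq Γ i a b) = (a * e i * (e i * b) : Alg Γ) :=
  f_tmul Γ i _ _

/-- Σ_i is defined with the unshifted bimodule, while the calculus with generators uses the uniform
family `Bs`; this matches the differentials. -/
lemma shiftZeroIso_inv_f (i : V) : (shiftZeroIso Γ i).inv ≫ f Γ i = fb Γ i := by
  refine bs_hom_ext (M := regular (gr Γ)) ?_
  refine Eq.trans ?_ (ev_fb (1 : Alg Γ) 1).symm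
  refine (congrArg (ev (f Γ i)) (shiftZeroIso_inv_bs Γ i 1 1)).trans ?_
  rw [ev_f_pq, one_mul, mul_one, e_mul_self]

/-- The presentation of `Σ_i`. -/
def twistPresents (i : V) : (MatrixData.double (fb Γ i) (-1)).Presents (twist Γ i) :=
  (MatrixData.doublePresents (f Γ i) (by norm_num) _).doubleCongr (shiftZeroIso Γ i)
    (Iso.refl _)
    ((Category.comp_id _).trans ((Iso.inv_comp_eq _).1 (shiftZeroIso_inv_f Γ i)))

/-- The homomorphism `A → P_i ⊗ Q_i⟨-2⟩`. -/
def gb (i : V) : regular (gr Γ) ⟶ Bs Γ i i (-2) := g Γ i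

/-- The presentation of `Σ_i⁻¹`. -/
def twistInvPresents (i : V) : (MatrixData.double (gb Γ i) 0).Presents (twistInv Γ i) :=
  MatrixData.doublePresents (g Γ i) (by norm_num) _

/-- The element `x_i ⊗ e_i + ∑_{j — i} (j|i) ⊗ (i|j) + e_i ⊗ x_i`. -/
def cas (i : V) (p : ℤ) : (Bs Γ i i p).carrier := casimir Γ i

open Classical in
lemma cas_eq (i : V) (p : ℤ) : cas Γ i p = bs Γ i i p (loop i) 1 +
    (∑ j : V, if h : Γ.Adj j i then bs Γ i i p (arr h) (arr h.symm) else 0) +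
    bs Γ i i p 1 (loop i) := by
  rw [← bs_e_right, ← bs_e_left (loop i)]
  exact casimir_eq i

variable {Γ}

@[simp] lemma ev_gb (a : Alg Γ) :
    ev (gb Γ i) a = lsm (M := Bs Γ i i (-2)) a (cas Γ i (-2)) := rfl

lemma lsm_add {M : GrBimod.{u} (gr Γ) (gr Γ)} (a : Alg Γ) (x y : M.carrier) :
    lsm a (x + y) = lsm a x + lsm a y := map_add _ x y
lemma lsm_zero {M : GrBimod.{u} (gr Γ) (gr Γ)} (a : Alg Γ) :
    lsm (M := M) a 0 = 0 := map_zero _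
lemma lsm_sum {M : GrBimod.{u} (gr Γ) (gr Γ)} (a : Alg Γ) (x : V → M.carrier) :
    lsm a (∑ j, x j) = ∑ j, lsm a (x j) := map_sum (M.lact a) x _
@[simp] lemma one_lsm {M : GrBimod.{u} (gr Γ) (gr Γ)} (x : M.carrier) :
    lsm (1 : Alg Γ) x = x := by
  rw [lsm, map_one, Module.End.one_apply]

/-- The arrow terms begin at vertices j adjacent to i, hence different from i, and e_i kills them.
-/
lemma e_lsm_cas : lsm (M := Bs Γ i i p) (e i) (cas Γ i p) =
    bs Γ i i p (loop i) 1 + bs Γ i i p 1 (loop i) := by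
  classical
  rw [cas_eq, lsm_add, lsm_add, lsm_bs, lsm_bs, e_mul_loop, mul_one, bs_e_left, lsm_sum,
    Finset.sum_eq_zero, add_zero]
  intro j _
  split_ifs with h
  · rw [lsm_bs, e_mul_arr_of_ne h h.ne', bs_zero_left]
  · exact lsm_zero _

lemma tmul_sum {M N : GrBimod.{u} (gr Γ) (gr Γ)} (m : M.carrier) (x : V → N.carrier) :
    tmul m (∑ j, x j) = ∑ j, tmul m (x j) := map_sum (tmulBilin M N m) x _

lemma sum_tmul {M N : GrBimod.{u} (gr Γ) (gr Γ)} (x : V → M.carrier) (n : N.carrier) :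
    tmul (∑ j, x j) n = ∑ j, tmul (x j) n := map_sum ((tmulBilin M N).flip n) x _

/-- The left factor ends in e_i, which annihilates the arrows (j|i). Of the Casimir element only the
two terms with x_i remain, one with x_i in the middle and one with x_i on the outside. -/
lemma tmul_bs_cas (a : Alg Γ) :
    tmul (M := Bs Γ k i p) (N := Bs Γ i i q) (bs Γ k i p a 1) (cas Γ i q) =
      tb Γ k i p i i q a (loop i) 1 + tb Γ k i p i i q a 1 (loop i) := by
  classical
  rw [cas_eq, GrBimod.tmul_add, GrBimod.tmul_add, tmul_bs_bs, tmul_bs_bs, one_mul, one_mul,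
    tmul_sum, Finset.sum_eq_zero, add_zero]
  intro j _
  split_ifs with h
  · rw [tmul_bs_bs, one_mul, ← tb_e_mul_mid, e_mul_arr_of_ne h h.ne', tb_zero_mid]
  · exact GrBimod.tmul_zero _

/-- The mirror image: the arrows (i|j) end at j ≠ i and are killed by the e_i that begins the right
factor. -/
lemma tmul_cas_bs (b : Alg Γ) :
    tmul (M := Bs Γ i i p) (N := Bs Γ i k q) (cas Γ i p) (bs Γ i k q 1 b) =
      tb Γ i i p i k q (loop i) 1 b + tb Γ i i p i k q 1 (loop i) b := by
  classical
  rw [cas_eq, GrBimod.add_tmul, GrBimod.add_tmul, tmul_bs_bs, tmul_bs_bs, one_mul, mul_one,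
    sum_tmul, Finset.sum_eq_zero, add_zero]
  intro j _
  split_ifs with h
  · rw [tmul_bs_bs, mul_one, ← tb_mul_e_mid, arr_mul_e_of_ne h.symm h.ne, tb_zero_mid]
  · exact GrBimod.zero_tmul _

end Twists

open GrBimod

/-! ### Invertibility of Σ_i -/

section Twists

variable {V : Type u} [Fintype V] (Γ : SimpleGraph V)

lemma one_tb_mem (i j : V) (p : ℤ) (k l : V) (q : ℤ) {d : ℤ} (h : p + q = d) :
    tb Γ i j p k l q 1 1 1 ∈ (tensor (Bs Γ i j p) (Bs Γ k l q)).gr d :=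
  tb_mem one_mem_gr one_mem_gr one_mem_gr (by omega)

/-- The homomorphism `P_i ⊗ Q_l → (P_i ⊗ Q_j) ⊗ (P_j ⊗ Q_l)` sending `e_i ⊗ e_l` to
`(e_i ⊗ e_j) ⊗ (e_j ⊗ e_l)`. -/
def ins (i j : V) (p : ℤ) (l : V) (q d : ℤ) (h : p + q = d) :
    Bs Γ i l d ⟶ tensor (Bs Γ i j p) (Bs Γ j l q) :=
  free (M := tensor (Bs Γ i j p) (Bs Γ j l q)) i l d (tb Γ i j p j l q 1 1 1)
    (one_tb_mem Γ i j p j l q h)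

variable {Γ}

@[simp] lemma ev_ins (i j : V) (p : ℤ) (l : V) (q d : ℤ) (h : p + q = d) (a b : Alg Γ) :
    ev (ins Γ i j p l q d h) (bs Γ i l d a b) = tb Γ i j p j l q a 1 b := by
  refine (ev_free (M := tensor (Bs Γ i j p) (Bs Γ j l q)) _ _ a b).trans ?_
  rw [rsm_tb, lsm_tb, mul_one, one_mul, tb_mul_e_left, tb_e_mul_right]

/-- The contraction along the coefficient of `x_j`. -/
def contrX (i j : V) (p : ℤ) (l : V) (q r : ℤ) (hr : p + q + 2 = r) :
    tensor (Bs Γ i j p) (Bs Γ j l q) ⟶ Bs Γ i l r :=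
  contr (coeffX j) (coeffX_eq_zero j) i j p j l q r hr

@[simp] lemma ev_contrX_loop (i j : V) (p : ℤ) (l : V) (q r : ℤ) (hr : p + q + 2 = r)
    (a b : Alg Γ) :
    ev (contrX i j p l q r hr) (tb Γ i j p j l q a (loop j) b) = bs Γ i l r a b := by
  rw [contrX, ev_contr, e_mul_loop, loop_mul_e, coeffX_loop, one_smul]

@[simp] lemma ev_contrX_one (i j : V) (p : ℤ) (l : V) (q r : ℤ) (hr : p + q + 2 = r)
    (a b : Alg Γ) :
    ev (contrX i j p l q r hr) (tb Γ i j p j l q a 1 b) = 0 := by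
  rw [contrX, ev_contr, mul_one, e_mul_self, coeffX_e, zero_smul]

@[simp] lemma ev_Bs_zero {i j : V} {p : ℤ} {M : GrBimod.{u} (gr Γ) (gr Γ)}
    (φ : Bs Γ i j p ⟶ M) : ev φ 0 = 0 := ev_map_zero φ

@[simp] lemma ev_regular_zero {M : GrBimod.{u} (gr Γ) (gr Γ)}
    (φ : regular (gr Γ) ⟶ M) : ev φ (0 : Alg Γ) = 0 := ev_map_zero φ

/-- The Casimir element is dual to the functional `coeffX`: its term with the loop in the middle
contracts to the generator, the other surviving term to zero. Hence 1 ⊗ g is a split monomorphism.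
-/
lemma contrX_tmul_cas (i j : V) (p q r : ℤ) (hr : p + q + 2 = r) (a : Alg Γ) :
    ev (contrX i j p j q r hr)
      (tmul (M := Bs Γ i j p) (N := Bs Γ j j q) (bs Γ i j p a 1) (cas Γ j q)) =
        bs Γ i j r a 1 := by
  rw [tmul_bs_cas, ev_map_add, ev_contrX_loop, ev_contrX_one, add_zero]

lemma contrX_cas_tmul (i j : V) (p q r : ℤ) (hr : p + q + 2 = r) (b : Alg Γ) :
    ev (contrX i i p j q r hr)
      (tmul (M := Bs Γ i i p) (N := Bs Γ i j q) (cas Γ i p) (bs Γ i j q 1 b)) =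
        bs Γ i j r 1 b := by
  rw [tmul_cas_bs, ev_map_add, ev_contrX_loop, ev_contrX_one, zero_add]

/-- Insertion puts the idempotent e_j in the middle, and its coefficient of x_j is zero. The two
splittings of the double product are thus orthogonal in this order. -/
lemma ins_contrX (i j : V) (p : ℤ) (l : V) (q d : ℤ) (h : p + q = d) (r : ℤ)
    (hr : p + q + 2 = r) : ins Γ i j p l q d h ≫ contrX i j p l q r hr = 0 := by
  refine bs_hom_ext ?_
  change ev _ _ = ev _ _
  rw [ev_comp, ev_ins, ev_contrX_one, ev_zero]

/-- The inserted e_i ⊗ e_i multiplies to e_i, so insertion is a section of multiplication up to the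
unit isomorphism. -/
lemma ins_fb_left (i l : V) (q : ℤ) (h : 0 + q = q) :
    ins Γ i i 0 l q q h ≫ tensorMap (fb Γ i) (𝟙 (Bs Γ i l q)) = (lunit (Bs Γ i l q)).inv := by
  refine bs_hom_ext (M := tensor (regular (gr Γ)) (Bs Γ i l q)) ?_
  change ev _ _ = ev _ _
  simp

lemma ins_fb_right (i l : V) (p : ℤ) (h : p + 0 = p) :
    ins Γ i l p l 0 p h ≫ tensorMap (𝟙 (Bs Γ i l p)) (fb Γ l) = (runit (Bs Γ i l p)).inv := by
  refine bs_hom_ext (M := tensor (Bs Γ i l p) (regular (gr Γ))) ?_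
  change ev _ _ = ev _ _
  simp

/-- Naturality of the unit isomorphisms at g. On A ⊗_A A the left and right ones coincide, so
`runit` is used for both. -/
lemma gb_lunit_inv (i : V) : gb Γ i ≫ (lunit (Bs Γ i i (-2))).inv =
    (runit (regular (gr Γ))).inv ≫ tensorMap (𝟙 (regular (gr Γ))) (gb Γ i) := by
  refine regular_hom_ext (M := tensor (regular (gr Γ)) (Bs Γ i i (-2))) ?_
  change ev _ _ = ev _ _
  rw [ev_comp, ev_comp, ev_runit_inv_reg, ev_tensorMap_tu, ev_id, ev_gb, one_lsm]
  exact lunit_inv_apply _ _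

lemma gb_runit_inv (i : V) : gb Γ i ≫ (runit (Bs Γ i i (-2))).inv =
    (runit (regular (gr Γ))).inv ≫ tensorMap (gb Γ i) (𝟙 (regular (gr Γ))) := by
  refine regular_hom_ext (M := tensor (Bs Γ i i (-2)) (regular (gr Γ))) ?_
  change ev _ _ = ev _ _
  rw [ev_comp, ev_comp, ev_runit_inv_reg, ev_tensorMap_tu, ev_id, ev_gb, one_lsm]
  exact runit_inv_apply _ _

lemma tensorMap_gb_lunit (i : V) :
    tensorMap (𝟙 (regular (gr Γ))) (gb Γ i) ≫ (lunit (Bs Γ i i (-2))).hom =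
      (runit (regular (gr Γ))).hom ≫ gb Γ i := by
  rw [← Iso.eq_comp_inv, Category.assoc, gb_lunit_inv, Iso.hom_inv_id_assoc]

lemma tensorMap_gb_runit (i : V) :
    tensorMap (gb Γ i) (𝟙 (regular (gr Γ))) ≫ (runit (Bs Γ i i (-2))).hom =
      (runit (regular (gr Γ))).hom ≫ gb Γ i := by
  rw [← Iso.eq_comp_inv, Category.assoc, gb_runit_inv, Iso.hom_inv_id_assoc]

lemma runit_fb (i : V) : (runit (Bs Γ i i 0)).inv ≫ tensorMap (fb Γ i) (𝟙 (regular (gr Γ))) =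
    fb Γ i ≫ (runit (regular (gr Γ))).inv := by
  refine bs_hom_ext (M := tensor (regular (gr Γ)) (regular (gr Γ))) ?_
  change ev _ _ = ev _ _
  simp

lemma lunit_fb (i : V) : (lunit (Bs Γ i i 0)).inv ≫ tensorMap (𝟙 (regular (gr Γ))) (fb Γ i) =
    fb Γ i ≫ (runit (regular (gr Γ))).inv := by
  refine bs_hom_ext (M := tensor (regular (gr Γ)) (regular (gr Γ))) ?_
  change ev _ _ = ev _ _
  rw [ev_comp, ev_comp, ev_lunit_inv_bs, ev_tensorMap_tl, ev_fb, ev_runit_inv_reg]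
  refine (tmul_reg_reg _ _).trans ?_
  rw [one_mul, mul_one]
  exact congrArg (tu Γ) (one_mul _)

lemma contrX_fb (i : V) (p q : ℤ) (hr : p + q + 2 = 0) :
    contrX i i p i q 0 hr ≫ fb Γ i ≫ (runit (regular (gr Γ))).inv =
      contrX i i p i q 0 hr ≫ (runit (Bs Γ i i 0)).inv ≫
        tensorMap (fb Γ i) (𝟙 (regular (gr Γ))) := by
  rw [runit_fb]

lemma contrX_fb' (i : V) (p q : ℤ) (hr : p + q + 2 = 0) :
    contrX i i p i q 0 hr ≫ fb Γ i ≫ (runit (regular (gr Γ))).inv =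
      contrX i i p i q 0 hr ≫ (lunit (Bs Γ i i 0)).inv ≫
        tensorMap (𝟙 (regular (gr Γ))) (fb Γ i) := by
  rw [lunit_fb]

variable (Γ)

/-- The homotopy equivalence between `Σ_i ⊗ Σ_i⁻¹` and `A`. -/
theorem twist_twistInv (i : V) :
    Nonempty (HomotopyEquiv (tensorComplex (twist Γ i) (twistInv Γ i)) (unitComplex Γ)) := by
  -- The minus sign is the Koszul sign of P_i ⊗ Q_i in degree -1; on the last edge the left factor A
  -- has degree 0 and there is no sign.
  have M : (MatrixData.square (-tensorMap (𝟙 (Bs Γ i i 0)) (gb Γ i))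
      (tensorMap (fb Γ i) (𝟙 (regular (gr Γ)))) (tensorMap (fb Γ i) (𝟙 (Bs Γ i i (-2))))
      (tensorMap (𝟙 (regular (gr Γ))) (gb Γ i)) (-1) 0).Presents
      (tensorComplex (twist Γ i) (twistInv Γ i)) :=
    (twistPresents Γ i).tensorDouble (twistInvPresents Γ i) (Iso.refl _) (Iso.refl _)
      (Iso.refl _) (Iso.refl _)
      ((Category.comp_id _).trans (Eq.trans (by simp) (Category.id_comp _).symm))
      ((Category.comp_id _).trans (Category.id_comp _).symm)
      ((Category.comp_id _).trans (Category.id_comp _).symm)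
      ((Category.comp_id _).trans (Eq.trans (by simp) (Category.id_comp _).symm))
  have M' : (MatrixData.single (regular (gr Γ)) 0).Presents (unitComplex Γ) :=
    MatrixData.singlePresents _
  -- The term to be eliminated is `Y₁`, the double product, and A ⊗ A in position `Y₂` survives. The
  -- homotopy inverts 1 ⊗ g by contraction and f ⊗ 1 by insertion. The components of `r` and `h` at
  -- `Y₁` are the resulting corrections, and at `Y₂` they are the unit isomorphism.
  refine ⟨M.squareHomotopyEquiv M' (by norm_num) (contrX i i 0 i (-2) 0 rfl ≫ fb Γ i)
    (runit (regular (gr Γ))).hom (-(gb Γ i ≫ ins Γ i i 0 i (-2) (-2) rfl))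
    (runit (regular (gr Γ))).inv
    (contrX i i 0 i (-2) 0 rfl ≫ (runit (Bs Γ i i 0)).inv) 0
    (-((lunit (Bs Γ i i (-2))).hom ≫ ins Γ i i 0 i (-2) (-2) rfl))
    0 ?_ ?_ ?_ ?_ ?_ ?_ ?_ ?_ ?_⟩
  · refine tr_hom_ext (M := regular (gr Γ)) ?_
    change ev _ _ = ev _ _
    simp [contrX_tmul_cas]
  · rw [Preadditive.neg_comp, Category.assoc, ins_fb_left, gb_lunit_inv, neg_add_cancel]
  · refine tr_hom_ext (M := tensor (Bs Γ i i 0) (regular (gr Γ))) ?_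
    change ev _ _ = ev _ _
    simp [contrX_tmul_cas]
  · rw [Preadditive.neg_comp, Category.assoc, ins_fb_left, Iso.hom_inv_id, zero_comp, add_zero,
      neg_add_cancel]
  -- The identity on the double product. With e_i in the middle, insertion after multiplication
  -- already gives the element back; with x_i in the middle, the two terms of e_i times the Casimir
  -- element account for the difference.
  · refine tb_hom_ext_self (M := tensor (Bs Γ i i 0) (Bs Γ i i (-2))) ?_ ?_
    · change ev _ _ = ev _ _
      simp
      exact ev_map_zero _
    · change ev _ _ = ev _ _
      simp only [ev_comp, ev_neg, ev_add, ev_contrX_loop, ev_fb, one_mul, mul_one, ev_gb,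
        e_lsm_cas, ev_tensorMap_tb, ev_id, tmul_reg_bs, ev_lunit_tl, ev_runit_inv_bs,
        ev_tensorMap_tr, tmul_bs_cas, one_lsm]
      rw [ev_map_add, ev_ins, ev_ins, ev_ins, e_mul_loop]
      abel
  · rw [comp_zero, Category.assoc, Category.assoc, contrX_fb]
    exact (zero_add _).symm
  · rw [zero_comp, add_zero, Preadditive.comp_neg, Preadditive.comp_neg, ← Category.assoc,
      ← Category.assoc, tensorMap_gb_lunit]
  · rw [zero_comp, comp_zero, zero_add, zero_add, Iso.hom_inv_id]
  · rw [Preadditive.neg_comp, Category.assoc, ← Category.assoc (ins Γ i i 0 i (-2) (-2) rfl),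
      ins_contrX, zero_comp, comp_zero, neg_zero, zero_add, Iso.inv_hom_id]

/-- The homotopy equivalence between `Σ_i⁻¹ ⊗ Σ_i` and `A`. -/
theorem twistInv_twist (i : V) :
    Nonempty (HomotopyEquiv (tensorComplex (twistInv Γ i) (twist Γ i)) (unitComplex Γ)) := by
  have M : (MatrixData.square (tensorMap (𝟙 (regular (gr Γ))) (fb Γ i))
      (tensorMap (gb Γ i) (𝟙 (Bs Γ i i 0))) (tensorMap (gb Γ i) (𝟙 (regular (gr Γ))))
      (-tensorMap (𝟙 (Bs Γ i i (-2))) (fb Γ i)) 0 (-1)).Presents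
      (tensorComplex (twistInv Γ i) (twist Γ i)) :=
    (twistInvPresents Γ i).tensorDouble (twistPresents Γ i) (Iso.refl _) (Iso.refl _)
      (Iso.refl _) (Iso.refl _)
      ((Category.comp_id _).trans (Eq.trans (by simp) (Category.id_comp _).symm))
      ((Category.comp_id _).trans (Category.id_comp _).symm)
      ((Category.comp_id _).trans (Category.id_comp _).symm)
      ((Category.comp_id _).trans (Eq.trans (by simp) (Category.id_comp _).symm))
  have M' : (MatrixData.single (regular (gr Γ)) 0).Presents (unitComplex Γ) :=
    MatrixData.singlePresents _
  -- The mirror image: now A ⊗ A is `Y₁` and survives, while the double product is `Y₂`. It is split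
  -- by contraction on the side of g ⊗ 1 and by insertion on the side of 1 ⊗ f. The signs move
  -- because the left factor of the double product has degree 1.
  refine ⟨M.squareHomotopyEquiv M' (by norm_num) (runit (regular (gr Γ))).hom
    (-(contrX i i (-2) i 0 0 rfl ≫ fb Γ i)) (runit (regular (gr Γ))).inv
    (gb Γ i ≫ ins Γ i i (-2) i 0 (-2) rfl)
    0 (-(contrX i i (-2) i 0 0 rfl ≫ (lunit (Bs Γ i i 0)).inv)) 0
    ((runit (Bs Γ i i (-2))).hom ≫ ins Γ i i (-2) i 0 (-2) rfl)
    ?_ ?_ ?_ ?_ ?_ ?_ ?_ ?_ ?_⟩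
  · refine tl_hom_ext (M := regular (gr Γ)) ?_
    change ev _ _ = ev _ _
    simp [contrX_cas_tmul]
  · rw [Preadditive.comp_neg, Category.assoc, ins_fb_right, gb_runit_inv, add_neg_cancel]
  · refine tl_hom_ext (M := tensor (regular (gr Γ)) (Bs Γ i i 0)) ?_
    change ev _ _ = ev _ _
    simp [contrX_cas_tmul]
  · rw [Preadditive.comp_neg, Category.assoc, ins_fb_right, Iso.hom_inv_id, zero_comp, zero_add,
      neg_add_cancel]
  · rw [zero_comp, comp_zero, zero_add, zero_add, Iso.hom_inv_id]
  · rw [zero_comp, ← Category.assoc, ← Category.assoc (tensorMap _ _), tensorMap_gb_runit]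
    exact (add_zero _).symm
  · rw [comp_zero, zero_add, Preadditive.neg_comp, Preadditive.neg_comp, Category.assoc,
      Category.assoc, contrX_fb']
  · rw [Preadditive.neg_comp, Preadditive.neg_comp, Preadditive.neg_comp]
    refine tb_hom_ext_self (M := tensor (Bs Γ i i (-2)) (Bs Γ i i 0)) ?_ ?_
    · change ev _ _ = ev _ _
      simp
      exact ev_map_zero _
    · change ev _ _ = ev _ _
      simp only [ev_comp, ev_neg, ev_add, ev_contrX_loop, ev_fb, one_mul, mul_one, ev_gb,
        e_lsm_cas, ev_tensorMap_tb, ev_id, tmul_bs_reg, ev_runit_tr, ev_lunit_inv_bs,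
        ev_tensorMap_tl, tmul_cas_bs, one_lsm]
      rw [ev_map_add, ev_ins, ev_ins, ev_ins, loop_mul_e]
      abel
  · rw [Preadditive.comp_neg, Category.assoc, ← Category.assoc (ins Γ i i (-2) i 0 (-2) rfl),
      ins_contrX, zero_comp, comp_zero, neg_zero, add_zero, Iso.inv_hom_id]

end Twists

open GrBimod

/-! ### Commutation for non-adjacent vertices -/

section

variable {C : Type*} [Category C] [Preadditive C] {X Y₁ Y₂ W X' Y₁' Y₂' W' : C}
  {α : X ⟶ Y₁} {β : X ⟶ Y₂} {γ : Y₁ ⟶ W} {δ : Y₂ ⟶ W}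
  {α' : X' ⟶ Y₁'} {β' : X' ⟶ Y₂'} {γ' : Y₁' ⟶ W'} {δ' : Y₂' ⟶ W'}
  {K K' : CochainComplex C ℤ}

/-- An isomorphism of square complexes interchanging the two middle terms. -/
def MatrixData.Presents.squareSwap
    (M : (square α β γ δ (-1) (-1)).Presents K) (M' : (square α' β' γ' δ' (-1) (-1)).Presents K')
    (x : X ≅ X') (a : Y₁ ≅ Y₂') (b : Y₂ ≅ Y₁') (w : W ≅ W')
    (h1 : α ≫ a.hom = x.hom ≫ β') (h2 : β ≫ b.hom = x.hom ≫ α')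
    (h3 : γ ≫ w.hom = a.hom ≫ δ') (h4 : δ ≫ w.hom = b.hom ≫ γ') : HomotopyEquiv K K' := by
  have h1' : x.inv ≫ α = β' ≫ a.inv := by
    rw [Iso.inv_comp_eq, ← Category.assoc, Iso.eq_comp_inv, h1]
  have h2' : x.inv ≫ β = α' ≫ b.inv := by
    rw [Iso.inv_comp_eq, ← Category.assoc, Iso.eq_comp_inv, h2]
  have h3' : a.inv ≫ γ = δ' ≫ w.inv := by
    rw [Iso.inv_comp_eq, ← Category.assoc, Iso.eq_comp_inv, h3]
  have h4' : b.inv ≫ δ = γ' ≫ w.inv := by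
    rw [Iso.inv_comp_eq, ← Category.assoc, Iso.eq_comp_inv, h4]
  exact M.homotopyEquiv M'
    (fun
      | (false, false) => fun | (false, false) => x.hom | _ => 0
      | (false, true) => fun | (true, false) => a.hom | _ => 0
      | (true, false) => fun | (false, true) => b.hom | _ => 0
      | (true, true) => fun | (true, true) => w.hom | _ => 0)
    (fun
      | (false, false) => fun | (false, false) => x.inv | _ => 0
      | (false, true) => fun | (true, false) => b.inv | _ => 0
      | (true, false) => fun | (false, true) => a.inv | _ => 0
      | (true, true) => fun | (true, true) => w.inv | _ => 0)
    (fun _ _ => 0)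
    (by
      rintro ⟨_ | _, _ | _⟩ ⟨_ | _, _ | _⟩ h <;>
        first | rfl | exact absurd rfl h)
    (by
      rintro ⟨_ | _, _ | _⟩ ⟨_ | _, _ | _⟩ h <;>
        first | rfl | exact absurd rfl h)
    (fun _ _ _ => rfl)
    (by
      rintro ⟨_ | _, _ | _⟩ ⟨_ | _, _ | _⟩ h <;> first | (norm_num at h; done) | clear h
      all_goals simp only [Fintype.sum_prod_type, Fintype.sum_bool, comp_zero,
          zero_comp, add_zero, zero_add, h1, h2, h3, h4])
    (by
      rintro ⟨_ | _, _ | _⟩ ⟨_ | _, _ | _⟩ h <;> first | (norm_num at h; done) | clear h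
      all_goals simp only [Fintype.sum_prod_type, Fintype.sum_bool, comp_zero,
          zero_comp, add_zero, zero_add, h1', h2', h3', h4'])
    (by
      rintro ⟨_ | _, _ | _⟩ ⟨_ | _, _ | _⟩ h <;> first | (norm_num at h; done) | clear h
      all_goals simp only [Fintype.sum_prod_type, Fintype.sum_bool, comp_zero,
          zero_comp, add_zero, zero_add, one, Prod.mk.injEq, Iso.hom_inv_id,
          reduceCtorEq, and_false, dite_true, dite_false, eqToHom_refl])
    (by
      rintro ⟨_ | _, _ | _⟩ ⟨_ | _, _ | _⟩ h <;> first | (norm_num at h; done) | clear h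
      all_goals simp only [Fintype.sum_prod_type, Fintype.sum_bool, comp_zero,
          zero_comp, add_zero, zero_add, one, Prod.mk.injEq, Iso.inv_hom_id,
          reduceCtorEq, and_false, dite_true, dite_false, eqToHom_refl])

end

section Twists

variable {V : Type u} [Fintype V] (Γ : SimpleGraph V)

/-- The presentation of `Σ_i ⊗ Σ_j` as a square. -/
def twistTwistPresents (i j : V) :
    (MatrixData.square (-tensorMap (𝟙 (Bs Γ i i 0)) (fb Γ j))
      (tensorMap (fb Γ i) (𝟙 (Bs Γ j j 0))) (tensorMap (fb Γ i) (𝟙 (regular (gr Γ))))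
      (tensorMap (𝟙 (regular (gr Γ))) (fb Γ j)) (-1) (-1)).Presents
      (tensorComplex (twist Γ i) (twist Γ j)) :=
  (twistPresents Γ i).tensorDouble (twistPresents Γ j) (Iso.refl _) (Iso.refl _)
    (Iso.refl _) (Iso.refl _)
    ((Category.comp_id _).trans (Eq.trans (by simp) (Category.id_comp _).symm))
    ((Category.comp_id _).trans (Category.id_comp _).symm)
    ((Category.comp_id _).trans (Category.id_comp _).symm)
    ((Category.comp_id _).trans (Eq.trans (by simp) (Category.id_comp _).symm))

variable {Γ}

lemma runit_hom_fb (i : V) : tensorMap (fb Γ i) (𝟙 (regular (gr Γ))) ≫ (runit (regular (gr Γ))).hom =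
    (runit (Bs Γ i i 0)).hom ≫ fb Γ i := by
  rw [← Iso.eq_comp_inv, Category.assoc, ← runit_fb, Iso.hom_inv_id_assoc]

lemma lunit_hom_fb (i : V) : tensorMap (𝟙 (regular (gr Γ))) (fb Γ i) ≫ (runit (regular (gr Γ))).hom =
    (lunit (Bs Γ i i 0)).hom ≫ fb Γ i := by
  rw [← Iso.eq_comp_inv, Category.assoc, ← lunit_fb, Iso.hom_inv_id_assoc]

/-- The homotopy equivalence between `Σ_i ⊗ Σ_j` and `Σ_j ⊗ Σ_i` for non-adjacent `i`, `j`. -/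
theorem twist_comm (i j : V) (hij : i ≠ j) (h : ¬ Γ.Adj i j) :
    Nonempty (HomotopyEquiv (tensorComplex (twist Γ i) (twist Γ j))
      (tensorComplex (twist Γ j) (twist Γ i))) :=
  ⟨(twistTwistPresents Γ i j).squareSwap (twistTwistPresents Γ j i)
    -- Since e_i A e_j and e_j A e_i vanish, both corners in degree -2 are zero objects, and the
    -- zero maps between them are inverse to each other.
    { hom := 0
      inv := 0
      hom_inv_id := tb_hom_ext_not_adj hij h _ _
      inv_hom_id := tb_hom_ext_not_adj hij.symm (fun h' => h h'.symm) _ _ }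
    -- P_iQ_i ⊗ A and A ⊗ P_iQ_i are identified through P_iQ_i. They occupy opposite middle
    -- positions in the two squares, and the same holds for j.
    (runit (Bs Γ i i 0) ≪≫ (lunit (Bs Γ i i 0)).symm)
    (lunit (Bs Γ j j 0) ≪≫ (runit (Bs Γ j j 0)).symm) (Iso.refl _)
    (tb_hom_ext_not_adj hij h _ _) (tb_hom_ext_not_adj hij h _ _)
    (by
      rw [← cancel_mono (runit (regular (gr Γ))).hom, Iso.refl_hom, Category.comp_id, runit_hom_fb,
        Category.assoc, lunit_hom_fb, Iso.trans_hom, Iso.symm_hom, Category.assoc,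
        Iso.inv_hom_id_assoc])
    (by
      rw [← cancel_mono (runit (regular (gr Γ))).hom, Iso.refl_hom, Category.comp_id, lunit_hom_fb,
        Category.assoc, runit_hom_fb, Iso.trans_hom, Iso.symm_hom, Category.assoc,
        Iso.inv_hom_id_assoc])⟩

end Twists

open GrBimod

/-! ### The braid relation for adjacent vertices -/

section Twists

variable {V : Type u} [Fintype V] {Γ : SimpleGraph V} {i j : V}

lemma arr_tb_mem (h : Γ.Adj i j) (k : V) (p : ℤ) (l : V) (q : ℤ) {d : ℤ} (hd : p + q + 1 = d) :
    tb Γ k i p j l q 1 (arr h) 1 ∈ (tensor (Bs Γ k i p) (Bs Γ j l q)).gr d :=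
  tb_mem one_mem_gr (arr_mem h) one_mem_gr (by omega)

/-- The isomorphism `(P_k ⊗ Q_i) ⊗ (P_j ⊗ Q_l) ≅ P_k ⊗ Q_l⟨1⟩` for adjacent `i` and `j`. -/
def adjIso (h : Γ.Adj i j) (k : V) (p : ℤ) (l : V) (q d : ℤ) (hd : p + q + 1 = d) :
    tensor (Bs Γ k i p) (Bs Γ j l q) ≅ Bs Γ k l d where
  hom := contr (coeffA i j) (coeffA_eq_zero i j) k i p j l q d hd
  inv := free (M := tensor (Bs Γ k i p) (Bs Γ j l q)) k l d (tb Γ k i p j l q 1 (arr h) 1)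
    (arr_tb_mem h k p l q hd)
  hom_inv_id := by
    refine tb_hom_ext_adj h ?_
    change ev _ _ = ev _ _
    rw [ev_comp, ev_contr, e_mul_arr, arr_mul_e, coeffA_arr, one_smul]
    refine (ev_free (M := tensor (Bs Γ k i p) (Bs Γ j l q)) _ _ 1 1).trans ?_
    simp
  inv_hom_id := by
    refine bs_hom_ext ?_
    change ev _ _ = ev _ _
    rw [ev_comp]
    refine (congrArg (ev _)
      (ev_free (M := tensor (Bs Γ k i p) (Bs Γ j l q)) _ _ (1 : Alg Γ) 1)).trans ?_
    rw [rsm_tb, lsm_tb, ev_contr, e_mul_arr, arr_mul_e, coeffA_arr, one_smul]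
    simp

@[simp] lemma ev_adjIso_hom (h : Γ.Adj i j) (k : V) (p : ℤ) (l : V) (q d : ℤ)
    (hd : p + q + 1 = d) (a b : Alg Γ) :
    ev (adjIso h k p l q d hd).hom (tb Γ k i p j l q a (arr h) b) = bs Γ k l d a b := by
  rw [adjIso, ev_contr, e_mul_arr, arr_mul_e, coeffA_arr, one_smul]

@[simp] lemma ev_adjIso_inv (h : Γ.Adj i j) (k : V) (p : ℤ) (l : V) (q d : ℤ)
    (hd : p + q + 1 = d) (a b : Alg Γ) :
    ev (adjIso h k p l q d hd).inv (bs Γ k l d a b) = tb Γ k i p j l q a (arr h) b := by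
  refine (ev_free (M := tensor (Bs Γ k i p) (Bs Γ j l q)) _
    (arr_tb_mem h k p l q hd) a b).trans ?_
  simp

/-- The homomorphism `P_i ⊗ Q_j⟨1⟩ → P_i ⊗ Q_i`, `e_i ⊗ e_j ↦ e_i ⊗ (i|j)`. -/
def rmap (h : Γ.Adj i j) : Bs Γ i j 1 ⟶ Bs Γ i i 0 :=
  free i j 1 (bs Γ i i 0 1 (arr h)) (bs_mem one_mem_gr (arr_mem h) (by norm_num))

/-- The homomorphism `P_i ⊗ Q_j⟨1⟩ → P_j ⊗ Q_j`, `e_i ⊗ e_j ↦ (i|j) ⊗ e_j`. -/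
def lmap (h : Γ.Adj i j) : Bs Γ i j 1 ⟶ Bs Γ j j 0 :=
  free i j 1 (bs Γ j j 0 (arr h) 1) (bs_mem (arr_mem h) one_mem_gr (by norm_num))

@[simp] lemma ev_rmap (h : Γ.Adj i j) (a b : Alg Γ) :
    ev (rmap h) (bs Γ i j 1 a b) = bs Γ i i 0 a (arr h * b) := by
  refine (ev_free _ _ a b).trans ?_
  rw [rsm_bs, lsm_bs, mul_one, bs_mul_e, ← mul_assoc, arr_mul_e]

@[simp] lemma ev_lmap (h : Γ.Adj i j) (a b : Alg Γ) :
    ev (lmap h) (bs Γ i j 1 a b) = bs Γ j j 0 (a * arr h) b := by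
  refine (ev_free _ _ a b).trans ?_
  rw [rsm_bs, lsm_bs, one_mul, bs_e_mul, mul_assoc, e_mul_arr]

/-- Both composites send e_i ⊗ e_j to (i|j). This commutative square gives d² = 0 in the five-term
complex. -/
lemma rmap_fb (h : Γ.Adj i j) : rmap h ≫ fb Γ i = lmap h ≫ fb Γ j := by
  refine bs_hom_ext (M := regular (gr Γ)) ?_
  change ev _ _ = ev _ _
  rw [ev_comp, ev_comp, ev_rmap, ev_lmap, ev_fb, ev_fb, one_mul, one_mul, mul_one, mul_one,
    e_mul_arr, arr_mul_e]

/-- The presentation of `Σ_i ⊗ Σ_j` for adjacent `i` and `j`. -/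
def twistTwistPresentsAdj (h : Γ.Adj i j) :
    (MatrixData.square (-rmap h) (lmap h) (fb Γ i) (fb Γ j) (-1) (-1)).Presents
      (tensorComplex (twist Γ i) (twist Γ j)) :=
  -- The space e_i A e_j is spanned by (i|j), of degree 1, so the corner P_iQ_i ⊗ P_jQ_j becomes
  -- P_iQ_j⟨1⟩. The multiplications on its two sides turn into right and left multiplication by the
  -- arrow.
  (twistPresents Γ i).tensorDouble (twistPresents Γ j) (adjIso h i 0 j 0 1 (by norm_num))
    (runit (Bs Γ i i 0)) (lunit (Bs Γ j j 0)) (runit (regular (gr Γ)))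
    (by
      have : ((-1 : ℤ).negOnePow • tensorMap (𝟙 (Bs Γ i i 0)) (fb Γ j)) =
        -tensorMap (𝟙 (Bs Γ i i 0)) (fb Γ j) := by simp
      rw [this, Preadditive.neg_comp, Preadditive.comp_neg]
      refine congrArg Neg.neg ?_
      refine tb_hom_ext_adj h ?_
      change ev _ _ = ev _ _
      rw [ev_comp, ev_comp, ev_adjIso_hom, ev_rmap, ev_tensorMap_tb, ev_id, ev_fb, tmul_bs_reg,
        ev_runit_tr, one_mul, mul_one, mul_one, arr_mul_e])
    (by
      refine tb_hom_ext_adj h ?_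
      change ev _ _ = ev _ _
      rw [ev_comp, ev_comp, ev_adjIso_hom, ev_lmap, ev_tensorMap_tb, ev_id, ev_fb, tmul_reg_bs,
        ev_lunit_tl, one_mul, mul_one, one_mul, e_mul_arr])
    (runit_hom_fb i)
    (by
      have : ((-1 + 1 : ℤ).negOnePow • tensorMap (𝟙 (regular (gr Γ))) (fb Γ j)) =
        tensorMap (𝟙 (regular (gr Γ))) (fb Γ j) := by simp
      rw [this]
      exact lunit_hom_fb j)

/-- The homomorphism `(P_i ⊗ Q_i) ⊗ (P_i ⊗ Q_i) → (P_i ⊗ Q_j⟨1⟩) ⊗ (P_i ⊗ Q_i)` sending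
`(e_i ⊗ x_i) ⊗ (e_i ⊗ e_i)` to `(e_i ⊗ (j|i)) ⊗ (e_i ⊗ e_i)`. -/
def splitX (h : Γ.Adj i j) :
    tensor (Bs Γ i i 0) (Bs Γ i i 0) ⟶ tensor (Bs Γ i j 1) (Bs Γ i i 0) :=
  contrX i i 0 i 0 2 (by norm_num) ≫ (adjIso h.symm i 1 i 0 2 (by norm_num)).inv

/-- The homomorphism `(P_i ⊗ Q_i) ⊗ A → (P_i ⊗ Q_i) ⊗ (P_i ⊗ Q_i)`. -/
def splitOne (Γ : SimpleGraph V) (i : V) :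
    tensor (Bs Γ i i 0) (regular (gr Γ)) ⟶ tensor (Bs Γ i i 0) (Bs Γ i i 0) :=
  (runit (Bs Γ i i 0)).hom ≫ ins Γ i i 0 i 0 0 (by norm_num)

/-- One map puts e_i in the middle and the other reads the coefficient of x_i there. This
orthogonality makes one composite of the elimination maps a strict identity. -/
lemma splitOne_splitX (h : Γ.Adj i j) : splitOne Γ i ≫ splitX h = 0 := by
  rw [splitOne, splitX, Category.assoc, ← Category.assoc (ins _ _ _ _ _ _ _ _), ins_contrX,
    zero_comp, comp_zero]

lemma splitOne_fb (i : V) : splitOne Γ i ≫ tensorMap (𝟙 (Bs Γ i i 0)) (fb Γ i) = 𝟙 _ := by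
  rw [splitOne, Category.assoc, ins_fb_right, Iso.hom_inv_id]

/-- The middle arrow (j|i) is prolonged to (i|j)(j|i) = x_i, whose coefficient `splitX` then reads.
Here the relation for backtracking paths enters. -/
lemma rmap_splitX (h : Γ.Adj i j) :
    tensorMap (rmap h) (𝟙 (Bs Γ i i 0)) ≫ splitX h = 𝟙 _ := by
  refine tb_hom_ext_adj (M := tensor (Bs Γ i j 1) (Bs Γ i i 0)) h.symm ?_
  change ev _ _ = ev _ _
  rw [splitX, ev_comp, ev_comp, ev_tensorMap_tb, ev_rmap, ev_id, ev_id, tmul_bs_bs, mul_one,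
    arr_mul_arr_self, ev_contrX_loop, ev_adjIso_inv]

/-- The two idempotents cut out by `splitX` and `splitOne` do not sum to 1, because the copy of the
bottom corner is not killed by multiplication; the left side is the cross term. With e_i in the
middle, the first idempotent vanishes and the second is the identity. With x_i in the middle, the
first is the identity and the cross term balances the second. -/
lemma split_identity (h : Γ.Adj i j) :
    -(splitX h ≫ tensorMap (𝟙 (Bs Γ i j 1)) (fb Γ i) ≫
        tensorMap (rmap h) (𝟙 (regular (gr Γ))) ≫ splitOne Γ i) =
      -(tensorMap (𝟙 (Bs Γ i i 0)) (fb Γ i) ≫ splitOne Γ i) -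
        splitX h ≫ tensorMap (rmap h) (𝟙 (Bs Γ i i 0)) + 𝟙 _ := by
  rw [sub_eq_add_neg]
  refine tb_hom_ext_self (M := tensor (Bs Γ i i 0) (Bs Γ i i 0)) ?_ ?_
  · change ev _ _ = ev _ _
    rw [splitX, splitOne]
    simp only [ev_comp, ev_neg, ev_add, ev_contrX_one, ev_id, ev_Bs_zero, ev_tensorMap_tb, ev_fb,
      tmul_bs_reg, ev_runit_tr, ev_ins, one_mul, mul_one, tb_e_right]
    rw [ev_map_zero (tensorMap (𝟙 (Bs Γ i j 1)) (fb Γ i)), ev_map_zero (tensorMap (rmap h) _),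
      ev_map_zero (tensorMap (rmap h) _), ev_map_zero (runit (Bs Γ i i 0)).hom, ev_Bs_zero]
    simp
  · change ev _ _ = ev _ _
    rw [splitX, splitOne]
    simp only [ev_comp, ev_neg, ev_add, ev_contrX_loop, ev_id, ev_adjIso_inv, ev_tensorMap_tb,
      ev_fb, tmul_bs_reg, ev_runit_tr, ev_ins, one_mul, mul_one, arr_mul_e,
      ev_tensorMap_tr, ev_rmap, arr_mul_arr_self, loop_mul_e, tmul_bs_bs]
    abel

/-- The homotopy equivalence between `Σ_i ⊗ Σ_j ⊗ Σ_i` and a complex symmetric in `i` and `j`. -/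
theorem twist_twist_twist (h : Γ.Adj i j)
    {S : CochainComplex (GrBimod.{u} (gr Γ) (gr Γ)) ℤ}
    (N : (MatrixData.penta (-rmap h) (lmap h) (lmap h.symm) (-rmap h.symm)
      (fb Γ i) (fb Γ j)).Presents S) :
    Nonempty (HomotopyEquiv
      (tensorComplex (tensorComplex (twist Γ i) (twist Γ j)) (twist Γ i)) S) := by
  have M := (twistTwistPresentsAdj h).squareTensorDouble (twistPresents Γ i)
  -- The third factor's differential carries the Koszul sign of the corner of the square it leaves.
  -- The four corners have total degrees -2, -1, -1 and 0.
  have s1 : ∀ {X Y : GrBimod.{u} (gr Γ) (gr Γ)} (f : X ⟶ Y),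
    (-1 + -1 : ℤ).negOnePow • f = f := fun f => by
      rw [Int.negOnePow_even _ (by decide), one_smul]
  have s2 : ∀ {X Y : GrBimod.{u} (gr Γ) (gr Γ)} (f : X ⟶ Y),
    (-1 + (-1 + 1) : ℤ).negOnePow • f = -f := fun f => by
      rw [Int.negOnePow_odd _ (by decide), Units.neg_smul, one_smul]
  have s3 : ∀ {X Y : GrBimod.{u} (gr Γ) (gr Γ)} (f : X ⟶ Y),
    (-1 + 1 + -1 : ℤ).negOnePow • f = -f := fun f => by
      rw [Int.negOnePow_odd _ (by decide), Units.neg_smul, one_smul]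
  have s4 : ∀ {X Y : GrBimod.{u} (gr Γ) (gr Γ)} (f : X ⟶ Y),
    (-1 + 1 + (-1 + 1) : ℤ).negOnePow • f = f := fun f => by
      rw [Int.negOnePow_even _ (by decide), one_smul]
  rw [s1, s2, s3, s4, tensorMap_neg_left, tensorMap_neg_left] at M
  -- The double product P_iQ_i ⊗ P_iQ_i loses its x_i-part to the bottom corner through `splitX` and
  -- its e_i-part to P_iQ_i ⊗ A through `splitOne`. The five surviving corners are simplified by
  -- unit isomorphisms and by `adjIso`.
  refine ⟨M.cubeHomotopyEquiv N (runit (Bs Γ i j 1)) (adjIso h.symm j 0 i 0 1 (by norm_num))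
    (runit (Bs Γ j j 0)) (lunit (Bs Γ i i 0)) (runit (regular (gr Γ))) (splitX h) (splitOne Γ i)
    ?_ ?_ ?_ ?_ ?_ (splitOne_splitX h) ?_ ?_ ?_ ?_ ?_ (runit_hom_fb j) (lunit_hom_fb i)⟩
  · rw [Preadditive.neg_comp, ← tensorMap_comp, ← tensorMap_comp, rmap_fb, neg_add_cancel]
  · rw [Preadditive.comp_neg, ← tensorMap_comp, ← tensorMap_comp, Category.id_comp,
      Category.id_comp, Category.comp_id, Category.comp_id, add_neg_cancel]
  · rw [Preadditive.neg_comp, ← tensorMap_comp, ← tensorMap_comp, Category.id_comp,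
      Category.comp_id, neg_add_cancel]
  · rw [Preadditive.neg_comp, rmap_splitX, neg_add_cancel]
  · rw [Preadditive.comp_neg, splitOne_fb, neg_add_cancel]
  · have := split_identity h
    simpa [sub_eq_add_neg] using this
  -- This entry is absent from the cube and is created by the elimination: the zigzag through P_iQ_i
  -- ⊗ A and the double product yields `-rmap h`, the term that makes the result symmetric.
  · refine tr_hom_ext (M := Bs Γ i i 0) ?_
    change ev _ _ = ev _ _
    simp only [Preadditive.neg_comp, Preadditive.comp_neg]
    simp only [splitOne, ev_comp, ev_neg, ev_tensorMap_tr, ev_rmap, ev_id, tmul_bs_reg,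
      ev_runit_tr, ev_ins, ev_tensorMap_tb, ev_fb, tmul_reg_bs, ev_lunit_tl, one_mul, mul_one,
      bs_e_left]
  · refine tr_hom_ext (M := Bs Γ j j 0) ?_
    change ev _ _ = ev _ _
    simp
  · refine tb_hom_ext_adj (M := Bs Γ i i 0) h.symm ?_
    change ev _ _ = ev _ _
    simp only [ev_comp, ev_adjIso_hom, ev_lmap, ev_tensorMap_tb, ev_id, ev_fb, tmul_reg_bs,
        ev_lunit_tl, one_mul, mul_one, e_mul_arr]
  · refine tb_hom_ext_adj (M := Bs Γ j j 0) h.symm ?_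
    change ev _ _ = ev _ _
    simp only [Preadditive.neg_comp, Preadditive.comp_neg]
    simp only [ev_comp, ev_neg, ev_adjIso_hom, ev_rmap, ev_tensorMap_tb, ev_id, ev_fb, tmul_bs_reg,
        ev_runit_tr, one_mul, mul_one, arr_mul_e]

/-- The homotopy equivalence between `Σ_i ⊗ Σ_j ⊗ Σ_i` and `Σ_j ⊗ Σ_i ⊗ Σ_j` for adjacent
`i` and `j`. -/
theorem twist_braid (h : Γ.Adj i j) :
    Nonempty (HomotopyEquiv
      (tensorComplex (tensorComplex (twist Γ i) (twist Γ j)) (twist Γ i))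
      (tensorComplex (tensorComplex (twist Γ j) (twist Γ i)) (twist Γ j))) := by
  -- Biproducts are needed to realise the five-term complex by `tot`. It is formed for both
  -- orderings of i and j, and the two forms are identified by interchanging the summands in degrees
  -- -2 and -1.
  have : HasFiniteBiproducts (GrBimod.{u} (gr Γ) (gr Γ)) := .of_hasFiniteCoproducts
  have N := MatrixData.totPresents _ (MatrixData.penta_sq (s₁₁ := -rmap h) (s₁₂ := lmap h)
    (s₂₁ := lmap h.symm) (s₂₂ := -rmap h.symm) (t₁ := fb Γ i) (t₂ := fb Γ j)
    (by rw [Preadditive.neg_comp, rmap_fb, neg_add_cancel])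
    (by rw [Preadditive.neg_comp, rmap_fb, add_neg_cancel]))
  have N' := MatrixData.totPresents _ (MatrixData.penta_sq (s₁₁ := -rmap h.symm)
    (s₁₂ := lmap h.symm) (s₂₁ := lmap h) (s₂₂ := -rmap h) (t₁ := fb Γ j) (t₂ := fb Γ i)
    (by rw [Preadditive.neg_comp, rmap_fb, neg_add_cancel])
    (by rw [Preadditive.neg_comp, rmap_fb, add_neg_cancel]))
  obtain ⟨a⟩ := twist_twist_twist h N
  obtain ⟨b⟩ := twist_twist_twist h.symm N'
  exact ⟨a.trans ((N.pentaHomotopyEquiv N').trans b.symm)⟩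

end Twists

namespace GrBimod

section Coproducts

variable {A : Type v₁} [Ring A] [Algebra ℂ A] {B : Type v₂} [Ring B] [Algebra ℂ B]
  {C : Type v₃} [Ring C] [Algebra ℂ C] {𝒜 : ℤ → Submodule ℂ A} {ℬ : ℤ → Submodule ℂ B}
  {𝒞 : ℤ → Submodule ℂ C} [GradedAlgebra ℬ]

/-! ### Tensor products and direct sums -/

/-- The direct sum is a coproduct. -/
def directSumIsColimit {J : Type} (M : J → GrBimod.{w} 𝒜 ℬ) :
    IsColimit (Cofan.mk (directSum M) (directSumι M)) :=
  Cofan.IsColimit.mk _ (fun s => directSumDesc M s.inj)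
    (fun s j => directSumι_desc M s.inj j)
    (fun s m hm => by
      ext x
      refine directSum_induction M x ?_ (fun x y hx hy => ?_) fun j y => ?_
      · rw [map_zero, map_zero]
      · rw [map_add, map_add, hx, hy]
      · have h1 : directSumι M j ≫ m = s.inj j := hm j
        have h2 := directSumι_desc M s.inj j
        exact LinearMap.congr_fun (congrArg toLin (h1.trans h2.symm)) y)

section Left

variable {J : Type} (M : J → GrBimod.{w} 𝒜 ℬ) (N : GrBimod.{w} ℬ 𝒞) {T : GrBimod.{w} 𝒜 𝒞}
  (s : ∀ j, tensor (M j) N ⟶ T)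

/-- The bilinear map underlying a homomorphism out of `(⨁ M_j) ⊗ N`. -/
def directSumTensorBilin : (directSum M).carrier →ₗ[ℂ] N.carrier →ₗ[ℂ] T.carrier :=
  letI := Classical.decEq J
  LinearMap.flip ((DFinsupp.lsum (M := fun j => (M j).carrier) ℂ).toLinearMap ∘ₗ
    LinearMap.pi fun j => ((tmulBilin (M j) N).compr₂ (toLin (s j))).flip)

lemma directSumTensorBilin_ι (j : J) (m : (M j).carrier) (n : N.carrier) :
    directSumTensorBilin M N s (toLin (directSumι M j) m) n = toLin (s j) (tmul m n) := by
  classical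
  change DFinsupp.lsum (M := fun j => (M j).carrier) ℂ _ (DFinsupp.single j m) = _
  rw [DFinsupp.lsum_single]
  rfl

lemma directSumTensorBilin_mem {p q n : ℤ} (h : p + q = n) {x : (directSum M).carrier}
    (hx : x ∈ (directSum M).gr p) {y : N.carrier} (hy : y ∈ N.gr q) :
    directSumTensorBilin M N s x y ∈ T.gr n := by
  classical
  simp only [Submodule.mem_iInf, Submodule.mem_comap, DFinsupp.lapply_apply] at hx
  change DFinsupp.lsum (M := fun j => (M j).carrier) ℂ _ x ∈ _
  rw [DFinsupp.lsum_apply_apply, DFinsupp.sumAddHom_apply]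
  exact Submodule.dfinsuppSum_mem _ _ _ fun j _ =>
    toLin_mem (s j) (tmul_mem_tensorGr h (hx j) hy)

lemma directSumTensorBilin_balanced (x : (directSum M).carrier) (b : B) (n : N.carrier) :
    directSumTensorBilin M N s ((directSum M).ract (MulOpposite.op b) x) n =
      directSumTensorBilin M N s x (N.lact b n) := by
  refine directSum_induction M x ?_ (fun x y hx hy => ?_) fun j m => ?_
  · simp only [map_zero, LinearMap.zero_apply]
  · simp only [map_add, LinearMap.add_apply, hx, hy]
  · rw [← toLin_ract, directSumTensorBilin_ι, directSumTensorBilin_ι, ract_tmul]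

/-- The homomorphism out of `(⨁ M_j) ⊗ N` with given components. -/
def directSumTensorDesc : tensor (directSum M) N ⟶ T :=
  mkHom (tensorLift (directSumTensorBilin M N s) (directSumTensorBilin_balanced M N s))
    (fun a t => by
      refine tensor_induction t ?_ (fun x n => ?_) (fun x y hx hy => ?_)
      · simp only [map_zero]
      · rw [tensor_lact_tmul, tensorLift_tmul, tensorLift_tmul]
        refine directSum_induction M x ?_ (fun x y hx hy => ?_) fun j m => ?_
        · simp only [map_zero, LinearMap.zero_apply]
        · simp only [map_add, LinearMap.add_apply, hx, hy]
        · rw [← toLin_lact, directSumTensorBilin_ι, directSumTensorBilin_ι, ← tensor_lact_tmul,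
            toLin_lact]
      · simp only [map_add, hx, hy])
    (fun a t => by
      refine tensor_induction t ?_ (fun x n => ?_) (fun x y hx hy => ?_)
      · simp only [map_zero]
      · rw [tensor_ract_tmul, tensorLift_tmul, tensorLift_tmul]
        refine directSum_induction M x ?_ (fun x y hx hy => ?_) fun j m => ?_
        · simp only [map_zero, LinearMap.zero_apply]
        · simp only [map_add, LinearMap.add_apply, hx, hy]
        · rw [directSumTensorBilin_ι, directSumTensorBilin_ι, ← tensor_ract_tmul, toLin_ract]
      · simp only [map_add, hx, hy])
    (fun n x hx => by
      induction hx using Submodule.span_induction with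
      | mem x hx =>
        obtain ⟨i, j, h, x, hx, y, hy, rfl⟩ := hx
        rw [tensorLift_tmul]
        exact directSumTensorBilin_mem M N s h hx hy
      | zero => rw [map_zero]; exact zero_mem _
      | add x y _ _ hx hy => rw [map_add]; exact add_mem hx hy
      | smul c x _ hx => rw [map_smul]; exact Submodule.smul_mem _ _ hx)

lemma directSumTensorDesc_tmul (x : (directSum M).carrier) (n : N.carrier) :
    toLin (directSumTensorDesc M N s) (tmul x n) = directSumTensorBilin M N s x n :=
  tensorLift_tmul _ (directSumTensorBilin_balanced M N s) _ _

lemma directSumTensor_fac (j : J) :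
    tensorMap (directSumι M j) (𝟙 N) ≫ directSumTensorDesc M N s = s j :=
  tensor_hom_ext fun m n => (directSumTensorDesc_tmul M N s _ _).trans
    (directSumTensorBilin_ι M N s j m n)

lemma directSumTensor_hom_ext {f g : tensor (directSum M) N ⟶ T}
    (h : ∀ j, tensorMap (directSumι M j) (𝟙 N) ≫ f = tensorMap (directSumι M j) (𝟙 N) ≫ g) :
    f = g := by
  refine tensor_hom_ext fun x n => ?_
  refine directSum_induction M x ?_ (fun x y hx hy => ?_) fun j m => ?_
  · rw [zero_tmul, map_zero, map_zero]
  · rw [add_tmul, map_add, map_add, hx, hy]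
  · exact LinearMap.congr_fun (congrArg toLin (h j)) (tmul m n)

/-- A term of a total complex is an infinite coproduct over p + q = n. The associator for iterated
total complexes needs tensoring, on either side, to preserve such coproducts. -/
instance : PreservesColimit (Discrete.functor M) ((tensorFunctor.{w} 𝒜 ℬ 𝒞).flip.obj N) :=
  preservesColimit_of_preserves_colimit_cocone (directSumIsColimit M)
    ((isColimitMapCoconeCofanMkEquiv _ _ _).symm
      (Cofan.IsColimit.mk _ (fun t => directSumTensorDesc M N t.inj)
        (fun t j => directSumTensor_fac M N t.inj j)
        (fun t _ hm => directSumTensor_hom_ext M N fun j =>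
          (hm j).trans (directSumTensor_fac M N t.inj j).symm)))

end Left

section Right

variable {J : Type} (N : GrBimod.{w} 𝒜 ℬ) (M : J → GrBimod.{w} ℬ 𝒞) {T : GrBimod.{w} 𝒜 𝒞}
  (s : ∀ j, tensor N (M j) ⟶ T)

/-- The bilinear map underlying a homomorphism out of `N ⊗ (⨁ M_j)`. -/
def tensorDirectSumBilin : N.carrier →ₗ[ℂ] (directSum M).carrier →ₗ[ℂ] T.carrier :=
  letI := Classical.decEq J
  (DFinsupp.lsum (M := fun j => (M j).carrier) ℂ).toLinearMap ∘ₗ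
    LinearMap.pi fun j => (tmulBilin N (M j)).compr₂ (toLin (s j))

lemma tensorDirectSumBilin_ι (j : J) (m : (M j).carrier) (n : N.carrier) :
    tensorDirectSumBilin N M s n (toLin (directSumι M j) m) = toLin (s j) (tmul n m) := by
  classical
  change DFinsupp.lsum (M := fun j => (M j).carrier) ℂ _ (DFinsupp.single j m) = _
  rw [DFinsupp.lsum_single]
  rfl

lemma tensorDirectSumBilin_mem {p q n : ℤ} (h : p + q = n) {y : N.carrier} (hy : y ∈ N.gr p)
    {x : (directSum M).carrier} (hx : x ∈ (directSum M).gr q) :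
    tensorDirectSumBilin N M s y x ∈ T.gr n := by
  classical
  simp only [Submodule.mem_iInf, Submodule.mem_comap, DFinsupp.lapply_apply] at hx
  change DFinsupp.lsum (M := fun j => (M j).carrier) ℂ _ x ∈ _
  rw [DFinsupp.lsum_apply_apply, DFinsupp.sumAddHom_apply]
  exact Submodule.dfinsuppSum_mem _ _ _ fun j _ =>
    toLin_mem (s j) (tmul_mem_tensorGr h hy (hx j))

lemma tensorDirectSumBilin_balanced (n : N.carrier) (b : B) (x : (directSum M).carrier) :
    tensorDirectSumBilin N M s (N.ract (MulOpposite.op b) n) x =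
      tensorDirectSumBilin N M s n ((directSum M).lact b x) := by
  refine directSum_induction M x ?_ (fun x y hx hy => ?_) fun j m => ?_
  · simp only [map_zero]
  · simp only [map_add, hx, hy]
  · rw [← toLin_lact, tensorDirectSumBilin_ι, tensorDirectSumBilin_ι, ract_tmul]

/-- The homomorphism out of `N ⊗ (⨁ M_j)` with given components. -/
def tensorDirectSumDesc : tensor N (directSum M) ⟶ T :=
  mkHom (tensorLift (tensorDirectSumBilin N M s) (tensorDirectSumBilin_balanced N M s))
    (fun a t => by
      refine tensor_induction t ?_ (fun n x => ?_) (fun x y hx hy => ?_)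
      · simp only [map_zero]
      · rw [tensor_lact_tmul, tensorLift_tmul, tensorLift_tmul]
        refine directSum_induction M x ?_ (fun x y hx hy => ?_) fun j m => ?_
        · simp only [map_zero]
        · simp only [map_add, hx, hy]
        · rw [tensorDirectSumBilin_ι, tensorDirectSumBilin_ι, ← tensor_lact_tmul, toLin_lact]
      · simp only [map_add, hx, hy])
    (fun a t => by
      refine tensor_induction t ?_ (fun n x => ?_) (fun x y hx hy => ?_)
      · simp only [map_zero]
      · rw [tensor_ract_tmul, tensorLift_tmul, tensorLift_tmul]
        refine directSum_induction M x ?_ (fun x y hx hy => ?_) fun j m => ?_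
        · simp only [map_zero]
        · simp only [map_add, hx, hy]
        · rw [← toLin_ract, tensorDirectSumBilin_ι, tensorDirectSumBilin_ι, ← tensor_ract_tmul,
            toLin_ract]
      · simp only [map_add, hx, hy])
    (fun n x hx => by
      induction hx using Submodule.span_induction with
      | mem x hx =>
        obtain ⟨i, j, h, x, hx, y, hy, rfl⟩ := hx
        rw [tensorLift_tmul]
        exact tensorDirectSumBilin_mem N M s h hx hy
      | zero => rw [map_zero]; exact zero_mem _
      | add x y _ _ hx hy => rw [map_add]; exact add_mem hx hy
      | smul c x _ hx => rw [map_smul]; exact Submodule.smul_mem _ _ hx)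

lemma tensorDirectSumDesc_tmul (n : N.carrier) (x : (directSum M).carrier) :
    toLin (tensorDirectSumDesc N M s) (tmul n x) = tensorDirectSumBilin N M s n x :=
  tensorLift_tmul _ (tensorDirectSumBilin_balanced N M s) _ _

lemma tensorDirectSum_fac (j : J) :
    tensorMap (𝟙 N) (directSumι M j) ≫ tensorDirectSumDesc N M s = s j :=
  tensor_hom_ext fun n m => (tensorDirectSumDesc_tmul N M s _ _).trans
    (tensorDirectSumBilin_ι N M s j m n)

lemma tensorDirectSum_hom_ext {f g : tensor N (directSum M) ⟶ T}
    (h : ∀ j, tensorMap (𝟙 N) (directSumι M j) ≫ f = tensorMap (𝟙 N) (directSumι M j) ≫ g) :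
    f = g := by
  refine tensor_hom_ext fun n x => ?_
  refine directSum_induction M x ?_ (fun x y hx hy => ?_) fun j m => ?_
  · rw [tmul_zero, map_zero, map_zero]
  · rw [tmul_add, map_add, map_add, hx, hy]
  · exact LinearMap.congr_fun (congrArg toLin (h j)) (tmul n m)

instance : PreservesColimit (Discrete.functor M) ((tensorFunctor.{w} 𝒜 ℬ 𝒞).obj N) :=
  preservesColimit_of_preserves_colimit_cocone (directSumIsColimit M)
    ((isColimitMapCoconeCofanMkEquiv _ _ _).symm
      (Cofan.IsColimit.mk _ (fun t => tensorDirectSumDesc N M t.inj)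
        (fun t j => tensorDirectSum_fac N M t.inj j)
        (fun t _ hm => tensorDirectSum_hom_ext N M fun j =>
          (hm j).trans (tensorDirectSum_fac N M t.inj j).symm)))

end Right

end Coproducts

end GrBimod

/-! ### Naturality of the associator -/

section Naturality

open HomologicalComplex

variable {C₁ C₂ C₁₂ C₂₃ C₃ C₄ : Type*}
  [Category C₁] [Category C₂] [Category C₃] [Category C₄] [Category C₁₂] [Category C₂₃]
  [Preadditive C₁] [Preadditive C₂] [Preadditive C₃]
  [Preadditive C₁₂] [Preadditive C₂₃] [Preadditive C₄]
  {F₁₂ : C₁ ⥤ C₂ ⥤ C₁₂} {G : C₁₂ ⥤ C₃ ⥤ C₄}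
  {F : C₁ ⥤ C₂₃ ⥤ C₄} {G₂₃ : C₂ ⥤ C₃ ⥤ C₂₃}
  [F₁₂.PreservesZeroMorphisms] [∀ (X₁ : C₁), (F₁₂.obj X₁).PreservesZeroMorphisms]
  [G.Additive] [∀ (X₁₂ : C₁₂), (G.obj X₁₂).PreservesZeroMorphisms]
  [G₂₃.PreservesZeroMorphisms] [∀ (X₂ : C₂), (G₂₃.obj X₂).PreservesZeroMorphisms]
  [F.PreservesZeroMorphisms] [∀ (X₁ : C₁), (F.obj X₁).Additive]
  (associator : bifunctorComp₁₂ F₁₂ G ≅ bifunctorComp₂₃ F G₂₃)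
  (K₁ : CochainComplex C₁ ℤ) (K₂ : CochainComplex C₂ ℤ)
  {K₃ L₃ : CochainComplex C₃ ℤ} (f : K₃ ⟶ L₃)
  [HasMapBifunctor K₁ K₂ F₁₂ (.up ℤ)] [HasMapBifunctor K₂ K₃ G₂₃ (.up ℤ)]
  [HasMapBifunctor K₂ L₃ G₂₃ (.up ℤ)]
  [HasMapBifunctor (mapBifunctor K₁ K₂ F₁₂ (.up ℤ)) K₃ G (.up ℤ)]
  [HasMapBifunctor (mapBifunctor K₁ K₂ F₁₂ (.up ℤ)) L₃ G (.up ℤ)]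
  [HasMapBifunctor K₁ (mapBifunctor K₂ K₃ G₂₃ (.up ℤ)) F (.up ℤ)]
  [HasMapBifunctor K₁ (mapBifunctor K₂ L₃ G₂₃ (.up ℤ)) F (.up ℤ)]

lemma mapBifunctor₁₂_ι_map (i₁ i₂ i₃ i₁₂ n : ℤ)
    (h₁₂ : ComplexShape.π (.up ℤ) (.up ℤ) (.up ℤ) (i₁, i₂) = i₁₂)
    (h : ComplexShape.π (.up ℤ) (.up ℤ) (.up ℤ) (i₁₂, i₃) = n) :
    (G.map (ιMapBifunctor K₁ K₂ F₁₂ (.up ℤ) i₁ i₂ i₁₂ h₁₂)).app (K₃.X i₃) ≫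
        ιMapBifunctor (mapBifunctor K₁ K₂ F₁₂ (.up ℤ)) K₃ G (.up ℤ) i₁₂ i₃ n h ≫
          (mapBifunctorMap (𝟙 (mapBifunctor K₁ K₂ F₁₂ (.up ℤ))) f G (.up ℤ)).f n =
      (G.obj ((F₁₂.obj (K₁.X i₁)).obj (K₂.X i₂))).map (f.f i₃) ≫
        (G.map (ιMapBifunctor K₁ K₂ F₁₂ (.up ℤ) i₁ i₂ i₁₂ h₁₂)).app (L₃.X i₃) ≫
          ιMapBifunctor (mapBifunctor K₁ K₂ F₁₂ (.up ℤ)) L₃ G (.up ℤ) i₁₂ i₃ n h := by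
  rw [ι_mapBifunctorMap, id_f, CategoryTheory.Functor.map_id, NatTrans.id_app, Category.id_comp,
    NatTrans.naturality_assoc]

lemma mapBifunctor₂₃_ι_map (i₁ i₂ i₃ i₂₃ n : ℤ)
    (h₂₃ : ComplexShape.π (.up ℤ) (.up ℤ) (.up ℤ) (i₂, i₃) = i₂₃)
    (h : ComplexShape.π (.up ℤ) (.up ℤ) (.up ℤ) (i₁, i₂₃) = n) :
    (F.obj (K₁.X i₁)).map (ιMapBifunctor K₂ K₃ G₂₃ (.up ℤ) i₂ i₃ i₂₃ h₂₃) ≫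
        ιMapBifunctor K₁ (mapBifunctor K₂ K₃ G₂₃ (.up ℤ)) F (.up ℤ) i₁ i₂₃ n h ≫
          (mapBifunctorMap (𝟙 K₁) (mapBifunctorMap (𝟙 K₂) f G₂₃ (.up ℤ)) F (.up ℤ)).f n =
      (F.obj (K₁.X i₁)).map ((G₂₃.obj (K₂.X i₂)).map (f.f i₃)) ≫
        (F.obj (K₁.X i₁)).map (ιMapBifunctor K₂ L₃ G₂₃ (.up ℤ) i₂ i₃ i₂₃ h₂₃) ≫
          ιMapBifunctor K₁ (mapBifunctor K₂ L₃ G₂₃ (.up ℤ)) F (.up ℤ) i₁ i₂₃ n h := by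
  rw [ι_mapBifunctorMap, id_f, CategoryTheory.Functor.map_id, NatTrans.id_app, Category.id_comp,
    ← Functor.map_comp_assoc, ι_mapBifunctorMap, id_f, CategoryTheory.Functor.map_id, NatTrans.id_app,
    Category.id_comp, Functor.map_comp_assoc]

variable [HasGoodTrifunctor₁₂Obj F₁₂ G K₁ K₂ K₃ (.up ℤ) (.up ℤ)]
  [HasGoodTrifunctor₂₃Obj F G₂₃ K₁ K₂ K₃ (.up ℤ) (.up ℤ) (.up ℤ)]
  [HasGoodTrifunctor₁₂Obj F₁₂ G K₁ K₂ L₃ (.up ℤ) (.up ℤ)]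
  [HasGoodTrifunctor₂₃Obj F G₂₃ K₁ K₂ L₃ (.up ℤ) (.up ℤ) (.up ℤ)]

/-- Naturality in the third variable is what a statement about the functors K ⊗ - requires. On the
summand indexed by (i₁, i₂, i₃) both sides reduce to naturality of the given associator. -/
lemma mapBifunctorAssociator_naturality :
    mapBifunctorMap (𝟙 (mapBifunctor K₁ K₂ F₁₂ (.up ℤ))) f G (.up ℤ) ≫
        (mapBifunctorAssociator associator K₁ K₂ L₃ (.up ℤ) (.up ℤ) (.up ℤ)).hom =
      (mapBifunctorAssociator associator K₁ K₂ K₃ (.up ℤ) (.up ℤ) (.up ℤ)).hom ≫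
        mapBifunctorMap (𝟙 K₁) (mapBifunctorMap (𝟙 K₂) f G₂₃ (.up ℤ)) F (.up ℤ) := by
  ext n i₁ i₂ i₃ h
  have h' : i₁ + (i₂ + i₃) = n := by rw [← h]; exact (add_assoc _ _ _).symm
  have e1 : mapBifunctor₁₂.ι F₁₂ G K₁ K₂ K₃ (.up ℤ) (.up ℤ) i₁ i₂ i₃ n h ≫
      (mapBifunctorMap (𝟙 (mapBifunctor K₁ K₂ F₁₂ (.up ℤ))) f G (.up ℤ)).f n =
      (G.obj ((F₁₂.obj (K₁.X i₁)).obj (K₂.X i₂))).map (f.f i₃) ≫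
        mapBifunctor₁₂.ι F₁₂ G K₁ K₂ L₃ (.up ℤ) (.up ℤ) i₁ i₂ i₃ n h := by
    rw [mapBifunctor₁₂.ι_eq _ _ _ _ _ _ _ _ _ _ _ _ rfl h,
      mapBifunctor₁₂.ι_eq _ _ _ _ _ _ _ _ _ _ _ _ rfl h, Category.assoc]
    exact mapBifunctor₁₂_ι_map K₁ K₂ f i₁ i₂ i₃ _ n rfl h
  have e2 : mapBifunctor₂₃.ι F G₂₃ K₁ K₂ K₃ (.up ℤ) (.up ℤ) (.up ℤ) i₁ i₂ i₃ n h ≫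
      (mapBifunctorMap (𝟙 K₁) (mapBifunctorMap (𝟙 K₂) f G₂₃ (.up ℤ)) F (.up ℤ)).f n =
      (F.obj (K₁.X i₁)).map ((G₂₃.obj (K₂.X i₂)).map (f.f i₃)) ≫
        mapBifunctor₂₃.ι F G₂₃ K₁ K₂ L₃ (.up ℤ) (.up ℤ) (.up ℤ) i₁ i₂ i₃ n h := by
    rw [mapBifunctor₂₃.ι_eq _ _ _ _ _ _ _ _ _ _ _ _ _ rfl h',
      mapBifunctor₂₃.ι_eq _ _ _ _ _ _ _ _ _ _ _ _ _ rfl h', Category.assoc]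
    exact mapBifunctor₂₃_ι_map K₁ K₂ f i₁ i₂ i₃ _ n rfl h'
  have e3 := ι_mapBifunctorAssociatorX_hom associator K₁ K₂ K₃ (.up ℤ) (.up ℤ) (.up ℤ) i₁ i₂ i₃ n h
  have e4 := ι_mapBifunctorAssociatorX_hom associator K₁ K₂ L₃ (.up ℤ) (.up ℤ) (.up ℤ) i₁ i₂ i₃ n h
  have e5 := ((associator.hom.app (K₁.X i₁)).app (K₂.X i₂)).naturality (f.f i₃)
  change _ ≫ _ ≫ (mapBifunctorAssociatorX associator K₁ K₂ L₃ (.up ℤ) (.up ℤ) (.up ℤ) n).hom =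
    _ ≫ (mapBifunctorAssociatorX associator K₁ K₂ K₃ (.up ℤ) (.up ℤ) (.up ℤ) n).hom ≫ _
  rw [reassoc_of% e1, e4, reassoc_of% e3]
  refine ((reassoc_of% e5) _).trans ?_
  exact (congrArg (((associator.hom.app (K₁.X i₁)).app (K₂.X i₂)).app (K₃.X i₃) ≫ ·) e2.symm).trans
    (Category.assoc _ _ _).symm

end Naturality

/-! ### The associativity of the tensor product -/

namespace GrBimod

section Associator

variable {A : Type v₁} [Ring A] [Algebra ℂ A] {B : Type v₂} [Ring B] [Algebra ℂ B]
  {C : Type v₃} [Ring C] [Algebra ℂ C] {D : Type v₄} [Ring D] [Algebra ℂ D]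
  {𝒜 : ℤ → Submodule ℂ A} {ℬ : ℤ → Submodule ℂ B}
  {𝒞 : ℤ → Submodule ℂ C} {𝒟 : ℤ → Submodule ℂ D}
  (M : GrBimod.{w} 𝒜 ℬ) (N : GrBimod.{w} ℬ 𝒞) (K : GrBimod.{w} 𝒞 𝒟)

@[elab_as_elim]
lemma tensor_tensor_induction [GradedAlgebra ℬ] {p : TensorCarrier (tensor M N) K → Prop}
    (x : TensorCarrier (tensor M N) K) (zero : p 0)
    (tmul : ∀ m n k, p (tmul (M := tensor M N) (tmul m n) k))
    (add : ∀ x y, p x → p y → p (x + y)) : p x := by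
  refine tensor_induction x zero (fun y k => ?_) add
  refine tensor_induction y ?_ (fun m n => tmul m n k) (fun x y hx hy => ?_)
  · rw [GrBimod.zero_tmul (M := tensor M N)]; exact zero
  · rw [GrBimod.add_tmul (M := tensor M N)]; exact add _ _ hx hy

@[elab_as_elim]
lemma tensor_tensor_induction' [GradedAlgebra 𝒞] {p : TensorCarrier M (tensor N K) → Prop}
    (x : TensorCarrier M (tensor N K)) (zero : p 0)
    (tmul : ∀ m n k, p (tmul (N := tensor N K) m (tmul n k)))
    (add : ∀ x y, p x → p y → p (x + y)) : p x := by
  refine tensor_induction x zero (fun m y => ?_) add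
  refine tensor_induction y ?_ (fun n k => tmul m n k) (fun x y hx hy => ?_)
  · rw [GrBimod.tmul_zero (N := tensor N K)]; exact zero
  · rw [GrBimod.tmul_add (N := tensor N K)]; exact add _ _ hx hy

variable [GradedAlgebra ℬ] [GradedAlgebra 𝒞]

/-- The trilinear map `m ⊗ n ⊗ k ↦ m ⊗ (n ⊗ k)`. -/
def assocTrilin : M.carrier →ₗ[ℂ] N.carrier →ₗ[ℂ] K.carrier →ₗ[ℂ]
    TensorCarrier M (tensor N K) where
  toFun m := (tmulBilin N K).compr₂ (tmulBilin M (tensor N K) m)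
  map_add' m m' := LinearMap.ext₂ fun n k => add_tmul (N := tensor N K) m m' (tmul n k)
  map_smul' c m := LinearMap.ext₂ fun n k =>
    LinearMap.congr_fun (map_smul (tmulBilin M (tensor N K)) c m) (tmul n k)

/-- The linear map `m ⊗ n ↦ (k ↦ m ⊗ (n ⊗ k))`. -/
def assocBilin : TensorCarrier M N →ₗ[ℂ] K.carrier →ₗ[ℂ] TensorCarrier M (tensor N K) :=
  tensorLift (assocTrilin M N K) fun m b n =>
    LinearMap.ext fun k => ract_tmul (N := tensor N K) m b (tmul n k)

lemma assocBilin_balanced (x : TensorCarrier M N) (c : C) (k : K.carrier) :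
    assocBilin M N K ((tensor M N).ract (MulOpposite.op c) x) k =
      assocBilin M N K x (K.lact c k) := by
  refine tensor_induction x ?_ (fun m n => ?_) (fun x y hx hy => ?_)
  · simp only [map_zero, LinearMap.zero_apply]
  · exact congrArg (tmul (N := tensor N K) m) (ract_tmul n c k)
  · simp only [map_add, LinearMap.add_apply, hx, hy]

/-- The trilinear map `m ⊗ n ⊗ k ↦ (m ⊗ n) ⊗ k`. -/
def assocInvTrilin : N.carrier →ₗ[ℂ] K.carrier →ₗ[ℂ] M.carrier →ₗ[ℂ]
    TensorCarrier (tensor M N) K where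
  toFun n := ((tmulBilin (tensor M N) K) ∘ₗ ((tmulBilin M N).flip n)).flip
  map_add' n n' := LinearMap.ext₂ fun k m =>
    (congrArg (fun x => tmul (M := tensor M N) x k) (tmul_add m n n')).trans
      (add_tmul (M := tensor M N) _ _ k)
  map_smul' c n := LinearMap.ext₂ fun k m =>
    (congrArg (fun x => tmul (M := tensor M N) x k) (map_smul (tmulBilin M N m) c n)).trans
      (LinearMap.congr_fun (map_smul (tmulBilin (tensor M N) K) c (tmul m n)) k)

/-- The linear map `n ⊗ k ↦ (m ↦ (m ⊗ n) ⊗ k)`. -/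
def assocInvBilin : TensorCarrier N K →ₗ[ℂ] M.carrier →ₗ[ℂ] TensorCarrier (tensor M N) K :=
  tensorLift (assocInvTrilin M N K) fun n c k =>
    LinearMap.ext fun m => ract_tmul (M := tensor M N) (tmul m n) c k

lemma assocInvBilin_balanced (m : M.carrier) (b : B) (x : TensorCarrier N K) :
    (assocInvBilin M N K).flip (M.ract (MulOpposite.op b) m) x =
      (assocInvBilin M N K).flip m ((tensor N K).lact b x) := by
  refine tensor_induction x ?_ (fun n k => ?_) (fun x y hx hy => ?_)
  · simp only [map_zero]
  · exact congrArg (fun x => tmul (M := tensor M N) x k) (ract_tmul m b n)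
  · simp only [map_add, hx, hy]

/-- The associator. -/
def assoc : tensor (tensor M N) K ≅ tensor M (tensor N K) where
  hom := mkHom (tensorLift (M := tensor M N) (assocBilin M N K) (assocBilin_balanced M N K))
    (fun a x => by
      refine tensor_tensor_induction M N K x ?_ (fun m n k => rfl) (fun x y hx hy => ?_)
      · simp only [map_zero]
      · simp only [map_add, hx, hy])
    (fun a x => by
      refine tensor_tensor_induction M N K x ?_ (fun m n k => rfl) (fun x y hx hy => ?_)
      · simp only [map_zero]
      · simp only [map_add, hx, hy])
    (fun n x hx => by
      induction hx using Submodule.span_induction with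
      | mem x hx =>
        obtain ⟨i, j, rfl, x, hx, k, hk, rfl⟩ := hx
        induction hx using Submodule.span_induction with
        | mem x hx =>
          obtain ⟨i, l, rfl, m, hm, n, hn, rfl⟩ := hx
          exact tmul_mem_tensorGr (N := tensor N K) (add_assoc _ _ _).symm hm
            (tmul_mem_tensorGr rfl hn hk)
        | zero => rw [GrBimod.zero_tmul (M := tensor M N), map_zero]; exact zero_mem _
        | add x y _ _ hx hy =>
          rw [GrBimod.add_tmul (M := tensor M N), map_add]; exact add_mem hx hy
        | smul c x _ hx =>
          rw [tensorLift_tmul (M := tensor M N)] at hx ⊢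
          rw [map_smul, LinearMap.smul_apply]
          exact Submodule.smul_mem _ _ hx
      | zero => rw [map_zero]; exact zero_mem _
      | add x y _ _ hx hy => rw [map_add]; exact add_mem hx hy
      | smul c x _ hx => rw [map_smul]; exact Submodule.smul_mem _ _ hx)
  inv := mkHom (tensorLift (N := tensor N K) (assocInvBilin M N K).flip
      (assocInvBilin_balanced M N K))
    (fun a x => by
      refine tensor_tensor_induction' M N K x ?_ (fun m n k => rfl) (fun x y hx hy => ?_)
      · simp only [map_zero]
      · simp only [map_add, hx, hy])
    (fun a x => by
      refine tensor_tensor_induction' M N K x ?_ (fun m n k => rfl) (fun x y hx hy => ?_)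
      · simp only [map_zero]
      · simp only [map_add, hx, hy])
    (fun n x hx => by
      induction hx using Submodule.span_induction with
      | mem x hx =>
        obtain ⟨i, j, rfl, m, hm, x, hx, rfl⟩ := hx
        induction hx using Submodule.span_induction with
        | mem x hx =>
          obtain ⟨j, l, rfl, n, hn, k, hk, rfl⟩ := hx
          exact tmul_mem_tensorGr (M := tensor M N) (add_assoc _ _ _)
            (tmul_mem_tensorGr rfl hm hn) hk
        | zero => rw [GrBimod.tmul_zero (N := tensor N K), map_zero]; exact zero_mem _
        | add x y _ _ hx hy =>
          rw [GrBimod.tmul_add (N := tensor N K), map_add]; exact add_mem hx hy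
        | smul c x _ hx =>
          rw [tensorLift_tmul (N := tensor N K)] at hx ⊢
          rw [map_smul]
          exact Submodule.smul_mem _ _ hx
      | zero => rw [map_zero]; exact zero_mem _
      | add x y _ _ hx hy => rw [map_add]; exact add_mem hx hy
      | smul c x _ hx => rw [map_smul]; exact Submodule.smul_mem _ _ hx)
  hom_inv_id := by
    ext x
    refine tensor_tensor_induction M N K x ?_ (fun m n k => rfl) (fun x y hx hy => ?_)
    · simp only [map_zero]
    · simp only [map_add, hx, hy]
  inv_hom_id := by
    ext x
    refine tensor_tensor_induction' M N K x ?_ (fun m n k => rfl) (fun x y hx hy => ?_)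
    · simp only [map_zero]
    · simp only [map_add, hx, hy]

variable {M N K} in
lemma tensor_tensor_hom_ext {T : GrBimod.{w} 𝒜 𝒟} {f g : tensor (tensor M N) K ⟶ T}
    (h : ∀ m n k, toLin f (tmul (M := tensor M N) (tmul m n) k) =
      toLin g (tmul (M := tensor M N) (tmul m n) k)) : f = g := by
  ext x
  refine tensor_tensor_induction M N K x ?_ h (fun x y hx hy => ?_)
  · rw [map_zero, map_zero]
  · rw [map_add, map_add, hx, hy]

variable {M N K} in
lemma assoc_naturality {M' : GrBimod.{w} 𝒜 ℬ} {N' : GrBimod.{w} ℬ 𝒞} {K' : GrBimod.{w} 𝒞 𝒟}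
    (f : M ⟶ M') (g : N ⟶ N') (h : K ⟶ K') :
    tensorMap (tensorMap f g) h ≫ (assoc M' N' K').hom =
      (assoc M N K).hom ≫ tensorMap f (tensorMap g h) :=
  tensor_tensor_hom_ext fun _ _ _ => rfl

variable (𝒜 ℬ 𝒞 𝒟) in
/-- The associativity of the tensor product, as an isomorphism of trifunctors. -/
def tensorAssociator :
    bifunctorComp₁₂ (tensorFunctor.{w} 𝒜 ℬ 𝒞) (tensorFunctor.{w} 𝒜 𝒞 𝒟) ≅
      bifunctorComp₂₃ (tensorFunctor.{w} 𝒜 ℬ 𝒟) (tensorFunctor.{w} ℬ 𝒞 𝒟) :=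
  NatIso.ofComponents (fun M => NatIso.ofComponents (fun N => NatIso.ofComponents
    (fun K => assoc M N K)
    (fun {K K'} h => by
      have := assoc_naturality (𝟙 M) (𝟙 N) h
      rw [tensorMap_id] at this
      exact this))
    (fun {N N'} g => NatTrans.ext (funext fun K => assoc_naturality (𝟙 M) g (𝟙 K))))
    (fun {M M'} f => NatTrans.ext (funext fun N => NatTrans.ext (funext fun K => by
      have := assoc_naturality f (𝟙 N) (𝟙 K)
      rw [tensorMap_id] at this
      exact this)))

end Associator

end GrBimod

namespace GrBimod

/-! ### Functoriality, associativity and unitality of the tensor product of complexes -/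

section Complexes

variable {A : Type v₁} [Ring A] [Algebra ℂ A] {B : Type v₂} [Ring B] [Algebra ℂ B]
  {C : Type v₃} [Ring C] [Algebra ℂ C] {D : Type v₄} [Ring D] [Algebra ℂ D]
  {𝒜 : ℤ → Submodule ℂ A} {ℬ : ℤ → Submodule ℂ B}
  {𝒞 : ℤ → Submodule ℂ C} {𝒟 : ℤ → Submodule ℂ D} [GradedAlgebra ℬ]

lemma tensorComplexMap_id (K : CochainComplex (GrBimod.{w} 𝒜 ℬ) ℤ)
    (L : CochainComplex (GrBimod.{w} ℬ 𝒞) ℤ) : tensorComplexMap (𝟙 K) (𝟙 L) = 𝟙 _ := by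
  ext n : 1
  refine tensorComplex_hom_ext fun p q h => ?_
  rw [tensorι_map, HomologicalComplex.id_f, HomologicalComplex.id_f, HomologicalComplex.id_f,
    tensorMap_id, Category.id_comp, Category.comp_id]

lemma tensorComplexMap_comp {K K' K'' : CochainComplex (GrBimod.{w} 𝒜 ℬ) ℤ}
    {L L' L'' : CochainComplex (GrBimod.{w} ℬ 𝒞) ℤ} (f : K ⟶ K') (f' : K' ⟶ K'') (g : L ⟶ L')
    (g' : L' ⟶ L'') :
    tensorComplexMap (f ≫ f') (g ≫ g') = tensorComplexMap f g ≫ tensorComplexMap f' g' := by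
  ext n : 1
  refine tensorComplex_hom_ext fun p q h => ?_
  rw [tensorι_map, HomologicalComplex.comp_f, HomologicalComplex.comp_f,
    HomologicalComplex.comp_f, tensorMap_comp, ← Category.assoc (tensorι K L p q n h), tensorι_map,
    Category.assoc, Category.assoc, tensorι_map]

/-- The tensor product with a fixed complex preserves homotopy equivalences in the first
variable. -/
def tensorHomotopyEquiv {K K' : CochainComplex (GrBimod.{w} 𝒜 ℬ) ℤ} (e : HomotopyEquiv K K')
    (L : CochainComplex (GrBimod.{w} ℬ 𝒞) ℤ) :
    HomotopyEquiv (tensorComplex K L) (tensorComplex K' L) where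
  hom := tensorComplexMap e.hom (𝟙 L)
  inv := tensorComplexMap e.inv (𝟙 L)
  homotopyHomInvId := (Homotopy.ofEq (by
      rw [← tensorComplexMap_comp, Category.comp_id]; rfl)).trans
    ((HomologicalComplex.mapBifunctorMapHomotopy₁ e.homotopyHomInvId (𝟙 L)
      (tensorFunctor.{w} 𝒜 ℬ 𝒞) (ComplexShape.up ℤ)).trans
    (Homotopy.ofEq (tensorComplexMap_id K L)))
  homotopyInvHomId := (Homotopy.ofEq (by
      rw [← tensorComplexMap_comp, Category.comp_id]; rfl)).trans
    ((HomologicalComplex.mapBifunctorMapHomotopy₁ e.homotopyInvHomId (𝟙 L)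
      (tensorFunctor.{w} 𝒜 ℬ 𝒞) (ComplexShape.up ℤ)).trans
    (Homotopy.ofEq (tensorComplexMap_id K' L)))

variable (𝒞) in
/-- Homotopy equivalent complexes induce isomorphic functors. -/
def tensorLeftHomotopyCongr {K K' : CochainComplex (GrBimod.{w} 𝒜 ℬ) ℤ}
    (e : HomotopyEquiv K K') : tensorLeftHomotopy.{w} 𝒞 K ≅ tensorLeftHomotopy.{w} 𝒞 K' :=
  CategoryTheory.Quotient.natIsoLift _ (NatIso.ofComponents
    (fun L => HomotopyCategory.isoOfHomotopyEquiv (tensorHomotopyEquiv e L))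
    (fun {L L'} g => by
      -- The interchange law holds strictly for complexes, before passing to homotopy classes.
      have h : tensorComplexMap (𝟙 K) g ≫ tensorComplexMap e.hom (𝟙 L') =
          tensorComplexMap e.hom (𝟙 L) ≫ tensorComplexMap (𝟙 K') g := by
        rw [← tensorComplexMap_comp, ← tensorComplexMap_comp, Category.comp_id, Category.comp_id,
          Category.id_comp, Category.id_comp]
      exact congrArg (HomotopyCategory.quotient _ _).map h))

section Assoc

variable [GradedAlgebra 𝒞]

/-- The associativity of the tensor product of complexes. -/
def tensorComplexAssoc (K : CochainComplex (GrBimod.{w} 𝒜 ℬ) ℤ)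
    (L : CochainComplex (GrBimod.{w} ℬ 𝒞) ℤ) (M : CochainComplex (GrBimod.{w} 𝒞 𝒟) ℤ) :
    tensorComplex (tensorComplex K L) M ≅ tensorComplex K (tensorComplex L M) :=
  HomologicalComplex.mapBifunctorAssociator (tensorAssociator 𝒜 ℬ 𝒞 𝒟) K L M (.up ℤ) (.up ℤ)
    (.up ℤ)

lemma tensorComplexAssoc_naturality (K : CochainComplex (GrBimod.{w} 𝒜 ℬ) ℤ)
    (L : CochainComplex (GrBimod.{w} ℬ 𝒞) ℤ) {M M' : CochainComplex (GrBimod.{w} 𝒞 𝒟) ℤ}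
    (f : M ⟶ M') :
    tensorComplexMap (𝟙 (tensorComplex K L)) f ≫ (tensorComplexAssoc K L M').hom =
      (tensorComplexAssoc K L M).hom ≫ tensorComplexMap (𝟙 K) (tensorComplexMap (𝟙 L) f) :=
  mapBifunctorAssociator_naturality (tensorAssociator 𝒜 ℬ 𝒞 𝒟) K L f

variable (𝒟) in
/-- The functor `(K ⊗ L) ⊗ -` is isomorphic to `K ⊗ (L ⊗ -)`. -/
def tensorLeftHomotopyComp (K : CochainComplex (GrBimod.{w} 𝒜 ℬ) ℤ)
    (L : CochainComplex (GrBimod.{w} ℬ 𝒞) ℤ) :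
    tensorLeftHomotopy.{w} 𝒟 (tensorComplex K L) ≅
      tensorLeftHomotopy.{w} 𝒟 L ⋙ tensorLeftHomotopy.{w} 𝒟 K :=
  CategoryTheory.Quotient.natIsoLift _ (NatIso.ofComponents
    (fun M => (HomotopyCategory.quotient _ _).mapIso (tensorComplexAssoc K L M))
    (fun f => congrArg (HomotopyCategory.quotient _ _).map
      (tensorComplexAssoc_naturality K L f)))

end Assoc

end Complexes

section Unit

variable {A : Type w} [Ring A] [Algebra ℂ A] {B : Type v₂} [Ring B] [Algebra ℂ B]
  (𝒜 : ℤ → Submodule ℂ A) {ℬ : ℤ → Submodule ℂ B} [GradedAlgebra 𝒜]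

/-- The regular bimodule as a complex concentrated in degree `0`. -/
abbrev regularComplex : CochainComplex (GrBimod.{w} 𝒜 𝒜) ℤ :=
  (CochainComplex.singleFunctor _ 0).obj (regular 𝒜)

/-- The term of degree `0` of the regular complex. -/
def regularComplexIso {p : ℤ} (h : p = 0) : (regularComplex 𝒜).X p ≅ regular 𝒜 :=
  HomologicalComplex.singleObjXIsoOfEq _ 0 (regular 𝒜) p h

variable {𝒜} (M : CochainComplex (GrBimod.{w} 𝒜 ℬ) ℤ)

/-- The terms of `A ⊗_A M`. -/
def tensorComplexUnitX (n : ℤ) : M.X n ≅ (tensorComplex (regularComplex 𝒜) M).X n where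
  hom := (lunit (M.X n)).inv ≫ tensorMap (regularComplexIso 𝒜 rfl).inv (𝟙 (M.X n)) ≫
    tensorι (regularComplex 𝒜) M 0 n n (zero_add n)
  -- The value 0 for `p ≠ 0` is harmless, since the regular complex has only zero terms there; for
  -- `p = 0` the `eqToHom` identifies `q` with `n`.
  inv := tensorDesc fun p q h => if hp : p = 0 then
    tensorMap (regularComplexIso 𝒜 hp).hom (eqToHom (by rw [← h, hp, zero_add])) ≫
      (lunit (M.X n)).hom else 0
  hom_inv_id := by
    rw [Category.assoc, Category.assoc, tensorι_desc, dif_pos rfl, ← Category.assoc (tensorMap _ _),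
      ← tensorMap_comp, Iso.inv_hom_id, eqToHom_refl, Category.comp_id, tensorMap_id,
      Category.id_comp, Iso.inv_hom_id]
  inv_hom_id := by
    refine tensorComplex_hom_ext fun p q h => ?_
    rw [← Category.assoc, tensorι_desc, Category.comp_id]
    by_cases hp : p = 0
    · obtain rfl := hp
      obtain rfl : q = n := by omega
      rw [dif_pos rfl, Category.assoc, Iso.hom_inv_id_assoc, ← Category.assoc, ← tensorMap_comp,
        Iso.hom_inv_id, eqToHom_refl, Category.comp_id, tensorMap_id, Category.id_comp]
    · have h1 : 𝟙 ((regularComplex 𝒜).X p) = 0 := (HomologicalComplex.isZero_single_obj_X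
        (ComplexShape.up ℤ) 0 (regular 𝒜) p hp).eq_of_src _ _
      have h0 : 𝟙 (tensor ((regularComplex 𝒜).X p) (M.X q)) = 0 := by
        rw [← tensorMap_id, h1, tensorMap_zero_left]
      rw [← Category.id_comp (tensorι _ _ p q n h), h0, dif_neg hp, zero_comp]
      exact zero_comp.symm

lemma lunit_inv_naturality {N N' : GrBimod.{w} 𝒜 ℬ} (f : N ⟶ N') :
    f ≫ (lunit N').inv = (lunit N).inv ≫ tensorMap (𝟙 _) f := rfl

/-- The isomorphism `M ≅ A ⊗_A M` for a complex `M`. -/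
def tensorComplexUnit : M ≅ tensorComplex (regularComplex 𝒜) M :=
  HomologicalComplex.Hom.isoOfComponents (tensorComplexUnitX M) (fun n m h => by
    obtain rfl : n + 1 = m := h
    -- The left factor has zero differential and sits in degree 0, where the Koszul sign is 1, so
    -- only the differential of `M` remains.
    have h0 : (regularComplex 𝒜).d 0 (0 + 1) = 0 := HomologicalComplex.single_obj_d _ _ _ _ _
    change ((lunit _).inv ≫ _ ≫ _) ≫ _ = _ ≫ (lunit _).inv ≫ _ ≫ _
    rw [Category.assoc, Category.assoc, tensorι_d _ _ _ _ _ rfl, h0, tensorMap_zero_left, zero_comp,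
      zero_add, Int.negOnePow_zero, one_smul, ← Category.assoc (tensorMap _ _), ← tensorMap_comp,
      ← Category.assoc (M.d n (n + 1)), lunit_inv_naturality, Category.assoc,
      ← Category.assoc (tensorMap _ _), ← tensorMap_comp]
    simp only [Category.comp_id, Category.id_comp])

lemma tensorComplexUnit_naturality {M M' : CochainComplex (GrBimod.{w} 𝒜 ℬ) ℤ} (f : M ⟶ M') :
    f ≫ (tensorComplexUnit M').hom =
      (tensorComplexUnit M).hom ≫ tensorComplexMap (𝟙 (regularComplex 𝒜)) f := by
  ext n : 1
  change f.f n ≫ (lunit _).inv ≫ _ ≫ _ = ((lunit _).inv ≫ _ ≫ _) ≫ _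
  rw [Category.assoc, Category.assoc, tensorι_map, ← Category.assoc (f.f n), lunit_inv_naturality,
    Category.assoc, ← Category.assoc (tensorMap _ _) (tensorMap _ _), ← tensorMap_comp,
    ← Category.assoc (tensorMap _ _) (tensorMap _ _), ← tensorMap_comp]
  simp only [Category.comp_id, Category.id_comp, HomologicalComplex.id_f]

variable (𝒜 ℬ) in
/-- The functor `A ⊗_A -` is isomorphic to the identity. -/
def tensorLeftHomotopyUnit : 𝟭 _ ≅ tensorLeftHomotopy.{w} ℬ (regularComplex 𝒜) :=
  CategoryTheory.Quotient.natIsoLift _ (NatIso.ofComponents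
    (fun M => (HomotopyCategory.quotient _ _).mapIso (tensorComplexUnit M))
    (fun f => congrArg (HomotopyCategory.quotient _ _).map
      (tensorComplexUnit_naturality f)))

end Unit

end GrBimod

/-! ### Finitely generated projective modules -/

/-- The maps exhibit `Y` as a direct summand of the finite sum of the `X j`. -/
lemma finite_projective_of_sum {R : Type*} [Ring R] {J : Type*} [Fintype J] {X : J → Type*}
    [∀ j, AddCommGroup (X j)] [∀ j, Module R (X j)] [∀ j, Module.Finite R (X j)]
    [∀ j, Module.Projective R (X j)] {Y : Type*} [AddCommGroup Y] [Module R Y]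
    (s : ∀ j, Y →ₗ[R] X j) (t : ∀ j, X j →ₗ[R] Y) (h : ∀ y, ∑ j, t j (s j y) = y) :
    Module.Finite R Y ∧ Module.Projective R Y := by
  classical
  have := Module.Projective.of_equiv' (DFinsupp.linearEquivFunOnFintype (R := R) (M := X))
  -- The auxiliary scalars of `lsum` are ℕ because `R` need not be commutative.
  let p : (∀ j, X j) →ₗ[R] Y := LinearMap.lsum R X ℕ t
  have hp : p ∘ₗ LinearMap.pi s = LinearMap.id := LinearMap.ext fun y => by
    simpa [p] using h y
  exact ⟨Module.Finite.of_surjective p fun y => ⟨_, LinearMap.congr_fun hp y⟩,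
    Module.Projective.of_split _ _ hp⟩

namespace GrBimod

section Projective

variable {A : Type v₁} [Ring A] [Algebra ℂ A] {B : Type v₂} [Ring B] [Algebra ℂ B]
  {𝒜 : ℤ → Submodule ℂ A} {ℬ : ℤ → Submodule ℂ B}

lemma sum_toLin_apply {M N : GrBimod.{w} 𝒜 ℬ} {J : Type*} (s : Finset J) (f : J → (M ⟶ N))
    (m : M.carrier) : toLin (∑ j ∈ s, f j) m = ∑ j ∈ s, toLin (f j) m :=
  map_sum (AddMonoidHom.mk' (fun f : M ⟶ N => toLin f m) fun _ _ => rfl) f s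

lemma isFGProjective_of_sum {J : Type*} [Fintype J] {X : J → GrMod.{w} 𝒜} {Y : GrMod.{w} 𝒜}
    (hX : ∀ j, IsFGProjective (X j)) (s : ∀ j, Y ⟶ X j) (t : ∀ j, X j ⟶ Y)
    (h : ∑ j, s j ≫ t j = 𝟙 Y) : IsFGProjective Y := by
  let := fun j => (X j).leftModule
  let := Y.leftModule
  have := fun j => (hX j).1
  have := fun j => (hX j).2
  refine finite_projective_of_sum (R := A) (X := fun j => (X j).carrier)
    (fun j => { toFun := toLin (s j), map_add' := map_add _, map_smul' := toLin_lact (s j) })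
    (fun j => { toFun := toLin (t j), map_add' := map_add _, map_smul' := toLin_lact (t j) })
    fun y => ?_
  have := congrArg (fun f => toLin f y) h
  exact (sum_toLin_apply _ _ _).symm.trans this

lemma isFGProjective_of_iso {X Y : GrMod.{w} 𝒜} (e : X ≅ Y) (hX : IsFGProjective X) :
    IsFGProjective Y :=
  isFGProjective_of_sum (J := Unit) (fun _ => hX) (fun _ => e.inv) (fun _ => e.hom) (by simp)

end Projective

section Presents

variable {A : Type v₁} [Ring A] [Algebra ℂ A] {B : Type v₂} [Ring B] [Algebra ℂ B]
  {C : Type v₃} [Ring C] [Algebra ℂ C] {𝒜 : ℤ → Submodule ℂ A} {ℬ : ℤ → Submodule ℂ B}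
  {𝒞 : ℤ → Submodule ℂ C} [GradedAlgebra ℬ]
  {T : MatrixData (GrBimod.{w} 𝒜 ℬ)} {K : CochainComplex (GrBimod.{w} 𝒜 ℬ) ℤ}
  (M : T.Presents K) (L : CochainComplex (GrBimod.{w} ℬ 𝒞) ℤ)

/-- The projection from a term of `K ⊗ L` to the summand given by an entry of `K`. -/
def tensorProj (n : ℤ) (j : T.J) : (tensorComplex K L).X n ⟶ tensor (T.X j) (L.X (n - T.deg j)) :=
  tensorDesc fun p q h => if hp : T.deg j = p then
    tensorMap (M.π j p) (eqToHom (by rw [hp, ← h, add_sub_cancel_left])) else 0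

/-- The inclusion into a term of `K ⊗ L` of the summand given by an entry of `K`. -/
def tensorIncl (n : ℤ) (j : T.J) : tensor (T.X j) (L.X (n - T.deg j)) ⟶ (tensorComplex K L).X n :=
  tensorMap (M.ι j (T.deg j)) (𝟙 _) ≫
    tensorι K L (T.deg j) (n - T.deg j) n (add_sub_cancel _ _)

/-- On `K^p ⊗ L^q` the composite through entry `j` is the projector of `K^p` onto that entry,
tensored with the identity; summing over `j` then recovers the identity by `total`. -/
lemma tensorι_proj_incl (p q n : ℤ) (h : p + q = n) (j : T.J) :
    tensorι K L p q n h ≫ tensorProj M L n j ≫ tensorIncl M L n j =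
      tensorMap (M.π j p ≫ M.ι j p) (𝟙 _) ≫ tensorι K L p q n h := by
  rw [tensorProj, ← Category.assoc, tensorι_desc]
  split_ifs with hp
  · subst hp
    obtain rfl : q = n - T.deg j := by omega
    rw [tensorIncl, ← Category.assoc, ← tensorMap_comp, eqToHom_refl, Category.comp_id]
  · rw [M.π_eq_zero j p hp, zero_comp, zero_comp, tensorMap_zero_left, zero_comp]

/-- Although the total complex is an infinite coproduct in each degree, its terms are summands of a
finite sum, because `K` has finitely many entries. Projectivity and boundedness follow from this. -/
lemma tensorProj_incl (n : ℤ) : ∑ j, tensorProj M L n j ≫ tensorIncl M L n j = 𝟙 _ := by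
  refine tensorComplex_hom_ext fun p q h => ?_
  rw [Preadditive.comp_sum, Finset.sum_congr rfl fun j _ => tensorι_proj_incl M L p q n h j,
    ← Preadditive.sum_comp, ← tensorMap_sum_left, M.total, tensorMap_id, Category.id_comp,
    Category.comp_id]

lemma isZero_tensor {N : GrBimod.{w} 𝒜 ℬ} {N' : GrBimod.{w} ℬ 𝒞} (h : IsZero N') :
    IsZero (tensor N N') := by
  rw [IsZero.iff_id_eq_zero, ← tensorMap_id, h.eq_of_src (𝟙 N') 0, tensorMap_zero_right]

lemma isZero_tensorComplex_X (M : T.Presents K) (n : ℤ) (h : ∀ j, IsZero (L.X (n - T.deg j))) :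
    IsZero ((tensorComplex K L).X n) := by
  rw [IsZero.iff_id_eq_zero, ← tensorProj_incl M L n]
  exact Finset.sum_eq_zero fun j _ => by
    rw [(isZero_tensor (h j)).eq_of_src (tensorIncl M L n j) 0, comp_zero]

lemma isPerfect_tensorLeftHomotopy (M : T.Presents K)
    (h : ∀ (j : T.J) (N : GrMod.{w} ℬ), IsFGProjective N → IsFGProjective (tensor (T.X j) N))
    (X : HomotopyCategory (GrMod.{w} ℬ) (ComplexShape.up ℤ)) (hX : isPerfect ℬ X) :
    isPerfect 𝒜 ((tensorLeftHomotopy trivGr K).obj X) := by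
  obtain ⟨h1, a, b, h2⟩ := hX
  have h3 : ∀ n, IsFGProjective ((tensorComplex K X.as).X n) := fun n =>
    isFGProjective_of_sum (fun j => h j _ (h1 (n - T.deg j)))
      (tensorProj M X.as n) (tensorIncl M X.as n) (tensorProj_incl M X.as n)
  -- The sum of the absolute values of the degrees of the entries is a crude common bound for the
  -- shifts involved.
  have h4 : ∀ n, n < a - ∑ j, |T.deg j| ∨ b + ∑ j, |T.deg j| < n →
      IsZero ((tensorComplex K X.as).X n) := fun n hn => by
    refine isZero_tensorComplex_X X.as M n fun j => h2 (n - T.deg j) ?_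
    have hj : |T.deg j| ≤ ∑ j, |T.deg j| :=
      Finset.single_le_sum (f := fun j => |T.deg j|) (fun j _ => abs_nonneg _) (Finset.mem_univ j)
    rw [abs_le] at hj
    omega
  exact ⟨h3, _, _, h4⟩

end Presents

end GrBimod

open GrBimod

/-! ### Preservation of perfect complexes -/

section Perfect

variable {V : Type u} [Fintype V] {Γ : SimpleGraph V}

/-- The algebra is finite-dimensional, so finite generation passes from A to ℂ. This is what makes A
⊗_ℂ N finitely generated over A. -/
lemma finite_of_isFGProjective {N : GrMod.{u} (gr Γ)} (h : IsFGProjective N) :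
    Module.Finite ℂ N.carrier := by
  let := N.leftModule
  have : IsScalarTower ℂ (Alg Γ) N.carrier := ⟨fun c a n => by
    change N.lact (c • a) n = c • N.lact a n
    rw [map_smul, LinearMap.smul_apply]⟩
  have : Module.Finite (Alg Γ) N.carrier := h.1
  exact Module.Finite.trans (Alg Γ) N.carrier

variable (i : V) (p : ℤ) (N : GrMod.{u} (gr Γ))

/-- The trilinear map `p ⊗ q ⊗ n ↦ p ⊗ q n`. -/
def contractTrilin : (P Γ i).carrier →ₗ[ℂ] (Q Γ i).carrier →ₗ[ℂ] N.carrier →ₗ[ℂ]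
    Alg Γ ⊗[ℂ] N.carrier :=
  LinearMap.mk₂ ℂ (fun x y => TensorProduct.mk ℂ (Alg Γ) N.carrier x.1 ∘ₗ N.lact y.1)
    (fun x x' y => by ext n; simp)
    (fun c x y => by ext n; simp [TensorProduct.smul_tmul'])
    (fun x y y' => by ext n; simp [TensorProduct.tmul_add])
    (fun c x y => by ext n; simp)

/-- The map `(P_i ⊗ Q_i) × N → A ⊗_ℂ N`. -/
def contractBilin : (Bs Γ i i p).carrier →ₗ[ℂ] N.carrier →ₗ[ℂ] Alg Γ ⊗[ℂ] N.carrier :=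
  tensorLift (M := P Γ i) (N := Q Γ i) (X := N.carrier →ₗ[ℂ] Alg Γ ⊗[ℂ] N.carrier)
      (contractTrilin i N) fun x c y => by
    ext n
    simp [contractTrilin, Algebra.ofId_apply]

lemma contractBilin_bs (a b : Alg Γ) (n : N.carrier) :
    contractBilin i p N (bs Γ i i p a b) n = (a * e i) ⊗ₜ[ℂ] N.lact (e i * b) n := rfl

lemma contractBilin_balanced (x : (Bs Γ i i p).carrier) (a : Alg Γ) (n : N.carrier) :
    contractBilin i p N ((Bs Γ i i p).ract (MulOpposite.op a) x) n =
      contractBilin i p N x (N.lact a n) := by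
  refine Bs_induction x ?_ (fun b c => ?_) (fun x y hx hy => ?_)
  · simp only [map_zero, LinearMap.zero_apply]
  · rw [ract_bs, contractBilin_bs, contractBilin_bs, ← mul_assoc, map_mul N.lact (e i * c),
      Module.End.mul_apply]
  · simp only [map_add, LinearMap.add_apply, hx, hy]

/-- The map `(P_i ⊗ Q_i) ⊗_A N → A ⊗_ℂ N`. -/
def contractLin : TensorCarrier (Bs Γ i i p) N →ₗ[ℂ] Alg Γ ⊗[ℂ] N.carrier :=
  tensorLift (contractBilin i p N) (contractBilin_balanced i p N)

/-- The map `A ⊗_ℂ N → (P_i ⊗ Q_i) ⊗_A N`, `a ⊗ n ↦ (a e_i ⊗ e_i) ⊗ n`. -/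
def expandLin : Alg Γ ⊗[ℂ] N.carrier →ₗ[ℂ] TensorCarrier (Bs Γ i i p) N :=
  TensorProduct.lift (tmulBilin (Bs Γ i i p) N ∘ₗ (bsBilin Γ i i p).flip 1)

@[elab_as_elim]
lemma tensor_Bs_induction {φ : TensorCarrier (Bs Γ i i p) N → Prop}
    (x : TensorCarrier (Bs Γ i i p) N) (zero : φ 0)
    (tmul : ∀ a b n, φ (tmul (M := Bs Γ i i p) (bs Γ i i p a b) n))
    (add : ∀ x y, φ x → φ y → φ (x + y)) : φ x := by
  refine tensor_induction x zero (fun y n => ?_) add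
  refine Bs_induction y ?_ (fun a b => tmul a b n) (fun x y hx hy => ?_)
  · rw [GrBimod.zero_tmul (M := Bs Γ i i p)]; exact zero
  · rw [GrBimod.add_tmul (M := Bs Γ i i p)]; exact add _ _ hx hy

/-- The contraction lets the factor e_i b act on `n`; balancing over A moves it back. -/
lemma expandLin_contractLin (x : TensorCarrier (Bs Γ i i p) N) :
    expandLin i p N (contractLin i p N x) = x := by
  refine tensor_Bs_induction i p N x ?_ (fun a b n => ?_) (fun x y hx hy => ?_)
  · simp only [map_zero]
  · change tmul (M := Bs Γ i i p) (bs Γ i i p (a * e i) 1) (N.lact (e i * b) n) = _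
    rw [← ract_tmul (M := Bs Γ i i p), ract_bs]
    refine congrArg (fun x => tmul (M := Bs Γ i i p) x n) ?_
    rw [one_mul, bs_mul_e, bs_e_mul]
  · simp only [map_add, hx, hy]

/-- (P_i ⊗ Q_i) ⊗_A N is P_i ⊗_ℂ e_i N, a summand of A ⊗_ℂ N. The latter is free of finite rank over
A because N is finite-dimensional. The grading plays no role here. -/
lemma isFGProjective_tensor_Bs (h : IsFGProjective N) :
    IsFGProjective (tensor (Bs Γ i i p) N) := by
  have := finite_of_isFGProjective h
  let := (tensor (Bs Γ i i p) N).leftModule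
  refine finite_projective_of_sum (R := Alg Γ) (J := Unit)
    (X := fun _ => Alg Γ ⊗[ℂ] N.carrier)
    (fun _ =>
      { toFun := contractLin i p N
        map_add' := map_add _
        map_smul' := fun c x => ?_ })
    (fun _ =>
      { toFun := expandLin i p N
        map_add' := map_add _
        map_smul' := fun c x => ?_ })
    (fun y => (Fintype.sum_unique _).trans (expandLin_contractLin i p N y))
  · change contractLin i p N ((tensor (Bs Γ i i p) N).lact c x) = c • contractLin i p N x
    refine tensor_Bs_induction i p N x ?_ (fun a b n => ?_) (fun x y hx hy => ?_)
    · simp only [map_zero, smul_zero]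
    · rw [tensor_lact_tmul (M := Bs Γ i i p), lact_bs]
      change (c * a * e i) ⊗ₜ[ℂ] N.lact (e i * b) n = c • ((a * e i) ⊗ₜ[ℂ] N.lact (e i * b) n)
      rw [TensorProduct.smul_tmul', smul_eq_mul, mul_assoc]
    · simp only [map_add, hx, hy, smul_add]
  · change expandLin i p N (c • x) = (tensor (Bs Γ i i p) N).lact c (expandLin i p N x)
    induction x with
    | zero => simp only [map_zero, smul_zero]
    | tmul a n =>
      rw [TensorProduct.smul_tmul']
      change tmul (M := Bs Γ i i p) (bs Γ i i p (c * a) 1) n = (tensor (Bs Γ i i p) N).lact c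
        (tmul (M := Bs Γ i i p) (bs Γ i i p a 1) n)
      rw [tensor_lact_tmul (M := Bs Γ i i p), lact_bs]
    | add x y hx hy => simp only [map_add, smul_add, hx, hy]

lemma isFGProjective_tensor_regular (h : IsFGProjective N) :
    IsFGProjective (tensor (regular (gr Γ)) N) :=
  isFGProjective_of_iso (lunit N).symm h

lemma isPerfect_twist (X : HomotopyCategory (GrMod.{u} (gr Γ)) (ComplexShape.up ℤ))
    (hX : isPerfect (gr Γ) X) :
    isPerfect (gr Γ) ((tensorLeftHomotopy trivGr (twist Γ i)).obj X) :=
  isPerfect_tensorLeftHomotopy (twistPresents Γ i)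
    (fun
      | false => isFGProjective_tensor_Bs i 0
      | true => isFGProjective_tensor_regular) X hX

lemma isPerfect_twistInv (X : HomotopyCategory (GrMod.{u} (gr Γ)) (ComplexShape.up ℤ))
    (hX : isPerfect (gr Γ) X) :
    isPerfect (gr Γ) ((tensorLeftHomotopy trivGr (twistInv Γ i)).obj X) :=
  isPerfect_tensorLeftHomotopy (twistInvPresents Γ i)
    (fun
      | false => isFGProjective_tensor_regular
      | true => isFGProjective_tensor_Bs i (-2)) X hX

end Perfect

/-! ### Restricting endofunctors to a full subcategory -/

section Restrict

variable {C D : Type*} [Category C] [Category D] {I : C ⥤ D} {F G : C ⥤ C} {T S : D ⥤ D}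

/-- Compositions of functors compatible with `I` are compatible with `I`. -/
def restrictComp (a : F ⋙ I ≅ I ⋙ T) (b : G ⋙ I ≅ I ⋙ S) : (F ⋙ G) ⋙ I ≅ I ⋙ (T ⋙ S) :=
  Functor.associator _ _ _ ≪≫ Functor.isoWhiskerLeft F b ≪≫ (Functor.associator _ _ _).symm ≪≫
    Functor.isoWhiskerRight a S ≪≫ Functor.associator _ _ _

/-- Isomorphisms of functors restrict along a fully faithful functor. -/
def restrictIso [I.Full] [I.Faithful] (a : F ⋙ I ≅ I ⋙ T) (b : G ⋙ I ≅ I ⋙ S) (e : T ≅ S) :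
    F ≅ G :=
  Functor.fullyFaithfulCancelRight I (a ≪≫ Functor.isoWhiskerLeft I e ≪≫ b.symm)

/-- The identity functor is compatible with `I`. -/
def restrictId : 𝟭 C ⋙ I ≅ I ⋙ 𝟭 D := Functor.leftUnitor _ ≪≫ (Functor.rightUnitor _).symm

end Restrict

lemma AutEq.mk_eq_mk {D : Type*} [Category D] {F G : D ≌ D} (h : F.functor ≅ G.functor) :
    AutEq.mk F = AutEq.mk G := Quotient.sound ⟨h⟩

open GrBimod

/-! ### The action of the Artin–Tits group -/

section Action

variable {V : Type u} [Fintype V] (Γ : SimpleGraph V)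

/-- The endofunctor `Σ_i ⊗ -` of `C_Γ`. -/
def twistFunctor (i : V) : CatΓ Γ ⥤ CatΓ Γ :=
  (isPerfect.{u} (gr Γ)).lift (incl Γ ⋙ tensorLeftHomotopy trivGr (twist Γ i))
    fun X => isPerfect_twist i X.obj X.property

/-- The endofunctor `Σ_i⁻¹ ⊗ -` of `C_Γ`. -/
def twistInvFunctor (i : V) : CatΓ Γ ⥤ CatΓ Γ :=
  (isPerfect.{u} (gr Γ)).lift (incl Γ ⋙ tensorLeftHomotopy trivGr (twistInv Γ i))
    fun X => isPerfect_twistInv i X.obj X.property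

/-- The functor `Σ_i ⊗ -` on `C_Γ` is the restriction of the one on all complexes. -/
def twistFunctorIncl (i : V) :
    twistFunctor Γ i ⋙ incl Γ ≅ incl Γ ⋙ tensorLeftHomotopy trivGr (twist Γ i) :=
  (isPerfect.{u} (gr Γ)).liftCompιIso _ _

/-- The functor `Σ_i⁻¹ ⊗ -` on `C_Γ` is the restriction of the one on all complexes. -/
def twistInvFunctorIncl (i : V) :
    twistInvFunctor Γ i ⋙ incl Γ ≅ incl Γ ⋙ tensorLeftHomotopy trivGr (twistInv Γ i) :=
  (isPerfect.{u} (gr Γ)).liftCompιIso _ _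

/-- The composition of tensor product functors with inverse complexes is the identity. -/
def tensorLeftHomotopyInverse {K L : CochainComplex (GrBimod.{u} (gr Γ) (gr Γ)) ℤ}
    (e : HomotopyEquiv (tensorComplex K L) (unitComplex Γ)) :
    𝟭 _ ≅ tensorLeftHomotopy trivGr L ⋙ tensorLeftHomotopy trivGr K :=
  tensorLeftHomotopyUnit (gr Γ) trivGr ≪≫ (tensorLeftHomotopyCongr trivGr e).symm ≪≫
    tensorLeftHomotopyComp trivGr K L

/-- The autoequivalence `Σ_i ⊗ -` of `C_Γ`. -/
def twistEquivalence (i : V) : CatΓ Γ ≌ CatΓ Γ :=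
  -- The unit comes from Σ_i⁻¹ ⊗ Σ_i ≃ A and the counit from Σ_i ⊗ Σ_i⁻¹ ≃ A. They are chosen
  -- independently; `Equivalence.mk` adjusts them to satisfy the triangle identity.
  .mk (twistFunctor Γ i) (twistInvFunctor Γ i)
    (restrictIso restrictId (restrictComp (twistFunctorIncl Γ i) (twistInvFunctorIncl Γ i))
      (tensorLeftHomotopyInverse Γ (twistInv_twist Γ i).some))
    (restrictIso restrictId (restrictComp (twistInvFunctorIncl Γ i) (twistFunctorIncl Γ i))
      (tensorLeftHomotopyInverse Γ (twist_twistInv Γ i).some)).symm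

lemma twistEquivalence_comm {i j : V} (hij : i ≠ j) (h : ¬ Γ.Adj i j) :
    AutEq.mk (twistEquivalence Γ i) * AutEq.mk (twistEquivalence Γ j) =
      AutEq.mk (twistEquivalence Γ j) * AutEq.mk (twistEquivalence Γ i) :=
  AutEq.mk_eq_mk (restrictIso
    -- The product in `AutEq` is F ∘ G, whereas functors are composed here in diagrammatic order, so
    -- the factors appear reversed.
    (restrictComp (twistFunctorIncl Γ j) (twistFunctorIncl Γ i))
    (restrictComp (twistFunctorIncl Γ i) (twistFunctorIncl Γ j))
    ((tensorLeftHomotopyComp trivGr _ _).symm ≪≫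
      tensorLeftHomotopyCongr trivGr (twist_comm i j hij h).some ≪≫
      tensorLeftHomotopyComp trivGr _ _))

lemma twistEquivalence_braid {i j : V} (h : Γ.Adj i j) :
    AutEq.mk (twistEquivalence Γ i) * AutEq.mk (twistEquivalence Γ j) *
        AutEq.mk (twistEquivalence Γ i) =
      AutEq.mk (twistEquivalence Γ j) * AutEq.mk (twistEquivalence Γ i) *
        AutEq.mk (twistEquivalence Γ j) :=
  AutEq.mk_eq_mk (restrictIso
    (restrictComp (twistFunctorIncl Γ i)
      (restrictComp (twistFunctorIncl Γ j) (twistFunctorIncl Γ i)))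
    (restrictComp (twistFunctorIncl Γ j)
      (restrictComp (twistFunctorIncl Γ i) (twistFunctorIncl Γ j)))
    -- The threefold composite is bracketed to match (Σ_i ⊗ Σ_j) ⊗ Σ_i: the two functors applied
    -- last are merged first, and then the remaining one is joined to them.
    (Functor.isoWhiskerLeft _ (tensorLeftHomotopyComp trivGr _ _).symm ≪≫
      (tensorLeftHomotopyComp trivGr _ _).symm ≪≫
      tensorLeftHomotopyCongr trivGr (twist_braid h).some ≪≫
      tensorLeftHomotopyComp trivGr _ _ ≪≫
      Functor.isoWhiskerLeft _ (tensorLeftHomotopyComp trivGr _ _)))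

/-- The weak action of the Artin–Tits group on `C_Γ`. -/
def artinTitsAction : ArtinTits Γ →* AutEq (CatΓ Γ) :=
  PresentedGroup.toGroup (f := fun i => AutEq.mk (twistEquivalence Γ i)) (by
    -- Each relator has the form u v⁻¹, so its image is trivial once u and v have the same image.
    rintro r (⟨i, j, h, rfl⟩ | ⟨i, j, hij, h, rfl⟩)
    · simp only [map_mul, map_inv, FreeGroup.lift_apply_of]
      exact mul_inv_eq_one.2 (twistEquivalence_braid Γ h)
    · simp only [map_mul, map_inv, FreeGroup.lift_apply_of]
      exact mul_inv_eq_one.2 (twistEquivalence_comm Γ hij h))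

lemma artinTitsAction_σ (i : V) :
    artinTitsAction Γ (ArtinTits.σ Γ i) = AutEq.mk (twistEquivalence Γ i) :=
  PresentedGroup.toGroup.of _

end Action

end ZigZag

end

theorem mainTheorem1 {V : Type u} [Fintype V] (Γ : SimpleGraph V) :
    (∀ i : V,
      Nonempty (HomotopyEquiv
        (ZigZag.GrBimod.tensorComplex (ZigZag.twist Γ i) (ZigZag.twistInv Γ i))
        (ZigZag.unitComplex Γ)) ∧
      Nonempty (HomotopyEquiv
        (ZigZag.GrBimod.tensorComplex (ZigZag.twistInv Γ i) (ZigZag.twist Γ i))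
        (ZigZag.unitComplex Γ))) ∧
    (∀ i j : V, Γ.Adj i j → Nonempty (HomotopyEquiv
      (ZigZag.GrBimod.tensorComplex
        (ZigZag.GrBimod.tensorComplex (ZigZag.twist Γ i) (ZigZag.twist Γ j)) (ZigZag.twist Γ i))
      (ZigZag.GrBimod.tensorComplex
        (ZigZag.GrBimod.tensorComplex (ZigZag.twist Γ j) (ZigZag.twist Γ i))
        (ZigZag.twist Γ j)))) ∧
    (∀ i j : V, i ≠ j → ¬ Γ.Adj i j → Nonempty (HomotopyEquiv
      (ZigZag.GrBimod.tensorComplex (ZigZag.twist Γ i) (ZigZag.twist Γ j))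
      (ZigZag.GrBimod.tensorComplex (ZigZag.twist Γ j) (ZigZag.twist Γ i)))) ∧
    ∃ ρ : ZigZag.ArtinTits Γ →* ZigZag.AutEq (ZigZag.CatΓ Γ),
      ∀ i : V, ∃ F : ZigZag.CatΓ Γ ≌ ZigZag.CatΓ Γ,
        ρ (ZigZag.ArtinTits.σ Γ i) = ZigZag.AutEq.mk F ∧
        Nonempty (F.functor ⋙ ZigZag.incl Γ ≅
          ZigZag.incl Γ ⋙ ZigZag.GrBimod.tensorLeftHomotopy ZigZag.trivGr (ZigZag.twist Γ i)) ∧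
        Nonempty (F.inverse ⋙ ZigZag.incl Γ ≅
          ZigZag.incl Γ ⋙
            ZigZag.GrBimod.tensorLeftHomotopy ZigZag.trivGr (ZigZag.twistInv Γ i)) :=
  ⟨fun i => ⟨ZigZag.twist_twistInv Γ i, ZigZag.twistInv_twist Γ i⟩,
    fun _ _ h => ZigZag.twist_braid h,
    fun i j hij h => ZigZag.twist_comm i j hij h,
    ZigZag.artinTitsAction Γ, fun i => ⟨ZigZag.twistEquivalence Γ i,
      ZigZag.artinTitsAction_σ Γ i, ⟨ZigZag.twistFunctorIncl Γ i⟩,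
      ⟨ZigZag.twistInvFunctorIncl Γ i⟩⟩⟩
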